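/- Let $X,Y$ be relatively prime real polynomials in $x,y$, $X=\sum_{k=0}^n X_k$, $Y=\sum_{k=0}^n Y_k$ with $X_k,Y_k$ homogeneous of degree $k$ and $X_n,Y_n$ not both identically zero, and consider the system $$(D)\qquad \frac{dx}{dt}=X(x,y),\qquad \frac{dy}{dt}=Y(x,y).$$ Suppose that $(D)$ is projectively nonsingular, i.e. $xY_n(x,y)-yX_n(x,y)\not\equiv 0$. *Points at infinity.* Near its boundary circle, the closed projective circle (Poincaré disc) is described by coordinates $(\theta,\rho)$, $\rho\ge 0$, where $x=\cos\theta/\rho$, $y=\sin\theta/\rho$ for $\rho>0$ and $\rho=0$ is the boundary. After the change of time $dt=\rho^{\,n-1}ds$, system $(D)$ extends to $\rho=0$, and the boundary consists of trajectories. The equilibrium states at infinity are the equilibrium states on $\rho=0$. Let $L_1=(\theta_1,0)$ and $L_2=(\theta_2,0)$, $\theta_1<\theta_2$, be adjacent ones, i.e. the open boundary arc $A=\{(\theta,0):\theta_1<\theta<\theta_2\}$ contains no equilibrium state. (They may represent the same point of the projective plane.) *The point $M_\infty$.* Let $M_\infty$ be the infinitely remote point of the extended plane $\overline{Oxy}=Oxy\sqcup\{M_\infty\}$.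 Bendixson's transformation $x=4u/(u^2+v^2)$, $y=4v/(u^2+v^2)$ and a change of time $(u^2+v^2)^m\,d\tau=dt$, with an integer $m\ge0$, turn $(D)$ into a system $du/d\tau=U(u,v)$, $dv/d\tau=V(u,v)$ with relatively prime polynomials $U,V$. The point $M_\infty$ corresponds to the origin $O^*$ of the plane $O^*uv$; it is an equilibrium state if $O^*$ is one, and its Bendixson sectors are those of $O^*$. Suppose that $M_\infty$ is an equilibrium state. *Sectors.* A (closed) Bendixson sector $S$ of an equilibrium state $p$ of a planar vector field is called parabolic, hyperbolic or elliptic if there is a homeomorphism of the half disc $\{z\in\mathbb C:|z|\le 1,\ \operatorname{Im}z\ge 0\}$ onto $S$ that takes $0$ to $p$ and takes trajectory arcs to trajectory arcs, all with preservation or all with reversal of the direction of movement, for the model $z'=z$, $z'=|z|^2$ or $z'=z^2$, respectively. The images of the segments $(0,1]$ and $[-1,0)$ are the bounding half-trajectories of $S$. An exterior sector of $L_i$ adjacent to the arc $A$ is a Bendixson sector of $L_i$ in $\{\rho\ge 0\}$ one of whose bounding half-trajectories lies on $A$ while all its other points, except $L_i$, lie in the finite plane ($\rho>0$). **Claim.**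 Let $S_1$ and $S_2$ be exterior sectors of $L_1$ and $L_2$, respectively, both adjacent to the arc $A$. Then they collapse into one Bendixson sector $T$ of the equilibrium state $M_\infty$, whose type is: - a) elliptic, if $S_1$ and $S_2$ are both parabolic; - b) hyperbolic, if $S_1$ and $S_2$ are both hyperbolic; - c) parabolic, if one of $S_1,S_2$ is parabolic and the other is hyperbolic; - d) elliptic, if one of $S_1,S_2$ is hyperbolic and the other is elliptic. Here "collapse into $T$" means: for some $\theta_1<m_1\le m_2<\theta_2$ with $(m_1,0)\in S_1$ and $(m_2,0)\in S_2$, the set $T$ coincides, in some neighbourhood of $M_\infty$ (that is, of $O^*$), with the image of $S_1\cup S_2\cup\{(\theta,\rho):m_1\le\theta\le m_2,\ \rho\ge0\}$ under the map $(\theta,\rho)\mapsto(u,v)=(4\rho\cos\theta,4\rho\sin\theta)$, which is Bendixson's transformation for $\rho>0$ and takes the whole boundary circle $\rho=0$ to $O^*$. -/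

import Mathlib

open Set Topology

noncomputable section

/-! ### The polynomial system -/

/-- The homogeneous part of degree `k` of a polynomial in `x` and `y`. -/
abbrev homPart (k : ℕ) (P : MvPolynomial (Fin 2) ℝ) : MvPolynomial (Fin 2) ℝ :=
  MvPolynomial.homogeneousComponent k P

/-- The system `dx/dt = X(x, y)`, `dy/dt = Y(x, y)` of degree `n`: the polynomials `X` and `Y` are
sums of homogeneous polynomials of degrees `0, …, n`, those of degree `n` do not both vanish
identically, and `X`, `Y` have no common divisor apart from constants. -/
structure IsPolySystem (n : ℕ) (X Y : MvPolynomial (Fin 2) ℝ) : Prop where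
  degX : X.totalDegree ≤ n
  degY : Y.totalDegree ≤ n
  top : homPart n X ≠ 0 ∨ homPart n Y ≠ 0
  relPrime : IsRelPrime X Y

/-- `W_k(x, y) = x Y_k(x, y) - y X_k(x, y)`. -/
def angularPart (k : ℕ) (X Y : MvPolynomial (Fin 2) ℝ) : MvPolynomial (Fin 2) ℝ :=
  MvPolynomial.X 0 * homPart k Y - MvPolynomial.X 1 * homPart k X

/-- `Z_k(x, y) = x X_k(x, y) + y Y_k(x, y)`. -/
def radialPart (k : ℕ) (X Y : MvPolynomial (Fin 2) ℝ) : MvPolynomial (Fin 2) ℝ :=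
  MvPolynomial.X 0 * homPart k X + MvPolynomial.X 1 * homPart k Y

/-- The system is projectively nonsingular: `x Y_n - y X_n` is not identically zero. -/
def ProjectivelyNonsingular (n : ℕ) (X Y : MvPolynomial (Fin 2) ℝ) : Prop :=
  angularPart n X Y ≠ 0

/-! ### The projective circle near its boundary

The closed projective circle (the Poincaré disc) is described near its boundary by coordinates
`(θ, ρ)` with `ρ ≥ 0`: for `ρ > 0` they stand for the point `x = cos θ / ρ`, `y = sin θ / ρ`,
and `(θ, 0)` is the boundary point in the direction `θ` (so `θ` counts modulo `2π`). -/

/-- The system in the coordinates `(θ, ρ)`, after the positive change of time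
`dt = ρ ^ (n - 1) ds`, which makes it extend to the boundary `ρ = 0`:
`dθ/ds = ∑ ρ ^ (n - k) W_k(cos θ, sin θ)`, `dρ/ds = - ρ ∑ ρ ^ (n - k) Z_k(cos θ, sin θ)`. -/
def circleField (n : ℕ) (X Y : MvPolynomial (Fin 2) ℝ) (q : ℝ × ℝ) : ℝ × ℝ :=
  (∑ k ∈ Finset.range (n + 1), q.2 ^ (n - k) *
      MvPolynomial.eval ![Real.cos q.1, Real.sin q.1] (angularPart k X Y),
    -(q.2 * ∑ k ∈ Finset.range (n + 1), q.2 ^ (n - k) *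
      MvPolynomial.eval ![Real.cos q.1, Real.sin q.1] (radialPart k X Y)))

/-- The boundary points in the directions `θ₁ < θ₂` are equilibrium states at infinity, and the
open boundary arc from the first to the second contains no further equilibrium state. -/
structure AdjacentAtInfinity (n : ℕ) (X Y : MvPolynomial (Fin 2) ℝ) (θ₁ θ₂ : ℝ) : Prop where
  lt : θ₁ < θ₂
  left : circleField n X Y (θ₁, 0) = 0
  right : circleField n X Y (θ₂, 0) = 0
  between : ∀ θ ∈ Ioo θ₁ θ₂, circleField n X Y (θ, 0) ≠ 0

/-! ### Bendixson sectors of a planar vector field -/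

/-- The trajectory of `F` that starts at `a` runs inside `S` until it comes to `b`. -/
def Reaches (F : ℝ × ℝ → ℝ × ℝ) (S : Set (ℝ × ℝ)) (a b : ℝ × ℝ) : Prop :=
  ∃ (τ : ℝ) (γ : ℝ → ℝ × ℝ), 0 ≤ τ ∧ γ 0 = a ∧ γ τ = b ∧
    ∀ t ∈ Icc 0 τ, γ t ∈ S ∧ HasDerivWithinAt γ (F (γ t)) (Icc 0 τ) t

/-- The three types of Bendixson sectors. -/
inductive SectorType where
  | hyperbolic
  | parabolic
  | elliptic

/-- The closed upper half of the unit disc. -/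
def halfDisc : Set (ℝ × ℝ) := {a | a.1 ^ 2 + a.2 ^ 2 ≤ 1 ∧ 0 ≤ a.2}

/-- The vector field whose phase portrait on the upper half disc is the standard picture of the
type: horizontal lines that pass by the origin, slowed down to a stop there (`z' = |z|²`); rays
from the origin (`z' = z`); circles through the origin tangent to the real axis (`z' = z²`).
In each of them both halves of the real axis are half-trajectories that abut on the origin. -/
def modelField : SectorType → ℝ × ℝ → ℝ × ℝ
  | .hyperbolic, a => (a.1 ^ 2 + a.2 ^ 2, 0)
  | .parabolic, a => (a.1, a.2)
  | .elliptic, a => (a.1 ^ 2 - a.2 ^ 2, 2 * a.1 * a.2)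

/-- `h` is a homeomorphism of the half disc onto `S` with `h 0 = p` that takes the trajectory
arcs of the model on the half disc to the trajectory arcs of `F` on `S`, either all with
preservation or all with reversal of the direction of movement. -/
structure IsSectorChart (F : ℝ × ℝ → ℝ × ℝ) (p : ℝ × ℝ) (κ : SectorType) (S : Set (ℝ × ℝ))
    (h : ℝ × ℝ → ℝ × ℝ) : Prop where
  continuousOn : ContinuousOn h halfDisc
  injOn : InjOn h halfDisc
  image : h '' halfDisc = S
  vertex : h 0 = p
  trajectories :
    (∀ a ∈ halfDisc, ∀ b ∈ halfDisc,
      (Reaches F S (h a) (h b) ↔ Reaches (modelField κ) halfDisc a b)) ∨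
    (∀ a ∈ halfDisc, ∀ b ∈ halfDisc,
      (Reaches F S (h a) (h b) ↔ Reaches (modelField κ) halfDisc b a))

/-- `S` is a (closed) Bendixson sector of type `κ` of the equilibrium state `p` of `F`: it is
topologically equivalent to the model sector of this type. -/
def IsBendixsonSector (F : ℝ × ℝ → ℝ × ℝ) (p : ℝ × ℝ) (κ : SectorType) (S : Set (ℝ × ℝ)) : Prop :=
  F p = 0 ∧ ∃ h, IsSectorChart F p κ S h

/-- `S` is an exterior Bendixson sector, on the side of the boundary arc `A`, of the equilibrium
state at infinity in the direction `θ`: one of its two bounding half-trajectories lies on the arc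
`A` at infinity, and all its other points except the vertex lie in the finite plane. (By the
mirror symmetry of the models it does not matter which half of the real axis is sent to
infinity.) -/
def IsExteriorSector (n : ℕ) (X Y : MvPolynomial (Fin 2) ℝ) (θ : ℝ) (A : Set ℝ) (κ : SectorType)
    (S : Set (ℝ × ℝ)) : Prop :=
  circleField n X Y (θ, 0) = 0 ∧
  ∃ h, IsSectorChart (circleField n X Y) (θ, 0) κ S h ∧
    (∀ x ∈ Ioc (0 : ℝ) 1, (h (x, 0)).1 ∈ A ∧ (h (x, 0)).2 = 0) ∧
    (∀ a ∈ halfDisc, ¬ (a.2 = 0 ∧ 0 ≤ a.1) → 0 < (h a).2)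

/-! ### The infinitely remote point of the extended plane -/

/-- The system `(U, V)` is stereographically conjugate to `(X, Y)`: after Bendixson's
transformation `x = 4u / (u² + v²)`, `y = 4v / (u² + v²)` and the change of time
`(u² + v²) ^ m dτ = dt` the system `(X, Y)` becomes `du/dτ = U(u, v)`, `dv/dτ = V(u, v)` with
relatively prime polynomials `U`, `V`. -/
def StereoConjugate (X Y U V : MvPolynomial (Fin 2) ℝ) : Prop :=
  IsRelPrime U V ∧ ∃ m : ℕ, ∀ u v : ℝ, (u, v) ≠ 0 →
    MvPolynomial.eval ![u, v] U = (u ^ 2 + v ^ 2) ^ m *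
      (-((u ^ 2 - v ^ 2) / 4) *
          MvPolynomial.eval ![4 * u / (u ^ 2 + v ^ 2), 4 * v / (u ^ 2 + v ^ 2)] X
        - u * v / 2 *
          MvPolynomial.eval ![4 * u / (u ^ 2 + v ^ 2), 4 * v / (u ^ 2 + v ^ 2)] Y) ∧
    MvPolynomial.eval ![u, v] V = (u ^ 2 + v ^ 2) ^ m *
      (-(u * v / 2) *
          MvPolynomial.eval ![4 * u / (u ^ 2 + v ^ 2), 4 * v / (u ^ 2 + v ^ 2)] X
        + (u ^ 2 - v ^ 2) / 4 *
          MvPolynomial.eval ![4 * u / (u ^ 2 + v ^ 2), 4 * v / (u ^ 2 + v ^ 2)] Y)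

/-- The vector field `(U, V)` on the plane `O*uv`. The infinitely remote point of the extended
plane `Oxy` is represented by the origin `O*` of this plane; its being an equilibrium state and
its sectors are by definition those of `O*`. -/
def polyField (U V : MvPolynomial (Fin 2) ℝ) (w : ℝ × ℝ) : ℝ × ℝ :=
  (MvPolynomial.eval ![w.1, w.2] U, MvPolynomial.eval ![w.1, w.2] V)

/-- The map from the projective circle near its boundary to the plane `O*uv`. For `ρ > 0` it is
Bendixson's transformation `u = 4x / (x² + y²)`, `v = 4y / (x² + y²)` of `x = cos θ / ρ`,
`y = sin θ / ρ`; it takes the whole boundary circle `ρ = 0` to `O*`. -/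
def collapse (q : ℝ × ℝ) : ℝ × ℝ := (4 * q.2 * Real.cos q.1, 4 * q.2 * Real.sin q.1)

/-- The exterior sectors `S₁` and `S₂`, adjacent to the boundary arc from `θ₁` to `θ₂`, collapse
into one Bendixson sector `T` of type `κ` of the infinitely remote equilibrium state: near that
state, `T` is the image of `S₁`, `S₂` and the strip along the arc that connects them. -/
def CollapseToSector (U V : MvPolynomial (Fin 2) ℝ) (θ₁ θ₂ : ℝ) (S₁ S₂ : Set (ℝ × ℝ))
    (κ : SectorType) : Prop :=
  ∃ T : Set (ℝ × ℝ), IsBendixsonSector (polyField U V) 0 κ T ∧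
    ∃ m₁ m₂ : ℝ, θ₁ < m₁ ∧ m₁ ≤ m₂ ∧ m₂ < θ₂ ∧ (m₁, (0 : ℝ)) ∈ S₁ ∧ (m₂, (0 : ℝ)) ∈ S₂ ∧
      ∃ N ∈ 𝓝 (0 : ℝ × ℝ),
        T ∩ N = collapse '' (S₁ ∪ S₂ ∪ Icc m₁ m₂ ×ˢ Ici (0 : ℝ)) ∩ N

end

/-! ### Trajectory arcs of planar vector fields -/

/-! Reversing time if necessary, one may assume that the movement along `A` goes from `L₁` to `L₂`;
sector charts allow reversal, so nothing is lost. For `ρ > 0` the map `collapse` is polar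
coordinates with radius `4ρ`. It takes the circle field to a positive multiple of `(U, V)` and is
injective on a window of angles of length `2π`, whereas it crushes the whole arc to `O*`. Hence it
suffices to parametrize the part `ρ > 0` of the set `P` formed by `S₁`, `S₂` and the strip, near `ρ
= 0`, by a punctured model half disc, taking model arcs to trajectory arcs and with `ρ → 0` at the
vertex. This is `IsUnion`, and `FieldCollapse.of_isUnion` draws the conclusion. Only the passage
from model arcs to trajectory arcs has to be checked by hand: `isSectorChart_of_arcs` obtains the
converse from uniqueness of integral curves.

The geometry is this. A trajectory of `S₁` close to `A` leaves `S₁`, follows `A` and enters `S₂`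
close to the boundary. If `S₂` is hyperbolic, it turns round `L₂` and goes off along the other
bounding half-trajectory of `S₂`, so the union only prolongs trajectories of `S₁`, and the type of
`S₁` survives; with the mirror image this gives b), c) and d). If both sectors are parabolic, the
trajectories close to `A` come out of `L₁` and end in `L₂`, so after the collapse they are loops at
`O*`; the trajectories farther from `A` fill one fan on each side, as the trajectories near the
sides of an elliptic model do once it is cut off by the unit circle.

To make this precise, a compact part of `A` is covered by a flow box whose trajectories are graphs
over the angle (`exists_isFlowBox`). Near the arc a segment of constant label in the chart of a
sector lies on one such graph, and the label of the graph is a continuous increasing function of the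
label in the chart (`IsLocalChart.exists_isNormal`); comparing the two ends gives a change of labels
`lam` (`exists_transition`). The resulting `bridge` has a position `p` and a label `v`: for `p ≤ 1`
it is the first chart at position `p`, for `1 ≤ p ≤ 2` the flow box, for `p ≥ 2` the second chart at
position `3 - p` and label `lam v`. The lemmas on `Junction` show that it is continuous, injective,
maps segments to arcs and fills `P` near `ρ = 0`.

It remains to map a model half disc to the domain of the bridge. In the hyperbolic case `shiftPos`
stretches trajectories of small label by up to `3` units of position, and all of the positive
half-axis by `3` (`Junction.hyp_isUnion`). In the parabolic case the coordinate `-1/z` straightens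
the elliptic model, and `cutPos`, `squeeze` and `parLev` carry its trajectories to those of the
bridge (`Junction.par_isUnion`). -/

lemma Reaches.refl {F : ℝ × ℝ → ℝ × ℝ} {S : Set (ℝ × ℝ)} {a : ℝ × ℝ} (ha : a ∈ S) :
    Reaches F S a a := by
  refine ⟨0, fun _ => a, le_rfl, rfl, rfl, fun t ht => ⟨ha, ?_⟩⟩
  rw [Icc_self] at ht ⊢
  obtain rfl : t = 0 := ht
  exact hasDerivWithinAt_iff_hasFDerivWithinAt.2 (.of_subsingleton Set.subsingleton_singleton)

lemma Reaches.mono {F : ℝ × ℝ → ℝ × ℝ} {S S' : Set (ℝ × ℝ)} {a b : ℝ × ℝ}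
    (h : Reaches F S a b) (hS : S ⊆ S') : Reaches F S' a b := by
  obtain ⟨τ, γ, h0, ha, hb, h⟩ := h
  exact ⟨τ, γ, h0, ha, hb, fun t ht => ⟨hS (h t ht).1, (h t ht).2⟩⟩

lemma Reaches.left_mem {F : ℝ × ℝ → ℝ × ℝ} {S : Set (ℝ × ℝ)} {a b : ℝ × ℝ}
    (h : Reaches F S a b) : a ∈ S := by
  obtain ⟨τ, γ, h0, ha, hb, h⟩ := h
  exact ha ▸ (h 0 ⟨le_rfl, h0⟩).1

lemma Reaches.right_mem {F : ℝ × ℝ → ℝ × ℝ} {S : Set (ℝ × ℝ)} {a b : ℝ × ℝ}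
    (h : Reaches F S a b) : b ∈ S := by
  obtain ⟨τ, γ, h0, ha, hb, h⟩ := h
  exact hb ▸ (h τ ⟨h0, le_rfl⟩).1

/-- At the junction both one-sided derivatives equal the field at the common point, so the pasted
curve is an integral curve there too; no regularity of the field enters. -/
lemma Reaches.trans {F : ℝ × ℝ → ℝ × ℝ} {S : Set (ℝ × ℝ)} {a b c : ℝ × ℝ}
    (h : Reaches F S a b) (h' : Reaches F S b c) : Reaches F S a c := by
  obtain ⟨τ, γ, h0, ha, hb, h⟩ := h
  obtain ⟨τ', γ', h0', ha', hb', h'⟩ := h'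
  set η : ℝ → ℝ × ℝ := fun t => if t ≤ τ then γ t else γ' (t - τ) with hη
  have e1 : EqOn η γ (Icc 0 τ) := fun t ht => by simp [hη, ht.2]
  have e2 : EqOn η (fun t => γ' (t - τ)) (Icc τ (τ + τ')) := by
    intro t ht
    rcases eq_or_lt_of_le ht.1 with rfl | h1
    · simp [hη, hb, ha']
    · simp [hη, not_le.2 h1]
  have d1 : ∀ t ∈ Icc 0 τ, HasDerivWithinAt η (F (η t)) (Icc 0 τ) t := fun t ht => by
    rw [e1 ht]; exact (h t ht).2.congr e1 (e1 ht)
  have d2 : ∀ t ∈ Icc τ (τ + τ'), HasDerivWithinAt η (F (η t)) (Icc τ (τ + τ')) t := by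
    intro t ht
    have ht' : t - τ ∈ Icc 0 τ' := ⟨by linarith [ht.1], by linarith [ht.2]⟩
    rw [e2 ht]
    refine HasDerivWithinAt.congr ?_ e2 (e2 ht)
    have hm : MapsTo (fun x => x - τ) (Icc τ (τ + τ')) (Icc 0 τ') := fun x hx =>
      ⟨by linarith [hx.1], by linarith [hx.2]⟩
    have := (h' _ ht').2.scomp t ((hasDerivAt_id t).sub_const τ).hasDerivWithinAt hm
    simpa [Function.comp_def] using this
  refine ⟨τ + τ', η, by linarith, ?_, ?_, fun t ht => ?_⟩
  · rw [e1 ⟨le_rfl, h0⟩, ha]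
  · rw [e2 ⟨by linarith, le_rfl⟩]; simpa using hb'
  have hU : Icc 0 (τ + τ') = Icc 0 τ ∪ Icc τ (τ + τ') :=
    (Icc_union_Icc_eq_Icc h0 (by linarith)).symm
  constructor
  · rcases le_total t τ with h1 | h1
    · rw [e1 ⟨ht.1, h1⟩]; exact (h t ⟨ht.1, h1⟩).1
    · rw [e2 ⟨h1, ht.2⟩]; exact (h' _ ⟨by linarith, by linarith [ht.2]⟩).1
  · rw [hU]
    rcases lt_trichotomy t τ with h1 | rfl | h1
    · refine (d1 t ⟨ht.1, h1.le⟩).mono_of_mem_nhdsWithin ?_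
      rw [← hU]
      have : Iio τ ∈ 𝓝 t := Iio_mem_nhds h1
      filter_upwards [mem_nhdsWithin_of_mem_nhds this, self_mem_nhdsWithin] with x hx hx'
      exact ⟨hx'.1, (show x < τ from hx).le⟩
    · exact (d1 t ⟨ht.1, le_rfl⟩).union (d2 t ⟨le_rfl, ht.2⟩)
    · refine (d2 t ⟨h1.le, ht.2⟩).mono_of_mem_nhdsWithin ?_
      rw [← hU]
      have : Ioi τ ∈ 𝓝 t := Ioi_mem_nhds h1
      filter_upwards [mem_nhdsWithin_of_mem_nhds this, self_mem_nhdsWithin] with x hx hx'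
      exact ⟨(show τ < x from hx).le, hx'.2⟩

/-- A curve whose velocity is a positive multiple of the field runs along a trajectory. -/
lemma reaches_of_hasDerivWithinAt_smul {F : ℝ × ℝ → ℝ × ℝ} {S : Set (ℝ × ℝ)} {c : ℝ → ℝ × ℝ}
    {μ : ℝ → ℝ} {p q : ℝ} (hpq : p ≤ q) (hμc : ContinuousOn μ (Icc p q))
    (hμ : ∀ t ∈ Icc p q, 0 < μ t) (hS : ∀ t ∈ Icc p q, c t ∈ S)
    (hc : ∀ t ∈ Icc p q, HasDerivWithinAt c (μ t • F (c t)) (Icc p q) t) :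
    Reaches F S (c p) (c q) := by
  -- The new time is the integral `s` of `μ`, and the curve sought is `c` composed with the inverse
  -- of `s`. The extension of `μ` to a positive continuous function on the line makes `s`
  -- differentiable at the end points as well.
  set ν : ℝ → ℝ := IccExtend hpq ((Icc p q).domRestrict μ) with hν
  have hνc : Continuous ν := (hμc.domRestrict).Icc_extend'
  have hνpos : ∀ t, 0 < ν t := fun t => hμ _ (projIcc p q hpq t).2
  have hνeq : ∀ t ∈ Icc p q, ν t = μ t := fun t ht => by
    rw [hν, IccExtend_of_mem _ _ ht]; rfl
  set s : ℝ → ℝ := fun x => ∫ u in p..x, ν u with hs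
  have hsd : ∀ x, HasDerivAt s (ν x) x := fun x =>
    intervalIntegral.integral_hasDerivAt_right (hνc.intervalIntegrable _ _)
      (hνc.stronglyMeasurableAtFilter _ _) hνc.continuousAt
  have hsm : StrictMono s := strictMono_of_deriv_pos fun x => by
    rw [(hsd x).deriv]; exact hνpos x
  have hsc : Continuous s := continuous_iff_continuousAt.2 fun x => (hsd x).continuousAt
  have hsp : s p = 0 := by simp [hs]
  have hmaps : s '' Icc p q = Icc 0 (s q) := by
    refine Subset.antisymm ?_ ?_
    · rintro _ ⟨x, hx, rfl⟩
      exact ⟨hsp ▸ hsm.monotone hx.1, hsm.monotone hx.2⟩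
    · rw [← hsp]; exact intermediate_value_Icc hpq hsc.continuousOn
  choose! g hg using fun t (ht : t ∈ Icc 0 (s q)) => (hmaps.symm ▸ ht : t ∈ s '' Icc p q)
  have hgs : ∀ x ∈ Icc p q, g (s x) = x := fun x hx =>
    hsm.injective (hg _ (hmaps ▸ mem_image_of_mem s hx)).2
  have hgm : StrictMonoOn g (Icc 0 (s q)) := fun t ht t' ht' h => by
    rw [← (hg t ht).2, ← (hg t' ht').2] at h
    exact hsm.lt_iff_lt.1 h
  -- The points of `[p, q]` at distance at least `ε` from `g t` have a compact image under `s`,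
  -- which misses `t` and hence a neighbourhood of `t`.
  have hgc : ContinuousOn g (Icc 0 (s q)) := by
    intro t ht
    have hsurj : g '' Icc 0 (s q) = Icc p q := by
      refine Subset.antisymm ?_ fun x hx => ?_
      · rintro _ ⟨t, ht, rfl⟩; exact (hg t ht).1
      · exact ⟨s x, hmaps ▸ mem_image_of_mem s hx, hgs x hx⟩
    rw [Metric.continuousWithinAt_iff]
    by_contra hcon
    push Not at hcon
    obtain ⟨ε, hε, hcon⟩ := hcon
    have hK : IsCompact (Icc p q \ Metric.ball (g t) ε) := isCompact_Icc.diff Metric.isOpen_ball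
    have hcl : IsClosed (s '' (Icc p q \ Metric.ball (g t) ε)) := (hK.image hsc).isClosed
    have hnot : t ∉ s '' (Icc p q \ Metric.ball (g t) ε) := by
      rintro ⟨x, ⟨hx, hx'⟩, rfl⟩
      rw [hgs x hx] at hx'
      exact hx' (Metric.mem_ball_self hε)
    obtain ⟨δ, hδ, hb⟩ := Metric.isOpen_iff.1 hcl.isOpen_compl t hnot
    obtain ⟨t', ht', h1, h2⟩ := hcon δ hδ
    exact hb h1 ⟨g t', ⟨(hg t' ht').1, fun h => absurd h (not_lt.2 h2)⟩, (hg t' ht').2⟩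
  have h0q : 0 ≤ s q := hsp ▸ hsm.monotone hpq
  refine ⟨s q, c ∘ g, h0q, ?_, ?_, fun t ht => ⟨hS _ (hg t ht).1, ?_⟩⟩
  · simp only [Function.comp]
    conv_lhs => rw [← hsp]
    rw [hgs p ⟨le_rfl, hpq⟩]
  · simp only [Function.comp]; rw [hgs q ⟨hpq, le_rfl⟩]
  · have hgd : HasDerivWithinAt g (ν (g t))⁻¹ (Icc 0 (s q)) t := by
      have h1 : HasDerivWithinAt s (ν (g t)) (Icc p q) (g t) := (hsd _).hasDerivWithinAt
      rw [hasDerivWithinAt_iff_tendsto_slope] at h1 ⊢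
      have h2 : Filter.Tendsto g (𝓝[Icc 0 (s q) \ {t}] t) (𝓝[Icc p q \ {g t}] (g t)) := by
        refine tendsto_nhdsWithin_iff.2 ⟨(hgc t ht).mono_left (nhdsWithin_mono _ sdiff_subset), ?_⟩
        filter_upwards [self_mem_nhdsWithin] with x hx
        exact ⟨(hg x hx.1).1, fun h => hx.2 (hgm.injOn hx.1 ht h)⟩
      have h3 := (h1.comp h2).inv₀ (hνpos _).ne'
      refine h3.congr' ?_
      filter_upwards [self_mem_nhdsWithin] with x hx
      simp only [Function.comp, slope_def_field, (hg x hx.1).2, (hg t ht).2, inv_div]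
    have := (hc (g t) (hg t ht).1).scomp t hgd (fun x hx => (hg x hx).1)
    rw [hνeq _ (hg t ht).1, smul_smul, inv_mul_cancel₀ (hμ _ (hg t ht).1).ne', one_smul] at this
    exact this

/-- Images of trajectory arcs under a map that takes `F` to a positive multiple of `G`. -/
lemma Reaches.map {F G : ℝ × ℝ → ℝ × ℝ} {P : Set (ℝ × ℝ)} {a b : ℝ × ℝ} (h : Reaches F P a b)
    {f : ℝ × ℝ → ℝ × ℝ} {f' : ℝ × ℝ → (ℝ × ℝ →L[ℝ] ℝ × ℝ)} {g : ℝ × ℝ → ℝ}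
    (hf : ∀ q ∈ P, HasFDerivAt f (f' q) q) (hg : ContinuousOn g P) (hpos : ∀ q ∈ P, 0 < g q)
    (hfg : ∀ q ∈ P, f' q (F q) = g q • G (f q)) : Reaches G (f '' P) (f a) (f b) := by
  obtain ⟨τ, γ, h0, rfl, rfl, h⟩ := h
  have hγ : ContinuousOn γ (Icc 0 τ) := fun t ht => (h t ht).2.continuousWithinAt
  refine reaches_of_hasDerivWithinAt_smul (c := f ∘ γ) (μ := g ∘ γ) h0
    (hg.comp hγ fun t ht => (h t ht).1) (fun t ht => hpos _ (h t ht).1)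
    (fun t ht => mem_image_of_mem f (h t ht).1) fun t ht => ?_
  have := (hf _ (h t ht).1).comp_hasDerivWithinAt t (h t ht).2
  rw [hfg _ (h t ht).1] at this
  exact this

lemma Reaches.reverse {F : ℝ × ℝ → ℝ × ℝ} {S : Set (ℝ × ℝ)} {a b : ℝ × ℝ}
    (h : Reaches F S a b) : Reaches (-F) S b a := by
  obtain ⟨τ, γ, h0, rfl, rfl, h⟩ := h
  have hm : ∀ t ∈ Icc 0 τ, τ - t ∈ Icc 0 τ := fun t ht => ⟨by linarith [ht.2], by linarith [ht.1]⟩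
  refine ⟨τ, fun t => γ (τ - t), h0, by simp, by simp, fun t ht => ⟨(h _ (hm t ht)).1, ?_⟩⟩
  have := (h _ (hm t ht)).2.scomp t ((hasDerivAt_id t).const_sub τ).hasDerivWithinAt hm
  simpa [Function.comp_def] using this

lemma reaches_neg_iff {F : ℝ × ℝ → ℝ × ℝ} {S : Set (ℝ × ℝ)} {a b : ℝ × ℝ} :
    Reaches (-F) S a b ↔ Reaches F S b a :=
  ⟨fun h => by simpa using h.reverse, fun h => h.reverse⟩

/-- Integral curves of a locally Lipschitz field with the same initial point agree. -/
lemma integralCurve_unique {F : ℝ × ℝ → ℝ × ℝ} (hF : LocallyLipschitz F) {γ η : ℝ → ℝ × ℝ} {τ : ℝ}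
    (hγ : ∀ t ∈ Icc 0 τ, HasDerivWithinAt γ (F (γ t)) (Icc 0 τ) t)
    (hη : ∀ t ∈ Icc 0 τ, HasDerivWithinAt η (F (η t)) (Icc 0 τ) t) (h0 : γ 0 = η 0) :
    EqOn γ η (Icc 0 τ) := by
  have hγc : ContinuousOn γ (Icc 0 τ) := fun t ht => (hγ t ht).continuousWithinAt
  have hηc : ContinuousOn η (Icc 0 τ) := fun t ht => (hη t ht).continuousWithinAt
  -- A locally Lipschitz field has a Lipschitz constant on each compact set; the two curves together
  -- sweep out one.
  have hK : IsCompact (γ '' Icc 0 τ ∪ η '' Icc 0 τ) :=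
    (isCompact_Icc.image_of_continuousOn hγc).union (isCompact_Icc.image_of_continuousOn hηc)
  obtain ⟨K, hK⟩ := (hF.locallyLipschitzOn).exists_lipschitzOnWith_of_compact hK
  have right : ∀ {f : ℝ → ℝ × ℝ} {f' : ℝ × ℝ} {t : ℝ}, t ∈ Ico 0 τ →
      HasDerivWithinAt f f' (Icc 0 τ) t → HasDerivWithinAt f f' (Ici t) t := by
    intro f f' t ht h
    refine h.mono_of_mem_nhdsWithin ?_
    have : Iio τ ∈ 𝓝 t := Iio_mem_nhds ht.2
    filter_upwards [mem_nhdsWithin_of_mem_nhds this, self_mem_nhdsWithin] with x hx hx'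
    exact ⟨ht.1.trans hx', (show x < τ from hx).le⟩
  exact ODE_solution_unique_of_mem_Icc_right (v := fun _ => F) (K := K)
    (s := fun _ => γ '' Icc 0 τ ∪ η '' Icc 0 τ) (fun _ _ => hK) hγc
    (fun t ht => right ht (hγ t (Ico_subset_Icc_self ht)))
    (fun t ht => Or.inl (mem_image_of_mem _ (Ico_subset_Icc_self ht))) hηc
    (fun t ht => right ht (hη t (Ico_subset_Icc_self ht)))
    (fun t ht => Or.inr (mem_image_of_mem _ (Ico_subset_Icc_self ht))) h0

/-- A trajectory never leaves an equilibrium state. -/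
lemma Reaches.eq_of_left_eq_zero {F : ℝ × ℝ → ℝ × ℝ} (hF : LocallyLipschitz F)
    {S : Set (ℝ × ℝ)} {a b : ℝ × ℝ} (h : Reaches F S a b) (ha : F a = 0) : b = a := by
  obtain ⟨τ, γ, h0, rfl, rfl, h⟩ := h
  refine integralCurve_unique hF (fun t ht => (h t ht).2) (η := fun _ => γ 0) (fun t _ => ?_) rfl
    ⟨h0, le_rfl⟩
  rw [ha]; exact hasDerivWithinAt_const _ _ _

lemma LocallyLipschitz.neg_field {F : ℝ × ℝ → ℝ × ℝ} (hF : LocallyLipschitz F) :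
    LocallyLipschitz (-F) := by
  intro x
  obtain ⟨K, t, ht, h⟩ := hF x
  exact ⟨K, t, ht, h.neg⟩

/-- A trajectory never arrives at an equilibrium state from elsewhere. -/
lemma Reaches.eq_of_right_eq_zero {F : ℝ × ℝ → ℝ × ℝ} (hF : LocallyLipschitz F)
    {S : Set (ℝ × ℝ)} {a b : ℝ × ℝ} (h : Reaches F S a b) (hb : F b = 0) : a = b :=
  h.reverse.eq_of_left_eq_zero hF.neg_field (by simp [hb])

/-- The points of an arc are passed in succession. -/
lemma reaches_of_integralCurve {F : ℝ × ℝ → ℝ × ℝ} {S : Set (ℝ × ℝ)} {γ : ℝ → ℝ × ℝ} {τ t t' : ℝ}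
    (h : ∀ t ∈ Icc 0 τ, γ t ∈ S ∧ HasDerivWithinAt γ (F (γ t)) (Icc 0 τ) t)
    (h0 : 0 ≤ t) (htt : t ≤ t') (ht' : t' ≤ τ) : Reaches F S (γ t) (γ t') := by
  have hm : ∀ u ∈ Icc t t', u ∈ Icc 0 τ := fun u hu => ⟨h0.trans hu.1, hu.2.trans ht'⟩
  refine reaches_of_hasDerivWithinAt_smul (c := γ) (μ := fun _ => 1) htt continuousOn_const
    (fun _ _ => one_pos) (fun u hu => (h u (hm u hu)).1) fun u hu => ?_
  rw [one_smul]; exact (h u (hm u hu)).2.mono hm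

/-- Along a trajectory a function with nonnegative derivative does not decrease. -/
lemma Reaches.fst_le {F : ℝ × ℝ → ℝ × ℝ} {S : Set (ℝ × ℝ)} {a b : ℝ × ℝ} (h : Reaches F S a b)
    (hS : ∀ q ∈ S, 0 ≤ (F q).1) : a.1 ≤ b.1 := by
  obtain ⟨τ, γ, h0, rfl, rfl, h⟩ := h
  have hd : ∀ t ∈ Icc 0 τ, HasDerivWithinAt (fun t => (γ t).1) (F (γ t)).1 (Icc 0 τ) t :=
    fun t ht => (hasFDerivAt_fst (𝕜 := ℝ) (E := ℝ) (F := ℝ)).comp_hasDerivWithinAt t (h t ht).2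
  refine monotoneOn_of_hasDerivWithinAt_nonneg (convex_Icc 0 τ)
    (fun t ht => (hd t ht).continuousWithinAt) (fun t ht => (hd t (interior_subset ht)).mono
      interior_subset) (fun t ht => hS _ (h t (interior_subset ht)).1) ⟨le_rfl, h0⟩ ⟨h0, le_rfl⟩ h0

/-! ### The model fields in coordinates in which their trajectories are horizontal -/

/-- The position of a point on its trajectory. -/
noncomputable def modelPos : SectorType → ℝ × ℝ → ℝ
  | .hyperbolic, a => a.1
  | .parabolic, a => Real.log (√(a.1 ^ 2 + a.2 ^ 2))
  | .elliptic, a => -a.1 / (a.1 ^ 2 + a.2 ^ 2)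

/-- The label of the trajectory of a point. -/
noncomputable def modelLev : SectorType → ℝ × ℝ → ℝ
  | .hyperbolic, a => a.2
  | .parabolic, a => 1 - a.1 / √(a.1 ^ 2 + a.2 ^ 2)
  | .elliptic, a => a.2 / (a.1 ^ 2 + a.2 ^ 2)

/-- The point with given position and label. -/
noncomputable def modelPt : SectorType → ℝ → ℝ → ℝ × ℝ
  | .hyperbolic, p, v => (p, v)
  | .parabolic, p, v => (Real.exp p * (1 - v), Real.exp p * √(2 * v - v ^ 2))
  | .elliptic, p, v => (-p / (p ^ 2 + v ^ 2), v / (p ^ 2 + v ^ 2))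

lemma normSq_pos {a : ℝ × ℝ} (ha : a ≠ 0) : 0 < a.1 ^ 2 + a.2 ^ 2 := by
  rcases eq_or_ne a.1 0 with h | h
  · have : a.2 ≠ 0 := fun h' => ha (Prod.ext h h')
    positivity
  · positivity

lemma pair_ne_zero {x y : ℝ} : ((x, y) : ℝ × ℝ) ≠ 0 ↔ x ≠ 0 ∨ y ≠ 0 := by
  rw [Ne, Prod.ext_iff, not_and_or]; rfl

/-- The coordinates are `z` itself, then `log |z|` with `1 - cos (arg z)`, then the real and
imaginary parts of `-1/z`, which turns `z' = z²` into a constant field. The sign of the ordinate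
matters in the parabolic case, where the sine is recovered as a nonnegative root. -/
lemma modelPt_pos_lev {κ : SectorType} {a : ℝ × ℝ} (ha : a ≠ 0) (h2 : 0 ≤ a.2) :
    modelPt κ (modelPos κ a) (modelLev κ a) = a := by
  have hn := normSq_pos ha
  obtain ⟨x, y⟩ := a
  simp only at hn h2
  cases κ
  · rfl
  · have hs : 0 < √(x ^ 2 + y ^ 2) := Real.sqrt_pos.2 hn
    simp only [modelPt, modelPos, modelLev, Real.exp_log hs]
    have e : 2 * (1 - x / √(x ^ 2 + y ^ 2)) - (1 - x / √(x ^ 2 + y ^ 2)) ^ 2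
        = (y / √(x ^ 2 + y ^ 2)) ^ 2 := by
      have := Real.sq_sqrt hn.le
      field_simp
      nlinarith
    rw [e, Real.sqrt_sq (by positivity)]
    ext <;> simp only <;> field_simp
    ring
  · simp only [modelPt, modelPos, modelLev]
    have e : (-x / (x ^ 2 + y ^ 2)) ^ 2 + (y / (x ^ 2 + y ^ 2)) ^ 2 = (x ^ 2 + y ^ 2)⁻¹ := by
      field_simp
    rw [e]
    ext <;> simp only <;> field_simp

/-- The labels that occur in the upper half plane. -/
def IsLev (κ : SectorType) (v : ℝ) : Prop := 0 ≤ v ∧ (κ = .parabolic → v ≤ 2)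

lemma isLev_modelLev {κ : SectorType} {a : ℝ × ℝ} (h2 : 0 ≤ a.2) : IsLev κ (modelLev κ a) := by
  obtain ⟨x, y⟩ := a
  simp only at h2
  cases κ
  · exact ⟨h2, by simp⟩
  · have hx : |x| ≤ √(x ^ 2 + y ^ 2) := Real.abs_le_sqrt (by nlinarith)
    have h := abs_le.1 hx
    have h1 : |x / √(x ^ 2 + y ^ 2)| ≤ 1 := by
      rw [abs_div, abs_of_nonneg (Real.sqrt_nonneg _)]
      exact div_le_one_of_le₀ hx (Real.sqrt_nonneg _)
    have h2 := abs_le.1 h1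
    simp only [IsLev, modelLev]
    exact ⟨by linarith, fun _ => by linarith⟩
  · exact ⟨by simp only [modelLev]; positivity, by simp⟩

lemma modelPt_snd_nonneg {κ : SectorType} {p v : ℝ} (hv : IsLev κ v) : 0 ≤ (modelPt κ p v).2 := by
  have := hv.1
  cases κ <;> simp only [modelPt] <;> positivity

lemma modelPos_lev_modelPt {κ : SectorType} {p v : ℝ} (hv : IsLev κ v) (h0 : modelPt κ p v ≠ 0) :
    modelPos κ (modelPt κ p v) = p ∧ modelLev κ (modelPt κ p v) = v := by
  cases κ
  · exact ⟨rfl, rfl⟩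
  · have h2 := hv.2 rfl
    have h1 := hv.1
    have e : (Real.exp p * (1 - v)) ^ 2 + (Real.exp p * √(2 * v - v ^ 2)) ^ 2
        = (Real.exp p) ^ 2 := by
      have : √(2 * v - v ^ 2) ^ 2 = 2 * v - v ^ 2 := Real.sq_sqrt (by nlinarith)
      rw [mul_pow, mul_pow, this]; ring
    simp only [modelPos, modelPt, modelLev, e, Real.sqrt_sq (Real.exp_pos p).le, Real.log_exp,
      true_and]
    field_simp
    ring
  · have h : p ^ 2 + v ^ 2 ≠ 0 := fun h => h0 (by simp [modelPt, h])
    have e : (-p / (p ^ 2 + v ^ 2)) ^ 2 + (v / (p ^ 2 + v ^ 2)) ^ 2 = (p ^ 2 + v ^ 2)⁻¹ := by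
      field_simp
    simp only [modelPos, modelPt, modelLev, e]
    constructor <;> field_simp

lemma hasDerivWithinAt_fst {γ : ℝ → ℝ × ℝ} {d : ℝ × ℝ} {s : Set ℝ} {t : ℝ}
    (h : HasDerivWithinAt γ d s t) : HasDerivWithinAt (fun t => (γ t).1) d.1 s t :=
  (hasFDerivAt_fst (𝕜 := ℝ) (E := ℝ) (F := ℝ)).comp_hasDerivWithinAt t h

lemma hasDerivWithinAt_snd {γ : ℝ → ℝ × ℝ} {d : ℝ × ℝ} {s : Set ℝ} {t : ℝ}
    (h : HasDerivWithinAt γ d s t) : HasDerivWithinAt (fun t => (γ t).2) d.2 s t :=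
  (hasFDerivAt_snd (𝕜 := ℝ) (E := ℝ) (F := ℝ)).comp_hasDerivWithinAt t h

/-- The label is a first integral, and the position advances at the rate `|z|²`, `1`, `1` for the
three types. -/
lemma hasDerivWithinAt_modelPos_lev {κ : SectorType} {γ : ℝ → ℝ × ℝ} {s : Set ℝ} {t : ℝ}
    (h : HasDerivWithinAt γ (modelField κ (γ t)) s t) (h0 : γ t ≠ 0) :
    (∃ d, 0 ≤ d ∧ HasDerivWithinAt (fun t => modelPos κ (γ t)) d s t) ∧
      HasDerivWithinAt (fun t => modelLev κ (γ t)) 0 s t := by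
  have hx := hasDerivWithinAt_fst h
  have hy := hasDerivWithinAt_snd h
  have hn := normSq_pos h0
  have hN := (hx.pow 2).add (hy.pow 2)
  cases κ <;> simp only [modelField, Nat.cast_ofNat, Nat.add_one_sub_one, pow_one] at hx hy hN
  · exact ⟨⟨_, by positivity, hx⟩, hy⟩
  · have hS := hN.sqrt (by simpa using hn.ne')
    have hs : 0 < √((γ t).1 ^ 2 + (γ t).2 ^ 2) := Real.sqrt_pos.2 hn
    have hL := hS.log (by simpa using hs.ne')
    have hd := (hx.div hS (by simpa using hs.ne')).const_sub 1
    have hsq := Real.sq_sqrt hn.le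
    constructor
    · refine ⟨_, ?_, hL⟩
      simp only [Pi.add_apply, Pi.pow_apply]
      have : 0 ≤ 2 * (γ t).1 * (γ t).1 + 2 * (γ t).2 * (γ t).2 := by nlinarith
      positivity
    · refine hd.congr_deriv ?_
      simp only [Pi.add_apply, Pi.pow_apply]
      field_simp
      rw [hsq]
      ring
  · have h1 := hx.neg.div hN (by simpa using hn.ne')
    have h2 := hy.div hN (by simpa using hn.ne')
    constructor
    · refine ⟨1, zero_le_one, h1.congr_deriv ?_⟩
      simp only [Pi.add_apply, Pi.pow_apply, Pi.neg_apply]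
      field_simp
      ring
    · refine h2.congr_deriv ?_
      simp only [Pi.add_apply, Pi.pow_apply]
      field_simp
      ring

/-- The reciprocal of the speed with which the position changes. -/
noncomputable def modelSlowness : SectorType → ℝ → ℝ → ℝ
  | .hyperbolic, p, v => (p ^ 2 + v ^ 2)⁻¹
  | _, _, _ => 1

lemma hasDerivAt_modelPt {κ : SectorType} {p v : ℝ} (hv : IsLev κ v) (h0 : modelPt κ p v ≠ 0) :
    HasDerivAt (fun p => modelPt κ p v)
      (modelSlowness κ p v • modelField κ (modelPt κ p v)) p := by
  cases κ
  · have hn := normSq_pos h0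
    simp only [modelPt] at hn
    refine ((hasDerivAt_id p).prodMk (hasDerivAt_const p v)).congr_deriv ?_
    simp only [modelField, modelSlowness, modelPt, Prod.smul_mk, smul_eq_mul, mul_zero, inv_mul_cancel₀ hn.ne']
  · refine (((Real.hasDerivAt_exp p).mul_const _).prodMk
      ((Real.hasDerivAt_exp p).mul_const _)).congr_deriv ?_
    simp [modelField, modelPt, modelSlowness]
  · have h : p ^ 2 + v ^ 2 ≠ 0 := fun h => h0 (by simp [modelPt, h])
    have hN := ((hasDerivAt_id p).pow 2).add_const (v ^ 2)
    have h1 := (hasDerivAt_id p).neg.div hN h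
    have h2 := (hasDerivAt_const p v).div hN h
    refine (h1.prodMk h2).congr_deriv ?_
    simp only [modelField, modelSlowness, modelPt, Pi.pow_apply, id, one_smul, Pi.neg_apply]
    ext <;> simp only <;> field_simp <;> ring

lemma continuousOn_modelPos (κ : SectorType) : ContinuousOn (modelPos κ) {0}ᶜ := by
  have hn : ∀ a : ℝ × ℝ, a ∈ ({0}ᶜ : Set (ℝ × ℝ)) → a.1 ^ 2 + a.2 ^ 2 ≠ 0 :=
    fun a ha => (normSq_pos ha).ne'
  cases κ
  · exact continuous_fst.continuousOn
  · exact ContinuousOn.log (by fun_prop) fun a ha => (Real.sqrt_pos.2 (normSq_pos ha)).ne'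
  · exact ContinuousOn.div (by fun_prop) (by fun_prop) hn

lemma continuousOn_modelLev (κ : SectorType) : ContinuousOn (modelLev κ) {0}ᶜ := by
  have hn : ∀ a : ℝ × ℝ, a ∈ ({0}ᶜ : Set (ℝ × ℝ)) → a.1 ^ 2 + a.2 ^ 2 ≠ 0 :=
    fun a ha => (normSq_pos ha).ne'
  cases κ
  · exact continuous_snd.continuousOn
  · exact continuousOn_const.sub (ContinuousOn.div (by fun_prop) (by fun_prop)
      fun a ha => (Real.sqrt_pos.2 (normSq_pos ha)).ne')
  · exact ContinuousOn.div (by fun_prop) (by fun_prop) hn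

lemma modelField_zero (κ : SectorType) : modelField κ 0 = 0 := by
  cases κ <;> simp [modelField]

lemma locallyLipschitz_modelField (κ : SectorType) : LocallyLipschitz (modelField κ) := by
  have : ContDiff ℝ 1 (modelField κ) := by
    cases κ
    · exact ((contDiff_fst.pow 2).add (contDiff_snd.pow 2)).prodMk contDiff_const
    · exact contDiff_fst.prodMk contDiff_snd
    · exact ((contDiff_fst.pow 2).sub (contDiff_snd.pow 2)).prodMk
        ((contDiff_const.mul contDiff_fst).mul contDiff_snd)
  exact this.locallyLipschitz

/-- The model trajectory through `a` runs inside `S` from `a` to `b`, away from the vertex. -/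
structure ModelArc (κ : SectorType) (S : Set (ℝ × ℝ)) (a b : ℝ × ℝ) : Prop where
  left : a ≠ 0
  right : b ≠ 0
  lev : modelLev κ a = modelLev κ b
  pos : modelPos κ a ≤ modelPos κ b
  mem : ∀ p ∈ Icc (modelPos κ a) (modelPos κ b),
    modelPt κ p (modelLev κ a) ∈ S ∧ modelPt κ p (modelLev κ a) ≠ 0

/-- The vertex is an equilibrium, so by uniqueness a trajectory that starts elsewhere never meets it
and has coordinates all along. The label stays constant, and by continuity every intermediate
position is taken. Together with `ModelArc.reaches` this turns accessibility in a model into an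
explicit condition on coordinates. -/
lemma Reaches.modelArc {κ : SectorType} {S : Set (ℝ × ℝ)} (hS : ∀ a ∈ S, 0 ≤ a.2) {a b : ℝ × ℝ}
    (h : Reaches (modelField κ) S a b) (ha : a ≠ 0) : ModelArc κ S a b := by
  obtain ⟨τ, γ, h0, rfl, rfl, h⟩ := h
  have hne : ∀ t ∈ Icc 0 τ, γ t ≠ 0 := fun t ht h' => by
    have := reaches_of_integralCurve h le_rfl ht.1 ht.2
    exact ha ((this.eq_of_right_eq_zero (locallyLipschitz_modelField κ)
      (by rw [h', modelField_zero])).trans h')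
  have hγ : ContinuousOn γ (Icc 0 τ) := fun t ht => (h t ht).2.continuousWithinAt
  have hd := fun t ht => hasDerivWithinAt_modelPos_lev (h t ht).2 (hne t ht)
  choose! d hd0 hd1 using fun t ht => (hd t ht).1
  have hpos : MonotoneOn (fun t => modelPos κ (γ t)) (Icc 0 τ) :=
    monotoneOn_of_hasDerivWithinAt_nonneg (convex_Icc 0 τ)
      (fun t ht => (hd1 t ht).continuousWithinAt)
      (fun t ht => (hd1 t (interior_subset ht)).mono interior_subset)
      (fun t ht => hd0 t (interior_subset ht))
  have hlev : ∀ t ∈ Icc 0 τ, modelLev κ (γ t) = modelLev κ (γ 0) := by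
    have hmono := monotoneOn_of_hasDerivWithinAt_nonneg (convex_Icc 0 τ)
      (fun t ht => (hd t ht).2.continuousWithinAt)
      (fun t ht => ((hd t (interior_subset ht)).2).mono interior_subset)
      (fun t _ => le_rfl)
    have hanti := antitoneOn_of_hasDerivWithinAt_nonpos (convex_Icc 0 τ)
      (fun t ht => (hd t ht).2.continuousWithinAt)
      (fun t ht => ((hd t (interior_subset ht)).2).mono interior_subset)
      (fun t _ => le_rfl)
    exact fun t ht => le_antisymm (hanti ⟨le_rfl, h0⟩ ht ht.1) (hmono ⟨le_rfl, h0⟩ ht ht.1)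
  have h0m : (0 : ℝ) ∈ Icc 0 τ := ⟨le_rfl, h0⟩
  have h1m : τ ∈ Icc 0 τ := ⟨h0, le_rfl⟩
  refine ⟨hne 0 h0m, hne τ h1m, (hlev τ h1m).symm, hpos h0m h1m h0, fun p hp => ?_⟩
  obtain ⟨t, ht, rfl⟩ := intermediate_value_Icc h0
    (fun t ht => (hd1 t ht).continuousWithinAt : ContinuousOn (fun t => modelPos κ (γ t)) _) hp
  have e := modelPt_pos_lev (κ := κ) (hne t ht) (hS _ (h t ht).1)
  rw [hlev t ht] at e
  simp only [e]
  exact ⟨(h t ht).1, hne t ht⟩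

lemma ModelArc.reaches {κ : SectorType} {S : Set (ℝ × ℝ)} {a b : ℝ × ℝ} (h : ModelArc κ S a b)
    (ha : 0 ≤ a.2) (hb : 0 ≤ b.2) : Reaches (modelField κ) S a b := by
  have ea := modelPt_pos_lev (κ := κ) h.left ha
  have eb := modelPt_pos_lev (κ := κ) h.right hb
  rw [← h.lev] at eb
  have hl := isLev_modelLev (κ := κ) ha
  have hn : κ = .hyperbolic → ∀ p ∈ Icc (modelPos κ a) (modelPos κ b),
      0 < p ^ 2 + (modelLev κ a) ^ 2 := by
    rintro rfl p hp; exact normSq_pos (h.mem p hp).2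
  have := reaches_of_hasDerivWithinAt_smul (F := modelField κ) (S := S)
    (c := fun p => modelPt κ p (modelLev κ a)) (p := modelPos κ a) (q := modelPos κ b)
    (μ := fun p => modelSlowness κ p (modelLev κ a)) h.pos
    (by
      cases κ
      · exact ContinuousOn.inv₀ (by fun_prop) fun p hp => (hn rfl p hp).ne'
      · exact continuousOn_const
      · exact continuousOn_const)
    (by
      intro p hp
      cases κ
      · exact inv_pos.2 (hn rfl p hp)
      · exact one_pos
      · exact one_pos)
    (fun p hp => (h.mem p hp).1)
    (fun p hp => (hasDerivAt_modelPt hl (h.mem p hp).2).hasDerivWithinAt)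
  simpa only [ea, eb] using this

lemma modelArc_injective {κ : SectorType} {a b : ℝ × ℝ} (ha : a ≠ 0) (hb : b ≠ 0) (ha2 : 0 ≤ a.2)
    (hb2 : 0 ≤ b.2) (hl : modelLev κ a = modelLev κ b) (hp : modelPos κ a = modelPos κ b) :
    a = b := by
  rw [← modelPt_pos_lev (κ := κ) ha ha2, ← modelPt_pos_lev (κ := κ) hb hb2, hl, hp]

lemma reaches_model_zero_iff {κ : SectorType} {S : Set (ℝ × ℝ)} {a b : ℝ × ℝ}
    (h : Reaches (modelField κ) S a b) : a = 0 ↔ b = 0 :=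
  ⟨fun ha => (h.eq_of_left_eq_zero (locallyLipschitz_modelField κ)
      (by rw [ha, modelField_zero])).trans ha,
    fun hb => (h.eq_of_right_eq_zero (locallyLipschitz_modelField κ)
      (by rw [hb, modelField_zero])).trans hb⟩

/-- A point passed between `a` and `b` lies on the arc from `a` to `b`. -/
lemma Reaches.model_between {κ : SectorType} {S S' : Set (ℝ × ℝ)} (hS : ∀ a ∈ S, 0 ≤ a.2)
    (hS' : ∀ a ∈ S', 0 ≤ a.2) {a b c : ℝ × ℝ} (h : Reaches (modelField κ) S a b)
    (hac : Reaches (modelField κ) S' a c) (hcb : Reaches (modelField κ) S' c b) :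
    Reaches (modelField κ) S a c ∧ Reaches (modelField κ) S c b := by
  rcases eq_or_ne a 0 with rfl | ha
  · have hc := (reaches_model_zero_iff hac).1 rfl
    have hb := (reaches_model_zero_iff h).1 rfl
    subst hc; subst hb
    exact ⟨h, h⟩
  have hc : c ≠ 0 := fun hc => ha ((reaches_model_zero_iff hac).2 hc)
  have h1 := h.modelArc hS ha
  have h2 := hac.modelArc hS' ha
  have h3 := hcb.modelArc hS' hc
  have ha2 := hS _ h.left_mem
  have hb2 := hS _ h.right_mem
  have hc2 := hS' _ hac.right_mem
  refine ⟨ModelArc.reaches ⟨ha, hc, h2.lev, h2.pos, fun p hp =>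
    h1.mem p ⟨hp.1, hp.2.trans h3.pos⟩⟩ ha2 hc2, ModelArc.reaches ⟨hc, h1.right, h3.lev, h3.pos,
    fun p hp => ?_⟩ hc2 hb2⟩
  rw [← h2.lev]
  exact h1.mem p ⟨h2.pos.trans hp.1, hp.2⟩

/-- The models are homogeneous, of degree `1` in the parabolic case and `2` in the other two, so a
dilation takes each field to a positive constant multiple of itself. -/
lemma Reaches.model_smul {κ : SectorType} {S : Set (ℝ × ℝ)} {a b : ℝ × ℝ} {δ : ℝ} (hδ : 0 < δ)
    (h : Reaches (modelField κ) S a b) :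
    Reaches (modelField κ) ((fun x => δ • x) '' S) (δ • a) (δ • b) := by
  refine h.map (f := fun x => δ • x) (f' := fun _ => δ • ContinuousLinearMap.id ℝ (ℝ × ℝ))
    (g := fun _ => match κ with | .parabolic => 1 | _ => δ⁻¹)
    (fun q _ => (hasFDerivAt_id q).const_smul δ) ?_ ?_ ?_
  · cases κ <;> exact continuousOn_const
  · intro q _; cases κ
    · exact inv_pos.2 hδ
    · exact one_pos
    · exact inv_pos.2 hδ
  · intro q _
    cases κ <;> simp only [modelField, smul_apply, ContinuousLinearMap.id_apply,
      Prod.smul_mk, Prod.smul_fst, Prod.smul_snd, smul_eq_mul, one_smul] <;>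
      ext <;> simp <;> field_simp

/-! ### Recognition of sectors -/

/-- The inverse of a continuous injective map on a compact set is continuous. -/
lemma IsCompact.continuousOn_of_leftInvOn {α β : Type*} [TopologicalSpace α] [TopologicalSpace β]
    [T2Space β] {K : Set α} (hK : IsCompact K) {f : α → β} (hf : ContinuousOn f K) {g : β → α}
    (hg : LeftInvOn g f K) : ContinuousOn g (f '' K) := by
  rw [continuousOn_iff_isClosed]
  intro C hC
  refine ⟨f '' (K ∩ C), ((hK.inter_right hC).image_of_continuousOn
    (hf.mono inter_subset_left)).isClosed, ?_⟩
  ext y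
  constructor
  · rintro ⟨hy, x, hx, rfl⟩
    rw [mem_preimage, hg hx] at hy
    exact ⟨mem_image_of_mem f ⟨hx, hy⟩, mem_image_of_mem f hx⟩
  · rintro ⟨⟨x, hx, rfl⟩, _⟩
    exact ⟨by rw [mem_preimage, hg hx.1]; exact hx.2, mem_image_of_mem f hx.1⟩

lemma isClosed_halfDisc : IsClosed halfDisc :=
  IsClosed.inter (s₁ := {a : ℝ × ℝ | a.1 ^ 2 + a.2 ^ 2 ≤ 1}) (s₂ := {a : ℝ × ℝ | 0 ≤ a.2})
    (isClosed_le (by fun_prop) (by fun_prop)) (isClosed_le (by fun_prop) (by fun_prop))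

lemma isCompact_halfDisc : IsCompact halfDisc := by
  refine Metric.isCompact_of_isClosed_isBounded isClosed_halfDisc
    ((Metric.isBounded_closedBall (x := (0 : ℝ × ℝ)) (r := 1)).subset fun a ha => ?_)
  have h := ha.1
  rw [mem_closedBall_zero_iff, Prod.norm_def, Real.norm_eq_abs, Real.norm_eq_abs]
  exact max_le (abs_le_one_iff_mul_self_le_one.2 (by nlinarith [sq_nonneg a.2]))
    (abs_le_one_iff_mul_self_le_one.2 (by nlinarith [sq_nonneg a.1]))

lemma smul_mem_halfDisc {δ : ℝ} (h0 : 0 ≤ δ) (h1 : δ ≤ 1) {a : ℝ × ℝ} (ha : a ∈ halfDisc) :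
    δ • a ∈ halfDisc := by
  obtain ⟨h, h'⟩ := ha
  refine ⟨?_, mul_nonneg h0 h'⟩
  simp only [Prod.smul_fst, Prod.smul_snd, smul_eq_mul, mul_pow]
  have : δ ^ 2 ≤ 1 := pow_le_one₀ h0 h1
  nlinarith [sq_nonneg a.1, sq_nonneg a.2]

lemma zero_mem_halfDisc : (0 : ℝ × ℝ) ∈ halfDisc := by simp [halfDisc]

/-- A model trajectory goes on inside an open set. -/
lemma exists_reaches_model {κ : SectorType} {O : Set (ℝ × ℝ)} (hO : IsOpen O) {a : ℝ × ℝ}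
    (ha : a ∈ O) (ha0 : a ≠ 0) (ha2 : 0 ≤ a.2) :
    ∃ b, b ≠ a ∧ Reaches (modelField κ) (O ∩ {x | 0 ≤ x.2}) a b := by
  have hl := isLev_modelLev (κ := κ) ha2
  have e := modelPt_pos_lev (κ := κ) ha0 ha2
  have hc : ContinuousAt (fun p => modelPt κ p (modelLev κ a)) (modelPos κ a) :=
    (hasDerivAt_modelPt hl (by rw [e]; exact ha0)).continuousAt
  have hn : O ∩ {0}ᶜ ∈ 𝓝 (modelPt κ (modelPos κ a) (modelLev κ a)) := by
    rw [e]; exact (hO.inter isOpen_compl_singleton).mem_nhds ⟨ha, ha0⟩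
  obtain ⟨ε, hε, hb⟩ := Metric.mem_nhds_iff.1 (hc.preimage_mem_nhds hn)
  have hb' : ∀ p ∈ Icc (modelPos κ a) (modelPos κ a + ε / 2),
      modelPt κ p (modelLev κ a) ∈ O ∩ {0}ᶜ := fun p hp => hb (by
    rw [Metric.mem_ball, Real.dist_eq, abs_lt]; constructor <;> linarith [hp.1, hp.2])
  have hq := hb' (modelPos κ a + ε / 2) ⟨by linarith, le_rfl⟩
  obtain ⟨h1, h2⟩ := modelPos_lev_modelPt hl hq.2
  refine ⟨modelPt κ (modelPos κ a + ε / 2) (modelLev κ a), fun h => ?_,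
    ModelArc.reaches ⟨ha0, hq.2, h2.symm, by rw [h1]; linarith, fun p hp => ?_⟩ ha2
      (modelPt_snd_nonneg hl)⟩
  · have := congrArg (modelPos κ) h
    rw [h1] at this; linarith
  · rw [h1] at hp
    exact ⟨⟨(hb' p hp).1, modelPt_snd_nonneg hl⟩, (hb' p hp).2⟩

/-- The points of the half disc between `a` and `b` on a model trajectory. -/
def modelBetween (κ : SectorType) (a b : ℝ × ℝ) : Set (ℝ × ℝ) :=
  {c | Reaches (modelField κ) halfDisc a c ∧ Reaches (modelField κ) halfDisc c b}

lemma modelBetween_subset (κ : SectorType) (a b : ℝ × ℝ) : modelBetween κ a b ⊆ halfDisc :=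
  fun _ hc => hc.1.right_mem

lemma half_smul_two_smul (x : ℝ × ℝ) : (1 / 2 : ℝ) • (2 : ℝ) • x = x := by
  rw [smul_smul]; norm_num

lemma two_smul_half_smul (x : ℝ × ℝ) : (2 : ℝ) • (1 / 2 : ℝ) • x = x := by
  rw [smul_smul]; norm_num

/-- A continuous injective map of the half disc that takes model arcs to trajectory arcs is, on
the half disc of half the size, the chart of a sector. -/
theorem isSectorChart_of_arcs {G : ℝ × ℝ → ℝ × ℝ} (hG : LocallyLipschitz G) (hG0 : G 0 = 0)
    {κ : SectorType} {Φ : ℝ × ℝ → ℝ × ℝ} (hc : ContinuousOn Φ halfDisc) (hi : InjOn Φ halfDisc)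
    (h0 : Φ 0 = 0)
    (harc : ∀ a b, a ≠ 0 → Reaches (modelField κ) halfDisc a b →
      Reaches G (Φ '' modelBetween κ a b) (Φ a) (Φ b)) :
    IsSectorChart G 0 κ (Φ '' ((fun x : ℝ × ℝ => (1 / 2 : ℝ) • x) '' halfDisc))
      (fun a => Φ ((1 / 2 : ℝ) • a)) := by
  set H := (fun x : ℝ × ℝ => (1 / 2 : ℝ) • x) '' halfDisc with hH
  have hHs : H ⊆ halfDisc := by
    rintro _ ⟨x, hx, rfl⟩; exact smul_mem_halfDisc (by norm_num) (by norm_num) hx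
  have hHc : IsCompact H := isCompact_halfDisc.image (continuous_const_smul _)
  have hup : ∀ a ∈ halfDisc, 0 ≤ a.2 := fun a ha => ha.2
  have hopen : IsOpen {x : ℝ × ℝ | x.1 ^ 2 + x.2 ^ 2 < 1} :=
    isOpen_lt (by fun_prop) (by fun_prop)
  -- The reason for halving: from a point of norm less than `1` the model trajectory goes on for a
  -- while inside `halfDisc`, where `harc` applies.
  have hHlt : ∀ x ∈ H, x.1 ^ 2 + x.2 ^ 2 < 1 := by
    rintro _ ⟨x, hx, rfl⟩
    have := hx.1
    simp only [Prod.smul_fst, Prod.smul_snd, smul_eq_mul]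
    nlinarith
  have key : ∀ a ∈ H, ∀ b ∈ H, Reaches G (Φ '' H) (Φ a) (Φ b) ↔ Reaches (modelField κ) H a b := by
    intro a ha b hb
    constructor
    · intro h
      rcases eq_or_ne a 0 with rfl | ha0
      · have := h.eq_of_left_eq_zero hG (by rw [h0, hG0])
        rw [hi (hHs hb) (hHs ha) this]
        exact Reaches.refl ha
      obtain ⟨τ, γ, hτ, hγ0, hγτ, hγ⟩ := h
      -- `c` is the trajectory `γ` pulled back to the model. It avoids the vertex because `γ` cannot
      -- arrive at the equilibrium `0`, and it is continuous because `Φ` is an embedding on the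
      -- compact set `H`.
      choose! c hcH hcγ using fun t ht => (hγ t ht).1
      have hγc : ContinuousOn γ (Icc 0 τ) := fun t ht => (hγ t ht).2.continuousWithinAt
      have hc0 : c 0 = a := hi (hHs (hcH 0 ⟨le_rfl, hτ⟩)) (hHs ha)
        ((hcγ 0 ⟨le_rfl, hτ⟩).trans hγ0)
      have hcτ : c τ = b := hi (hHs (hcH τ ⟨hτ, le_rfl⟩)) (hHs hb)
        ((hcγ τ ⟨hτ, le_rfl⟩).trans hγτ)
      have hcne : ∀ t ∈ Icc 0 τ, c t ≠ 0 := by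
        intro t ht h
        have h1 := reaches_of_integralCurve hγ le_rfl ht.1 ht.2
        have h2 : γ t = 0 := by rw [← hcγ t ht, h, h0]
        have := h1.eq_of_right_eq_zero hG (by rw [h2, hG0])
        rw [h2, hγ0, ← h0] at this
        exact ha0 (hi (hHs ha) zero_mem_halfDisc this)
      have hcc : ContinuousOn c (Icc 0 τ) := by
        have hinv := hHc.continuousOn_of_leftInvOn (hc.mono hHs)
          ((hi.mono hHs).leftInvOn_invFunOn)
        refine (hinv.comp hγc fun t ht => (hγ t ht).1).congr fun t ht => ?_
        have := (hi.mono hHs).leftInvOn_invFunOn (hcH t ht)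
        rw [hcγ t ht] at this
        exact this.symm
      have hmaps : MapsTo c (Icc 0 τ) {0}ᶜ := hcne
      have hpc := (continuousOn_modelPos κ).comp hcc hmaps
      have hlc := (continuousOn_modelLev κ).comp hcc hmaps
      -- Locally `c` follows the model: `harc` maps a short model arc from `c t` to a trajectory arc
      -- of `G` from `γ t`, which coincides with `γ` by uniqueness, and injectivity of `Φ` puts `c
      -- u` on the model arc.
      have hstep : ∀ t ∈ Ico 0 τ, ∃ t' ∈ Ioc t τ, ∀ u ∈ Icc t t',
          modelLev κ (c u) = modelLev κ (c t) ∧ modelPos κ (c t) ≤ modelPos κ (c u) := by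
        intro t ht
        have ht' := Ico_subset_Icc_self ht
        obtain ⟨x, hx, hr⟩ := exists_reaches_model (κ := κ) hopen (hHlt _ (hcH t ht'))
          (hcne t ht') (hup _ (hHs (hcH t ht')))
        have hr' := hr.mono (S' := halfDisc) fun y hy => ⟨(show _ < _ from hy.1).le, hy.2⟩
        obtain ⟨s, η, hs, hη0, hηs, hη⟩ := harc _ _ (hcne t ht') hr'
        have hspos : 0 < s := by
          rcases hs.eq_or_lt with rfl | h
          · rw [hη0] at hηs
            exact absurd (hi (hHs (hcH t ht')) hr'.right_mem hηs).symm hx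
          · exact h
        set σ := min s (τ - t) with hσ
        have hσpos : 0 < σ := lt_min hspos (by linarith [ht.2])
        have hagree : EqOn (fun u => γ (t + u)) η (Icc 0 σ) := by
          refine integralCurve_unique hG (fun u hu => ?_) (fun u hu => ?_) ?_
          · have hm : MapsTo (fun u => t + u) (Icc 0 σ) (Icc 0 τ) := fun u hu =>
              ⟨by linarith [hu.1, ht.1], by linarith [hu.2, min_le_right s (τ - t)]⟩
            have := (hγ _ (hm hu)).2.scomp u ((hasDerivAt_id u).const_add t).hasDerivWithinAt hm
            simpa [Function.comp_def] using this
          · have hm : Icc 0 σ ⊆ Icc 0 s := Icc_subset_Icc_right (min_le_left _ _)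
            exact (hη u (hm hu)).2.mono hm
          · simp only [add_zero]
            rw [hη0, hcγ t ht']
        refine ⟨t + σ, ⟨by linarith, by linarith [min_le_right s (τ - t)]⟩, fun u hu => ?_⟩
        have huσ : u - t ∈ Icc 0 σ := ⟨by linarith [hu.1], by linarith [hu.2]⟩
        have hu' : u ∈ Icc 0 τ := ⟨by linarith [hu.1, ht.1],
          by linarith [hu.2, min_le_right s (τ - t)]⟩
        have e := hagree huσ
        simp only [add_sub_cancel] at e
        obtain ⟨y, hy, hye⟩ := (hη (u - t) ⟨huσ.1, huσ.2.trans (min_le_left _ _)⟩).1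
        rw [← e, ← hcγ u hu'] at hye
        have := hi (modelBetween_subset _ _ _ hy) (hHs (hcH u hu')) hye
        rw [this] at hy
        have harc' := hy.1.modelArc hup (hcne t ht')
        exact ⟨harc'.lev.symm, harc'.pos⟩
      -- Continuous induction along `[0, τ]`: the condition is closed, holds at `0`, and `hstep`
      -- extends it to the right.
      have hall : Icc 0 τ ⊆ {t | modelLev κ (c t) = modelLev κ a ∧
          modelPos κ a ≤ modelPos κ (c t)} := by
        refine IsClosed.Icc_subset_of_forall_exists_gt ?_ (by simp [hc0]) ?_
        · have h1 := (hlc.sub (continuousOn_const (c := modelLev κ a))).preimage_isClosed_of_isClosed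
            isClosed_Icc (isClosed_singleton (x := (0 : ℝ)))
          have h2 := hpc.preimage_isClosed_of_isClosed isClosed_Icc
            (isClosed_Ici (a := modelPos κ a))
          convert h1.inter h2 using 1
          ext t
          simp only [mem_inter_iff, mem_ofPred_eq, mem_preimage, mem_singleton_iff, Pi.sub_apply, sub_eq_zero,
            mem_Ici, Function.comp]
          tauto
        · rintro t ⟨⟨h1, h2⟩, ht⟩ y hy
          obtain ⟨t', ht', h⟩ := hstep t ht
          refine ⟨min t' y, ?_, lt_min ht'.1 hy, min_le_right _ _⟩
          have := h (min t' y) ⟨(lt_min ht'.1 hy).le, min_le_left _ _⟩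
          exact ⟨this.1.trans h1, h2.trans this.2⟩
      have hτm : τ ∈ Icc 0 τ := ⟨hτ, le_rfl⟩
      have hb' := hall hτm
      rw [mem_ofPred_eq, hcτ] at hb'
      refine ModelArc.reaches ⟨ha0, hcτ ▸ hcne τ hτm, hb'.1.symm, hb'.2, fun p hp => ?_⟩
        (hup _ (hHs ha)) (hup _ (hHs hb))
      have hp' : p ∈ Icc ((modelPos κ ∘ c) 0) ((modelPos κ ∘ c) τ) := by
        simpa [hc0, hcτ] using hp
      obtain ⟨t, ht, rfl⟩ := intermediate_value_Icc hτ hpc hp'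
      have := modelPt_pos_lev (κ := κ) (hcne t ht) (hup _ (hHs (hcH t ht)))
      rw [(hall ht).1] at this
      simp only [Function.comp, this]
      exact ⟨hcH t ht, hcne t ht⟩
    · intro h
      rcases eq_or_ne a 0 with rfl | ha0
      · rw [(reaches_model_zero_iff h).1 rfl]
        exact Reaches.refl (mem_image_of_mem Φ ha)
      -- The arc given by `harc` runs through images of points between `a` and `b` in `halfDisc`;
      -- these lie in `H` because the whole arc from `a` to `b` does.
      refine (harc a b ha0 (h.mono hHs)).mono (image_mono fun c hc => ?_)
      exact (h.model_between (fun x hx => hup x (hHs hx)) hup hc.1 hc.2).1.right_mem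
  have hinj : ∀ {x y : ℝ × ℝ}, (1 / 2 : ℝ) • x = (1 / 2 : ℝ) • y → x = y := fun {x y} h => by
    rw [← two_smul_half_smul x, h, two_smul_half_smul]
  refine ⟨hc.comp (continuous_const_smul _).continuousOn
    (fun x hx => hHs (mem_image_of_mem _ hx)), fun x hx y hy h => hinj
      (hi (hHs (mem_image_of_mem _ hx)) (hHs (mem_image_of_mem _ hy)) h), ?_, by simp [h0],
    Or.inl fun a ha b hb => ?_⟩
  · rw [hH, image_image]
  · refine (key _ (mem_image_of_mem _ ha) _ (mem_image_of_mem _ hb)).trans ⟨fun h => ?_, fun h => ?_⟩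
    · have := h.model_smul (δ := 2) (by norm_num)
      rw [two_smul_half_smul, two_smul_half_smul, hH, image_image] at this
      simpa only [two_smul_half_smul, image_id'] using this
    · exact h.model_smul (by norm_num)

/-! ### From the projective circle to the plane of the infinitely remote point -/

/-- `CollapseToSector` for an arbitrary vector field. -/
def FieldCollapse (G : ℝ × ℝ → ℝ × ℝ) (θ₁ θ₂ : ℝ) (S₁ S₂ : Set (ℝ × ℝ)) (κ : SectorType) : Prop :=
  ∃ T : Set (ℝ × ℝ), IsBendixsonSector G 0 κ T ∧
    ∃ m₁ m₂ : ℝ, θ₁ < m₁ ∧ m₁ ≤ m₂ ∧ m₂ < θ₂ ∧ (m₁, (0 : ℝ)) ∈ S₁ ∧ (m₂, (0 : ℝ)) ∈ S₂ ∧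
      ∃ N ∈ 𝓝 (0 : ℝ × ℝ),
        T ∩ N = collapse '' (S₁ ∪ S₂ ∪ Icc m₁ m₂ ×ˢ Ici (0 : ℝ)) ∩ N

/-- A field `F` on the plane of `(θ, ρ)` for which the line `ρ = 0` is invariant, with
movement in the positive direction on the segment from `θ₁` to `θ₂`, and a field `G` which
`collapse` makes, up to a positive factor, out of `F`. -/
structure CollapseSetup (F G : ℝ × ℝ → ℝ × ℝ) (θ₁ θ₂ : ℝ) : Prop where
  smooth : ContDiff ℝ 1 F
  lipschitz : LocallyLipschitz G
  zero : G 0 = 0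
  lt : θ₁ < θ₂
  le : θ₂ ≤ θ₁ + Real.pi
  boundary : ∀ θ, (F (θ, 0)).2 = 0
  pos : ∀ θ ∈ Ioo θ₁ θ₂, 0 < (F (θ, 0)).1
  conj : ∃ g : ℝ × ℝ → ℝ, ContinuousOn g {q | 0 < q.2} ∧ (∀ q, 0 < q.2 → 0 < g q) ∧
    ∀ q, 0 < q.2 → fderiv ℝ collapse q (F q) = g q • G (collapse q)

lemma contDiff_collapse : ContDiff ℝ 1 collapse := by
  unfold collapse
  exact ((contDiff_const.mul contDiff_snd).mul (Real.contDiff_cos.comp contDiff_fst)).prodMk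
    ((contDiff_const.mul contDiff_snd).mul (Real.contDiff_sin.comp contDiff_fst))

lemma fderiv_collapse (q w : ℝ × ℝ) : fderiv ℝ collapse q w =
    (4 * w.2 * Real.cos q.1 - 4 * q.2 * (Real.sin q.1 * w.1),
      4 * w.2 * Real.sin q.1 + 4 * q.2 * (Real.cos q.1 * w.1)) := by
  have h1 := hasFDerivAt_fst (𝕜 := ℝ) (E := ℝ) (F := ℝ) (p := q)
  have h2 := (hasFDerivAt_snd (𝕜 := ℝ) (E := ℝ) (F := ℝ) (p := q)).const_mul 4
  have := (h2.mul h1.cos).prodMk (h2.mul h1.sin)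
  have e : HasFDerivAt collapse _ q := this
  rw [e.fderiv]
  ext <;> simp <;> ring

lemma collapse_zero_right {q : ℝ × ℝ} (hq : q.2 = 0) : collapse q = 0 := by
  simp [collapse, hq]

lemma collapse_normSq (q : ℝ × ℝ) :
    (collapse q).1 ^ 2 + (collapse q).2 ^ 2 = (4 * q.2) ^ 2 := by
  simp only [collapse]
  linear_combination (4 * q.2) ^ 2 * Real.sin_sq_add_cos_sq q.1

lemma collapse_ne_zero {q : ℝ × ℝ} (hq : 0 < q.2) : collapse q ≠ 0 := by
  intro h
  have := collapse_normSq q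
  rw [h] at this
  have : 0 < (4 * q.2) ^ 2 := by positivity
  simp_all

/-- The norm determines `ρ`, and then the sine and cosine determine the angle inside a window of
length `2π`. -/
lemma collapse_injOn {s : Set (ℝ × ℝ)} (hs : ∀ q ∈ s, 0 < q.2) {α : ℝ}
    (hα : ∀ q ∈ s, q.1 ∈ Ioo α (α + 2 * Real.pi)) : InjOn collapse s := by
  intro q hq q' hq' h
  have h1 := collapse_normSq q
  rw [h, collapse_normSq q'] at h1
  have hρ : q.2 = q'.2 := by
    have := (sq_eq_sq₀ (by linarith [hs q' hq']) (by linarith [hs q hq])).1 h1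
    linarith
  simp only [collapse, hρ, Prod.mk.injEq] at h
  have hp := hs q' hq'
  have hc : Real.cos q.1 = Real.cos q'.1 := mul_left_cancel₀ (by positivity) h.1
  have hsn : Real.sin q.1 = Real.sin q'.1 := mul_left_cancel₀ (by positivity) h.2
  have h2 : Real.cos (q.1 - q'.1) = 1 := by
    rw [Real.cos_sub, hc, hsn]; nlinarith [Real.sin_sq_add_cos_sq q'.1]
  have h3 := (Real.cos_eq_one_iff_of_lt_of_lt
    (by linarith [(hα q hq).1, (hα q' hq').2]) (by linarith [(hα q hq).2, (hα q' hq').1])).1 h2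
  exact Prod.ext (by linarith) hρ

/-- The map from the half disc into the projective circle that unites the two sectors. -/
structure IsUnion (F : ℝ × ℝ → ℝ × ℝ) (θ₁ θ₂ : ℝ) (κ : SectorType) (P : Set (ℝ × ℝ))
    (ψ : ℝ × ℝ → ℝ × ℝ) : Prop where
  continuousOn : ContinuousOn ψ (halfDisc \ {0})
  vertex : Filter.Tendsto (fun a => (ψ a).2) (𝓝[halfDisc \ {0}] 0) (𝓝 0)
  injOn : InjOn ψ (halfDisc \ {0})
  pos : ∀ a ∈ halfDisc \ {0}, 0 < (ψ a).2
  range : ∀ a ∈ halfDisc \ {0}, (ψ a).1 ∈ Ioo (θ₁ - 1) (θ₂ + 1)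
  arcs : ∀ a b, a ≠ 0 → Reaches (modelField κ) halfDisc a b →
    Reaches F (ψ '' modelBetween κ a b) (ψ a) (ψ b)
  subset : ∀ a ∈ halfDisc \ {0}, ψ a ∈ P
  cover : ∃ ε > 0, ∀ q ∈ P, 0 < q.2 → q.2 < ε → q ∈ ψ '' (halfDisc \ {0})

/-- `collapse ∘ ψ`, completed by `0 ↦ 0`, is continuous at the vertex since its norm is at most
`4ρ`, and `conj` makes trajectory arcs of `G` out of those of `F`. The sector `T` is the image of
the half disc of half the size, so it agrees with the image of `P` only near `O*`. -/
theorem FieldCollapse.of_isUnion {F G : ℝ × ℝ → ℝ × ℝ} {θ₁ θ₂ : ℝ} (hs : CollapseSetup F G θ₁ θ₂)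
    {κ : SectorType} {S₁ S₂ : Set (ℝ × ℝ)} (hS₁ : ∀ q ∈ S₁, 0 ≤ q.2) (hS₂ : ∀ q ∈ S₂, 0 ≤ q.2)
    {m₁ m₂ : ℝ} (h1 : θ₁ < m₁) (h12 : m₁ ≤ m₂) (h2 : m₂ < θ₂) (hm₁ : (m₁, (0 : ℝ)) ∈ S₁)
    (hm₂ : (m₂, (0 : ℝ)) ∈ S₂) {ψ : ℝ × ℝ → ℝ × ℝ}
    (hψ : IsUnion F θ₁ θ₂ κ (S₁ ∪ S₂ ∪ Icc m₁ m₂ ×ˢ Ici (0 : ℝ)) ψ) :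
    FieldCollapse G θ₁ θ₂ S₁ S₂ κ := by
  classical
  obtain ⟨g, hgc, hg0, hg⟩ := hs.conj
  set P := S₁ ∪ S₂ ∪ Icc m₁ m₂ ×ˢ Ici (0 : ℝ) with hP
  have hP0 : ∀ q ∈ P, 0 ≤ q.2 := by
    rintro q ((hq | hq) | hq)
    exacts [hS₁ q hq, hS₂ q hq, hq.2]
  set Φ : ℝ × ℝ → ℝ × ℝ := fun a => if a = 0 then 0 else collapse (ψ a) with hΦ
  have hΦ0 : Φ 0 = 0 := by simp [hΦ]
  have hΦ1 : ∀ a, a ≠ 0 → Φ a = collapse (ψ a) := fun a ha => by simp [hΦ, ha]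
  have hcol := contDiff_collapse.continuous
  have hΦn : ∀ a, a ≠ 0 → (Φ a).1 ^ 2 + (Φ a).2 ^ 2 = (4 * (ψ a).2) ^ 2 := fun a ha => by
    rw [hΦ1 a ha, collapse_normSq]
  have hcont : ContinuousOn Φ halfDisc := by
    intro a ha
    rcases eq_or_ne a 0 with rfl | ha0
    · have ht : Filter.Tendsto (fun a => Φ a) (𝓝[halfDisc \ {0}] 0) (𝓝 0) := by
        have hb : ∀ a ∈ halfDisc \ {0}, ‖Φ a‖ ≤ 4 * |(ψ a).2| := by
          intro a ha
          rw [hΦ1 a ha.2, Prod.norm_def, Real.norm_eq_abs, Real.norm_eq_abs]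
          simp only [collapse]
          refine max_le ?_ ?_ <;> rw [abs_mul, abs_mul, abs_of_pos (four_pos : (0 : ℝ) < 4)]
          · exact mul_le_of_le_one_right (by positivity) (Real.abs_cos_le_one _)
          · exact mul_le_of_le_one_right (by positivity) (Real.abs_sin_le_one _)
        have h3 : Filter.Tendsto (fun a => 4 * |(ψ a).2|) (𝓝[halfDisc \ {0}] 0) (𝓝 0) := by
          simpa using (hψ.vertex.abs).const_mul 4
        refine squeeze_zero_norm' ?_ h3
        filter_upwards [self_mem_nhdsWithin] with a ha using hb a ha
      have : ContinuousWithinAt Φ (halfDisc \ {0}) 0 := by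
        rw [ContinuousWithinAt, hΦ0]; exact ht
      have := (continuousWithinAt_insert_self.2 this)
      exact this.mono (by intro x hx; by_cases h : x = 0 <;> simp [h, hx])
    · have hc := (hcol.comp_continuousOn hψ.continuousOn) a ⟨ha, ha0⟩
      have h3 : ContinuousWithinAt Φ (halfDisc \ {0}) a :=
        hc.congr (fun x hx => hΦ1 x hx.2) (hΦ1 a ha0)
      refine h3.mono_of_mem_nhdsWithin ?_
      filter_upwards [self_mem_nhdsWithin, mem_nhdsWithin_of_mem_nhds
        (isOpen_compl_singleton.mem_nhds ha0)] with x hx hx' using ⟨hx, hx'⟩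
  -- The window from `θ₁ - 1` to `θ₂ + 1` has length at most `π + 2`, which is less than `2π`.
  have hpi := Real.pi_gt_three
  have hinj' : InjOn collapse (ψ '' (halfDisc \ {0})) := by
    refine collapse_injOn (α := θ₁ - 1) ?_ ?_
    · rintro _ ⟨a, ha, rfl⟩; exact hψ.pos a ha
    · rintro _ ⟨a, ha, rfl⟩
      have := hψ.range a ha
      exact ⟨this.1, by linarith [this.2, hs.le]⟩
  have hinj : InjOn Φ halfDisc := by
    intro a ha b hb h
    rcases eq_or_ne a 0 with rfl | ha0 <;> rcases eq_or_ne b 0 with rfl | hb0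
    · rfl
    · rw [hΦ0, hΦ1 b hb0] at h
      exact absurd h.symm (collapse_ne_zero (hψ.pos b ⟨hb, hb0⟩))
    · rw [hΦ0, hΦ1 a ha0] at h
      exact absurd h (collapse_ne_zero (hψ.pos a ⟨ha, ha0⟩))
    · rw [hΦ1 a ha0, hΦ1 b hb0] at h
      exact hψ.injOn ⟨ha, ha0⟩ ⟨hb, hb0⟩
        (hinj' (mem_image_of_mem _ ⟨ha, ha0⟩) (mem_image_of_mem _ ⟨hb, hb0⟩) h)
  have harc : ∀ a b, a ≠ 0 → Reaches (modelField κ) halfDisc a b →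
      Reaches G (Φ '' modelBetween κ a b) (Φ a) (Φ b) := by
    intro a b ha0 h
    have hb0 : b ≠ 0 := fun hb => ha0 ((reaches_model_zero_iff h).2 hb)
    have hne : ∀ c ∈ modelBetween κ a b, c ∈ halfDisc \ {0} := fun c hc =>
      ⟨hc.1.right_mem, fun h => ha0 ((reaches_model_zero_iff hc.1).2 h)⟩
    have hpos : ∀ q ∈ ψ '' modelBetween κ a b, 0 < q.2 := by
      rintro _ ⟨c, hc, rfl⟩; exact hψ.pos c (hne c hc)
    have := (hψ.arcs a b ha0 h).map (G := G) (f := collapse) (f' := fderiv ℝ collapse) (g := g)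
      (fun q _ => (contDiff_collapse.differentiable one_ne_zero q).hasFDerivAt)
      (hgc.mono hpos) (fun q hq => hg0 q (hpos q hq)) (fun q hq => hg q (hpos q hq))
    rw [← hΦ1 a ha0, ← hΦ1 b hb0, image_image] at this
    refine this.mono ?_
    rintro _ ⟨c, hc, rfl⟩
    exact ⟨c, hc, hΦ1 c (hne c hc).2⟩
  have hchart := isSectorChart_of_arcs hs.lipschitz hs.zero hcont hinj hΦ0 harc
  obtain ⟨ε, hε, hcov⟩ := hψ.cover
  -- The sector is the image of `|a| ≤ 1/2`. The outer part has a compact image without `0`, so near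
  -- `0` only the inner part counts.
  set K := Φ '' {a ∈ halfDisc | 1 / 4 ≤ a.1 ^ 2 + a.2 ^ 2} with hK
  have hKc : IsCompact K := (isCompact_halfDisc.inter_right (t := {a : ℝ × ℝ | 1 / 4 ≤ a.1 ^ 2 + a.2 ^ 2})
    (isClosed_le (by fun_prop) (by fun_prop))).image_of_continuousOn (hcont.mono inter_subset_left)
  have h0K : (0 : ℝ × ℝ) ∉ K := by
    rintro ⟨a, ⟨ha, ha'⟩, h⟩
    have := hinj ha zero_mem_halfDisc (h.trans hΦ0.symm)
    rw [this] at ha'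
    norm_num at ha'
  refine ⟨_, ⟨hs.zero, _, hchart⟩, m₁, m₂, h1, h12, h2, hm₁, hm₂,
    {w | w.1 ^ 2 + w.2 ^ 2 < (4 * ε) ^ 2} ∩ Kᶜ, Filter.inter_mem ?_ ?_, ?_⟩
  · exact (isOpen_lt (by fun_prop) (by fun_prop)).mem_nhds (by simp; positivity)
  · exact hKc.isClosed.isOpen_compl.mem_nhds h0K
  · ext w
    constructor
    · rintro ⟨⟨_, ⟨a, ha, rfl⟩, rfl⟩, hN⟩
      refine ⟨?_, hN⟩
      have hm := smul_mem_halfDisc (δ := 1 / 2) (by norm_num) (by norm_num) ha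
      simp only
      by_cases h0 : (1 / 2 : ℝ) • a = 0
      · rw [h0, hΦ0]
        exact ⟨(m₁, 0), Or.inl (Or.inl hm₁), collapse_zero_right rfl⟩
      · exact ⟨_, hψ.subset _ ⟨hm, h0⟩, (hΦ1 _ h0).symm⟩
    · rintro ⟨⟨q, hq, rfl⟩, hN⟩
      refine ⟨?_, hN⟩
      rcases (hP0 q hq).eq_or_lt with h0 | h0
      · rw [collapse_zero_right h0.symm]
        exact ⟨0, ⟨0, zero_mem_halfDisc, by simp⟩, hΦ0⟩
      · have hlt : q.2 < ε := by
          have := hN.1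
          rw [mem_ofPred_eq, collapse_normSq] at this
          have := lt_of_pow_lt_pow_left₀ 2 (by positivity) this
          linarith
        obtain ⟨a, ha, rfl⟩ := hcov q hq h0 hlt
        rw [← hΦ1 a ha.2] at hN ⊢
        have h4 : a.1 ^ 2 + a.2 ^ 2 < 1 / 4 := by
          by_contra h
          exact hN.2 ⟨a, ⟨ha.1, not_lt.1 h⟩, rfl⟩
        refine mem_image_of_mem Φ ⟨(2 : ℝ) • a, ⟨?_, ?_⟩, half_smul_two_smul a⟩
        · simp only [Prod.smul_fst, Prod.smul_snd, smul_eq_mul]; nlinarith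
        · simpa using ha.1.2

/-! ### Flow boxes along a boundary arc -/

/-- The graphs of the functions `Y · l` are the trajectories near the segment from `α` to `β`. -/
structure IsFlowBox (F : ℝ × ℝ → ℝ × ℝ) (α β l₀ ε₀ : ℝ) (Y : ℝ → ℝ → ℝ) : Prop where
  l_pos : 0 < l₀
  ε_pos : 0 < ε₀
  cont : ContinuousOn (fun q : ℝ × ℝ => Y q.1 q.2) (Icc α β ×ˢ Icc 0 l₀)
  zero : ∀ θ ∈ Icc α β, Y θ 0 = 0
  pos : ∀ θ ∈ Icc α β, ∀ l ∈ Ioc 0 l₀, 0 < Y θ l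
  inj : ∀ θ ∈ Icc α β, InjOn (Y θ) (Icc 0 l₀)
  arc : ∀ θ θ' l, α ≤ θ → θ ≤ θ' → θ' ≤ β → l ∈ Icc 0 l₀ →
    Reaches F ((fun t => (t, Y t l)) '' Icc θ θ') (θ, Y θ l) (θ', Y θ' l)
  mono : ∀ P p q, Reaches F P p q → P ⊆ Icc α β ×ˢ Icc 0 ε₀ → p.1 ≤ q.1
  label : ∀ P p q, Reaches F P p q → P ⊆ Icc α β ×ˢ Icc 0 ε₀ →
    ∀ l ∈ Icc 0 l₀, (p.2 = Y p.1 l ↔ q.2 = Y q.1 l)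
  cover : ∀ θ ∈ Icc α β, ∀ ρ ∈ Icc 0 ε₀, ∃ l ∈ Icc 0 l₀, Y θ l = ρ

/-- Solutions of a scalar equation with Lipschitz right-hand side agree everywhere if they agree
at one of the end points. -/
lemma scalar_ode_unique {v : ℝ → ℝ → ℝ} {K : NNReal} {a b : ℝ} (hab : a ≤ b)
    (hv : ∀ t ∈ Icc a b, LipschitzWith K (v t)) {f g : ℝ → ℝ}
    (hf : ∀ t ∈ Icc a b, HasDerivWithinAt f (v t (f t)) (Icc a b) t)
    (hg : ∀ t ∈ Icc a b, HasDerivWithinAt g (v t (g t)) (Icc a b) t) :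
    f a = g a ↔ f b = g b := by
  have hfc : ContinuousOn f (Icc a b) := fun t ht => (hf t ht).continuousWithinAt
  have hgc : ContinuousOn g (Icc a b) := fun t ht => (hg t ht).continuousWithinAt
  constructor
  · intro h
    exact ODE_solution_unique_of_mem_Icc_right (v := v) (s := fun _ => univ) (K := K)
      (fun t ht => (hv t (Ico_subset_Icc_self ht)).lipschitzOnWith) hfc
      (fun t ht => (hf t (Ico_subset_Icc_self ht)).mono_of_mem_nhdsWithin
        (Icc_mem_nhdsGE_of_mem ht)) (fun _ _ => trivial) hgc
      (fun t ht => (hg t (Ico_subset_Icc_self ht)).mono_of_mem_nhdsWithin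
        (Icc_mem_nhdsGE_of_mem ht)) (fun _ _ => trivial) h ⟨hab, le_rfl⟩
  · intro h
    exact ODE_solution_unique_of_mem_Icc_left (v := v) (s := fun _ => univ) (K := K)
      (fun t ht => (hv t (Ioc_subset_Icc_self ht)).lipschitzOnWith) hfc
      (fun t ht => (hf t (Ioc_subset_Icc_self ht)).mono_of_mem_nhdsWithin
        (Icc_mem_nhdsLE_of_mem ht)) (fun _ _ => trivial) hgc
      (fun t ht => (hg t (Ioc_subset_Icc_self ht)).mono_of_mem_nhdsWithin
        (Icc_mem_nhdsLE_of_mem ht)) (fun _ _ => trivial) h ⟨le_rfl, hab⟩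

/-- Near the segment the angle increases along trajectories, which are therefore graphs of solutions
of `dρ/dθ = F₂/F₁`. The label `l` is the value of the solution at `θ = α`; label `0` gives the
invariant line `ρ = 0`, and by uniqueness no other graph meets it. -/
theorem exists_isFlowBox {F : ℝ × ℝ → ℝ × ℝ} (hF : ContDiff ℝ 1 F)
    (hb : ∀ θ, (F (θ, 0)).2 = 0) {α β : ℝ} (hαβ : α < β)
    (hpos : ∀ θ ∈ Icc α β, 0 < (F (θ, 0)).1) : ∃ l₀ ε₀ Y, IsFlowBox F α β l₀ ε₀ Y := by
  have hF1 : Continuous fun q => (F q).1 := continuous_fst.comp hF.continuous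
  have hF2 : Continuous fun q => (F q).2 := continuous_snd.comp hF.continuous
  obtain ⟨u, v, -, hv, hu, h0v, huv⟩ := generalized_tube_lemma (isCompact_Icc (a := α) (b := β))
    (isCompact_singleton (x := (0 : ℝ))) (isOpen_lt continuous_const hF1) (by
      rintro ⟨θ, ρ⟩ ⟨h1, h2⟩
      obtain rfl : ρ = 0 := h2
      exact hpos θ h1)
  obtain ⟨ρ₁, hρ₁, hball⟩ := Metric.isOpen_iff.1 hv 0 (h0v rfl)
  set ρ₀ := ρ₁ / 2 with hρ₀
  have hρ : 0 < ρ₀ := by positivity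
  set R : Set (ℝ × ℝ) := Icc α β ×ˢ Icc (-ρ₀) ρ₀ with hR
  have hRc : IsCompact R := isCompact_Icc.prod isCompact_Icc
  have hRpos : ∀ q ∈ R, 0 < (F q).1 := fun q hq => huv ⟨hu hq.1, hball (by
    rw [mem_ball_zero_iff, Real.norm_eq_abs, abs_lt]
    constructor <;> linarith [hq.2.1, hq.2.2])⟩
  set f : ℝ × ℝ → ℝ := fun q => (F q).2 / (F q).1 with hf
  have hfc : ContinuousOn f R := hF2.continuousOn.div hF1.continuousOn fun q hq => (hRpos q hq).ne'
  obtain ⟨K, hK⟩ : ∃ K, LipschitzOnWith K f R := by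
    refine LocallyLipschitzOn.exists_lipschitzOnWith_of_compact hRc fun q hq => ?_
    have : ContDiffAt ℝ 1 f q := (contDiff_snd.comp hF).contDiffAt.div
      (contDiff_fst.comp hF).contDiffAt (hRpos q hq).ne'
    obtain ⟨K, t, ht, h⟩ := this.exists_lipschitzOnWith
    exact ⟨K, t, mem_nhdsWithin_of_mem_nhds ht, h⟩
  obtain ⟨L, hL⟩ := hRc.exists_bound_of_continuousOn hfc
  obtain ⟨C, hC⟩ := hRc.exists_bound_of_continuousOn hF1.continuousOn
  -- Clamping `ρ` to `[-ρ₀, ρ₀]` makes the right-hand side globally Lipschitz and bounded in `ρ`, so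
  -- that solutions exist over all of `[α, β]`. The graphs used later stay where the clamp is
  -- inactive.
  set c : ℝ → ℝ := fun x => (projIcc (-ρ₀) ρ₀ (by linarith) x : ℝ) with hc
  have hcm : ∀ x, c x ∈ Icc (-ρ₀) ρ₀ := fun x => (projIcc (-ρ₀) ρ₀ _ x).2
  have hcid : ∀ x ∈ Icc (-ρ₀) ρ₀, c x = x := fun x hx => by
    simp only [hc]; rw [projIcc_of_mem _ hx]
  have hcl : ∀ x y, dist (c x) (c y) ≤ dist x y := fun x y => by
    have := (LipschitzWith.projIcc (a := -ρ₀) (b := ρ₀) (by linarith)).dist_le_mul x y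
    simpa [Subtype.dist_eq] using this
  set w : ℝ → ℝ → ℝ := fun t x => f (t, c x) with hw
  have hwl : ∀ t ∈ Icc α β, LipschitzWith K (w t) := fun t ht =>
    LipschitzWith.of_dist_le_mul fun x y => by
      refine (hK.dist_le_mul (t, c x) ⟨ht, hcm x⟩ (t, c y) ⟨ht, hcm y⟩).trans ?_
      gcongr
      rw [Prod.dist_eq]
      simp [hcl x y]
  have hL0 : 0 ≤ L := (norm_nonneg _).trans (hL (α, 0) ⟨⟨le_rfl, hαβ.le⟩, by simp [hρ.le]⟩)
  -- Initial values fill the ball of radius `1`, and a solution moves by at most `L (β - α)`; hence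
  -- the outer radius.
  have hPL : IsPicardLindelof w (⟨α, le_rfl, hαβ.le⟩ : Icc α β) 0
      (1 + L.toNNReal * (β - α).toNNReal) 1 L.toNNReal K := by
    refine ⟨fun t ht => (hwl t ht).lipschitzOnWith, fun x _ => ?_, fun t ht x _ => ?_, ?_⟩
    · exact hfc.comp (by fun_prop) fun t ht => ⟨ht, hcm x⟩
    · rw [Real.coe_toNNReal _ hL0]
      exact hL _ ⟨ht, hcm x⟩
    · push_cast
      rw [Real.coe_toNNReal _ hL0, Real.coe_toNNReal _ (by linarith)]
      simp only [sub_self]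
      rw [max_eq_left (by linarith)]
      linarith
  obtain ⟨Z, hZ, hZc⟩ := hPL.exists_forall_mem_closedBall_eq_hasDerivWithinAt_continuousOn
  simp only [NNReal.coe_one] at hZ hZc
  have h0m : (0 : ℝ) ∈ Metric.closedBall (0 : ℝ) 1 := by simp
  have hw0 : ∀ t, w t 0 = 0 := fun t => by
    simp only [hw, hf, hcid 0 ⟨by linarith, hρ.le⟩, hb, zero_div]
  have hsub : ∀ {t}, t ∈ Icc α β → Icc α t ⊆ Icc α β := fun ht => Icc_subset_Icc_right ht.2
  have hagree : ∀ l ∈ Metric.closedBall (0 : ℝ) 1, ∀ l' ∈ Metric.closedBall (0 : ℝ) 1,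
      ∀ t ∈ Icc α β, (l = l' ↔ Z (l, t) = Z (l', t)) := by
    intro l hl l' hl' t ht
    have := scalar_ode_unique ht.1 (fun s hs => hwl s (hsub ht hs))
      (fun s hs => ((hZ l hl).2 s (hsub ht hs)).mono (hsub ht))
      (fun s hs => ((hZ l' hl').2 s (hsub ht hs)).mono (hsub ht))
    rwa [(hZ l hl).1, (hZ l' hl').1] at this
  have hZ0 : ∀ t ∈ Icc α β, Z (0, t) = 0 := by
    intro t ht
    refine (scalar_ode_unique (f := fun s => Z (0, s)) (g := fun _ => 0) ht.1
      (fun s hs => hwl s (hsub ht hs)) (fun s hs => ((hZ 0 h0m).2 s (hsub ht hs)).mono (hsub ht))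
      (fun s hs => ?_)).1 (hZ 0 h0m).1
    rw [hw0]; exact hasDerivWithinAt_const _ _ _
  obtain ⟨l₀, hl₀, hl₀1, hsmall⟩ : ∃ l₀ > 0, l₀ ≤ 1 ∧ ∀ l ∈ Icc 0 l₀, ∀ t ∈ Icc α β,
      |Z (l, t)| ≤ ρ₀ := by
    have huc := ((isCompact_closedBall (0 : ℝ) 1).prod
      (isCompact_Icc (a := α) (b := β))).uniformContinuousOn_of_continuous hZc
    obtain ⟨δ, hδ, h⟩ := Metric.uniformContinuousOn_iff.1 huc ρ₀ hρ
    refine ⟨min 1 (δ / 2), by positivity, min_le_left _ _, fun l hl t ht => ?_⟩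
    have h1 : l ≤ 1 := hl.2.trans (min_le_left _ _)
    have h2 : l ≤ δ / 2 := hl.2.trans (min_le_right _ _)
    have := h (l, t) ⟨by rw [mem_closedBall_zero_iff, Real.norm_eq_abs, abs_of_nonneg hl.1]
                         exact h1, ht⟩ (0, t) ⟨h0m, ht⟩ (by
      rw [Prod.dist_eq, dist_self, Real.dist_eq, sub_zero, abs_of_nonneg hl.1]
      exact max_lt (by linarith) hδ)
    rw [hZ0 t ht, Real.dist_eq, sub_zero] at this
    exact this.le
  have hlm : ∀ l ∈ Icc 0 l₀, l ∈ Metric.closedBall (0 : ℝ) 1 := fun l hl => by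
    rw [mem_closedBall_zero_iff, Real.norm_eq_abs, abs_of_nonneg hl.1]; exact hl.2.trans hl₀1
  have hcont : ContinuousOn (fun q : ℝ × ℝ => Z (q.2, q.1)) (Icc α β ×ˢ Icc 0 l₀) :=
    hZc.comp (by fun_prop) fun q hq => ⟨hlm _ hq.2, hq.1⟩
  have hZpos : ∀ t ∈ Icc α β, ∀ l ∈ Ioc 0 l₀, 0 < Z (l, t) := by
    intro t ht l hl
    have hl' := Ioc_subset_Icc_self hl
    by_contra hcon
    have h1 : ContinuousOn (fun s => Z (l, s)) (Icc α t) := fun s hs =>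
      (((hZ l (hlm l hl')).2 s (hsub ht hs)).mono (hsub ht)).continuousWithinAt
    obtain ⟨s, hs, h2⟩ := intermediate_value_Icc' ht.1 h1
      (show (0 : ℝ) ∈ Icc (Z (l, t)) (Z (l, α)) from ⟨not_lt.1 hcon, by
        rw [(hZ l (hlm l hl')).1]; exact hl.1.le⟩)
    have := (hagree l (hlm l hl') 0 h0m s (hsub ht hs)).2 (h2.trans (hZ0 s (hsub ht hs)).symm)
    exact hl.1.ne' this
  -- Below the graph of label `l₀` every height is taken by some label, by the intermediate value
  -- theorem; `ε₀` is at most the minimum of that graph.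
  obtain ⟨ε₀, hε₀, hε₀ρ, hε⟩ : ∃ ε₀ > 0, ε₀ ≤ ρ₀ ∧ ∀ t ∈ Icc α β, ε₀ ≤ Z (l₀, t) := by
    have h1 : ContinuousOn (fun s => Z (l₀, s)) (Icc α β) := fun s hs =>
      ((hZ l₀ (hlm _ ⟨hl₀.le, le_rfl⟩)).2 s hs).continuousWithinAt
    obtain ⟨t, ht, hmin⟩ := isCompact_Icc.exists_isMinOn ⟨α, le_rfl, hαβ.le⟩ h1
    have := hZpos t ht l₀ ⟨hl₀, le_rfl⟩
    exact ⟨min ρ₀ (Z (l₀, t)), by positivity, min_le_left _ _,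
      fun s hs => (min_le_right _ _).trans (hmin hs)⟩
  have hZnn : ∀ t ∈ Icc α β, ∀ l ∈ Icc 0 l₀, 0 ≤ Z (l, t) := by
    intro t ht l hl
    rcases hl.1.eq_or_lt with rfl | h
    · rw [hZ0 t ht]
    · exact (hZpos t ht l ⟨h, hl.2⟩).le
  have hPR : ∀ {P : Set (ℝ × ℝ)}, P ⊆ Icc α β ×ˢ Icc 0 ε₀ → P ⊆ R := fun hP q hq =>
    ⟨(hP hq).1, by linarith [(hP hq).2.1], (hP hq).2.2.trans hε₀ρ⟩
  refine ⟨l₀, ε₀, fun t l => Z (l, t), hl₀, hε₀, hcont, hZ0, hZpos, ?_, ?_, ?_, ?_, ?_⟩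
  · exact fun t ht l hl l' hl' h => (hagree l (hlm l hl) l' (hlm l' hl') t ht).2 h
  · intro θ θ' l h1 h2 h3 hl
    have hs : ∀ t ∈ Icc θ θ', t ∈ Icc α β := fun t ht => ⟨h1.trans ht.1, ht.2.trans h3⟩
    have hmR : ∀ t ∈ Icc θ θ', (t, Z (l, t)) ∈ R := fun t ht =>
      ⟨hs t ht, abs_le.1 (hsmall l hl t (hs t ht))⟩
    have hd : ∀ t ∈ Icc θ θ', HasDerivWithinAt (fun t => (t, Z (l, t))) (1, w t (Z (l, t)))
        (Icc θ θ') t := fun t ht => (hasDerivWithinAt_id t _).prodMk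
      (((hZ l (hlm l hl)).2 t (hs t ht)).mono hs)
    refine reaches_of_hasDerivWithinAt_smul (c := fun t => (t, Z (l, t)))
      (μ := fun t => ((F (t, Z (l, t))).1)⁻¹) h2 ?_ (fun t ht => inv_pos.2 (hRpos _ (hmR t ht)))
      (fun t ht => mem_image_of_mem _ ht) fun t ht => ?_
    · exact ContinuousOn.inv₀ (hF1.comp_continuousOn fun t ht => (hd t ht).continuousWithinAt)
        fun t ht => (hRpos _ (hmR t ht)).ne'
    · refine (hd t ht).congr_deriv ?_
      have := hRpos _ (hmR t ht)
      simp only [hw, hf, hcid _ (hmR t ht).2]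
      ext
      · simp [this.ne']
      · simp [div_eq_inv_mul]
  · exact fun P p q h hP => h.fst_le fun x hx => (hRpos x (hPR hP hx)).le
  · rintro P _ _ ⟨τ, γ, hτ, rfl, rfl, h⟩ hP l hl
    have hγR : ∀ t ∈ Icc 0 τ, γ t ∈ R := fun t ht => hPR hP (h t ht).1
    -- Along `γ`, the height of the moving point and the height of the graph of label `l` at the
    -- same angle solve one scalar equation in time, so they agree at the start exactly if they
    -- agree at the end.
    refine scalar_ode_unique (v := fun t y => (F (γ t)).1 * w (γ t).1 y)
      (K := C.toNNReal * K) (f := fun t => (γ t).2) (g := fun t => Z (l, (γ t).1)) hτ ?_ ?_ ?_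
    · intro t ht
      have hC' := hC _ (hγR t ht)
      refine LipschitzWith.of_dist_le_mul fun x y => ?_
      have := (hwl _ (hγR t ht).1).dist_le_mul x y
      rw [Real.dist_eq] at this ⊢
      rw [← mul_sub, abs_mul]
      push_cast
      rw [mul_assoc]
      exact mul_le_mul (hC'.trans (Real.le_coe_toNNReal C)) this (abs_nonneg _) (by positivity)
    · intro t ht
      refine (hasDerivWithinAt_snd (h t ht).2).congr_deriv ?_
      simp only [hw, hf, hcid _ (hγR t ht).2]
      rw [mul_div_cancel₀ _ (hRpos _ (hγR t ht)).ne']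
    · intro t ht
      have := ((hZ l (hlm l hl)).2 _ (hγR t ht).1).scomp t (hasDerivWithinAt_fst (h t ht).2)
        (fun s hs => (hγR s hs).1)
      simpa [Function.comp_def] using this
  · intro θ hθ ρ hρ'
    have h1 : ContinuousOn (fun l => Z (l, θ)) (Icc 0 l₀) :=
      hZc.comp (by fun_prop) fun l hl => ⟨hlm l hl, hθ⟩
    exact intermediate_value_Icc hl₀.le h1 ⟨by rw [hZ0 θ hθ]; exact hρ'.1, hρ'.2.trans (hε θ hθ)⟩

/-! ### Coordinates of the models near the positive half of the real axis -/

/-- The upper half of the disc of radius two. -/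
def bigDisc : Set (ℝ × ℝ) := {a | a.1 ^ 2 + a.2 ^ 2 ≤ 4 ∧ 0 ≤ a.2}

/-- A position on the trajectories near the positive half-axis. -/
noncomputable def endPos : SectorType → ℝ × ℝ → ℝ
  | .hyperbolic, a => a.1
  | _, a => √(a.1 ^ 2 + a.2 ^ 2)

/-- A label of the trajectories, small exactly near the positive half-axis. -/
noncomputable def endLev : SectorType → ℝ × ℝ → ℝ
  | .hyperbolic, a => a.2
  | .parabolic, a => 1 - a.1 / √(a.1 ^ 2 + a.2 ^ 2)
  | .elliptic, a => if 0 ≤ a.1 then min (1 / 2) (a.2 / (a.1 ^ 2 + a.2 ^ 2)) else 1 / 2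

/-- The point with given position and label. -/
noncomputable def endPt : SectorType → ℝ → ℝ → ℝ × ℝ
  | .hyperbolic, R, v => (R, v)
  | .parabolic, R, v => (R * (1 - v), R * √(2 * v - v ^ 2))
  | .elliptic, R, v => (R * √(1 - v ^ 2 * R ^ 2), v * R ^ 2)

/-- The admissible coordinates. -/
structure EndOK (κ : SectorType) (R v : ℝ) : Prop where
  nonneg : 0 ≤ v
  le : v ≤ 1 / 2 ∨ κ = .parabolic ∧ v ≤ 2
  bound : |R| ≤ 3 / 2
  pos : κ = .hyperbolic ∨ 0 < R
  ne : 0 < v ∨ R ≠ 0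

lemma continuous_endPos (κ : SectorType) : Continuous (endPos κ) := by
  cases κ <;> unfold endPos <;> fun_prop

lemma continuous_endPt (κ : SectorType) : Continuous fun q : ℝ × ℝ => endPt κ q.1 q.2 := by
  cases κ <;> unfold endPt <;> fun_prop

lemma halfDisc_subset_bigDisc : halfDisc ⊆ bigDisc := fun _ ha => ⟨by linarith [ha.1], ha.2⟩

lemma isClosed_bigDisc : IsClosed bigDisc :=
  IsClosed.inter (s₁ := {a : ℝ × ℝ | a.1 ^ 2 + a.2 ^ 2 ≤ 4}) (s₂ := {a : ℝ × ℝ | 0 ≤ a.2})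
    (isClosed_le (by fun_prop) (by fun_prop)) (isClosed_le (by fun_prop) (by fun_prop))

lemma isCompact_bigDisc : IsCompact bigDisc := by
  refine Metric.isCompact_of_isClosed_isBounded isClosed_bigDisc
    ((Metric.isBounded_closedBall (x := (0 : ℝ × ℝ)) (r := 2)).subset fun a ha => ?_)
  have h := ha.1
  rw [mem_closedBall_zero_iff, Prod.norm_def, Real.norm_eq_abs, Real.norm_eq_abs]
  exact max_le (abs_le_of_sq_le_sq (by nlinarith [sq_nonneg a.2]) (by norm_num))
    (abs_le_of_sq_le_sq (by nlinarith [sq_nonneg a.1]) (by norm_num))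

/-- In the elliptic model `y / |z|²` is small near both half-axes, so the left half is assigned the
constant `1/2`. The two definitions fit on the imaginary axis, where the quotient is `1 / y ≥ 1/2`
because `|z| ≤ 2`. -/
lemma continuousOn_endLev (κ : SectorType) : ContinuousOn (endLev κ) (bigDisc \ {0}) := by
  have hsub : bigDisc \ {0} ⊆ ({0}ᶜ : Set (ℝ × ℝ)) := fun a ha => ha.2
  cases κ
  · exact continuous_snd.continuousOn
  · exact (continuousOn_modelLev .parabolic).mono hsub
  · have hc : ContinuousOn (fun a : ℝ × ℝ => a.2 / (a.1 ^ 2 + a.2 ^ 2)) (bigDisc \ {0}) :=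
      (continuousOn_modelLev .elliptic).mono hsub
    rw [continuousOn_iff_continuous_domRestrict] at hc ⊢
    refine Continuous.if_le (f := fun _ => (0 : ℝ)) (g := fun a : ↥(bigDisc \ {0}) => a.1.1)
      (continuous_const.min hc) continuous_const continuous_const (by fun_prop) ?_
    rintro ⟨⟨x, y⟩, ⟨h1, h2⟩, h3⟩ h
    obtain rfl : 0 = x := h
    have hy : y ≠ 0 := fun hy => h3 (by simp [hy])
    simp only at h1 h2
    have hy0 : 0 < y := lt_of_le_of_ne h2 hy.symm
    refine min_eq_left ?_
    simp only
    rw [div_le_div_iff₀ two_pos (by positivity)]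
    nlinarith

/-- In the elliptic case the bounds `v ≤ 1/2` and `R ≤ 3/2` give `v R ≤ 3/4`, so the root in `endPt`
is positive. -/
lemma EndOK.endPt_ne_zero {κ : SectorType} {R v : ℝ} (h : EndOK κ R v) : endPt κ R v ≠ 0 := by
  obtain ⟨h0, h1, h2, h3, h4⟩ := h
  obtain ⟨h5, h6⟩ := abs_le.1 h2
  cases κ
  · simp only [endPt]; rw [pair_ne_zero]
    rcases h4 with h | h
    exacts [Or.inr h.ne', Or.inl h]
  · have hR : 0 < R := by simpa using h3
    simp only [endPt]; rw [pair_ne_zero]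
    rcases eq_or_ne v 1 with rfl | hv
    · right; norm_num; exact hR.ne'
    · left; exact mul_ne_zero hR.ne' (sub_ne_zero.2 hv.symm)
  · have hR : 0 < R := by simpa using h3
    have hv : v ≤ 1 / 2 := by simpa using h1
    have : v * R ≤ 3 / 4 := by nlinarith
    have : 0 < 1 - v ^ 2 * R ^ 2 := by
      have h0 : 0 ≤ v * R := by positivity
      nlinarith
    simp only [endPt]; rw [pair_ne_zero]
    left; positivity

lemma EndOK.coords {κ : SectorType} {R v : ℝ} (h : EndOK κ R v) :
    0 ≤ (endPt κ R v).2 ∧ endPos κ (endPt κ R v) = R ∧ modelLev κ (endPt κ R v) = v ∧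
      (v < 1 / 2 ∨ κ = .parabolic → endLev κ (endPt κ R v) = v) ∧
      (κ ≠ .hyperbolic → (endPt κ R v).1 ^ 2 + (endPt κ R v).2 ^ 2 = R ^ 2) := by
  obtain ⟨h0, h1, h2, h3, h4⟩ := h
  obtain ⟨h5, h6⟩ := abs_le.1 h2
  cases κ
  · exact ⟨h0, rfl, rfl, fun _ => rfl, fun h => absurd rfl h⟩
  · have hR : 0 < R := by simpa using h3
    have hv : v ≤ 2 := by rcases h1 with h | ⟨_, h⟩ <;> linarith
    have e : (R * (1 - v)) ^ 2 + (R * √(2 * v - v ^ 2)) ^ 2 = R ^ 2 := by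
      have : √(2 * v - v ^ 2) ^ 2 = 2 * v - v ^ 2 := Real.sq_sqrt (by nlinarith)
      rw [mul_pow, mul_pow, this]; ring
    have el : 1 - R * (1 - v) / R = v := by field_simp; ring
    refine ⟨by simp only [endPt]; positivity, ?_, ?_, fun _ => ?_, fun _ => e⟩ <;>
      simp only [endPt, endPos, modelLev, endLev, e, Real.sqrt_sq hR.le, el]
  · have hR : 0 < R := by simpa using h3
    have hv : v ≤ 1 / 2 := by simpa using h1
    have : v * R ≤ 3 / 4 := by nlinarith
    have h7 : 0 ≤ 1 - v ^ 2 * R ^ 2 := by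
      have h0 : 0 ≤ v * R := by positivity
      nlinarith
    have e : (R * √(1 - v ^ 2 * R ^ 2)) ^ 2 + (v * R ^ 2) ^ 2 = R ^ 2 := by
      rw [mul_pow, Real.sq_sqrt h7]; ring
    have el : v * R ^ 2 / R ^ 2 = v := by field_simp
    refine ⟨by simp only [endPt]; positivity, ?_, ?_, fun h => ?_, fun _ => e⟩ <;>
      simp only [endPt, endPos, modelLev, endLev, e, Real.sqrt_sq hR.le, el]
    rw [if_pos (by positivity), min_eq_right hv]

lemma EndOK.mem_bigDisc {κ : SectorType} {R v : ℝ} (h : EndOK κ R v) :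
    endPt κ R v ∈ bigDisc := by
  have h5 : R ^ 2 ≤ (3 / 2) ^ 2 := sq_le_sq' (abs_le.1 h.bound).1 (abs_le.1 h.bound).2
  refine ⟨?_, h.coords.1⟩
  by_cases hk : κ = .hyperbolic
  · subst hk
    have : v ≤ 1 / 2 := by simpa using h.le
    have := h.nonneg
    simp only [endPt]; nlinarith
  · rw [h.coords.2.2.2.2 hk]; nlinarith

/-- In the hyperbolic model the segment of label `0` passes through the vertex at `R = 0`; the
condition `hne` keeps it on one side. -/
lemma EndOK.mono {κ : SectorType} {R R' R'' v : ℝ} (h : EndOK κ R v) (h' : EndOK κ R' v)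
    (hne : 0 < v ∨ 0 < R ∨ R' < 0) (hR : R'' ∈ Icc R R') : EndOK κ R'' v := by
  refine ⟨h.nonneg, h.le, ?_, ?_, ?_⟩
  · rw [abs_le]
    exact ⟨(abs_le.1 h.bound).1.trans hR.1, hR.2.trans (abs_le.1 h'.bound).2⟩
  · exact h.pos.imp_right fun h => h.trans_le hR.1
  · rcases hne with h | h | h
    exacts [Or.inl h, Or.inr (h.trans_le hR.1).ne', Or.inr (hR.2.trans_lt h).ne]

lemma EndOK.modelPos_le {κ : SectorType} {R R' v : ℝ} (h : EndOK κ R v) (h' : EndOK κ R' v)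
    (hR : R ≤ R') : modelPos κ (endPt κ R v) ≤ modelPos κ (endPt κ R' v) := by
  cases κ
  · exact hR
  · have hR0 : 0 < R := by simpa using h.pos
    have e := h.coords.2.2.2.2 (by simp)
    have e' := h'.coords.2.2.2.2 (by simp)
    simp only [modelPos, e, e', Real.sqrt_sq hR0.le, Real.sqrt_sq (hR0.le.trans hR)]
    exact Real.log_le_log hR0 hR
  · have hR0 : 0 < R := by simpa using h.pos
    have hR0' : 0 < R' := by simpa using h'.pos
    have e := h.coords.2.2.2.2 (by simp)
    have e' := h'.coords.2.2.2.2 (by simp)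
    simp only [modelPos, e, e']
    simp only [endPt]
    have hd : ∀ r s : ℝ, 0 < r → r * s / r ^ 2 = s / r := fun r s hr => by field_simp
    rw [neg_div, neg_div, neg_le_neg_iff, hd _ _ hR0, hd _ _ hR0']
    have := h.nonneg
    gcongr

/-- Segments of constant label are model arcs. -/
lemma endPt_modelArc {κ : SectorType} {S : Set (ℝ × ℝ)} {R R' v : ℝ} (h : EndOK κ R v)
    (h' : EndOK κ R' v) (hne : 0 < v ∨ 0 < R ∨ R' < 0) (hR : R ≤ R')
    (hS : ∀ R'' ∈ Icc R R', endPt κ R'' v ∈ S) : ModelArc κ S (endPt κ R v) (endPt κ R' v) := by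
  have hok : ∀ R'' ∈ Icc R R', EndOK κ R'' v := fun R'' hR'' => h.mono h' hne hR''
  refine ⟨h.endPt_ne_zero, h'.endPt_ne_zero, by rw [h.coords.2.2.1, h'.coords.2.2.1],
    h.modelPos_le h' hR, fun p hp => ?_⟩
  have hc : ContinuousOn (fun r => modelPos κ (endPt κ r v)) (Icc R R') :=
    (continuousOn_modelPos κ).comp ((continuous_endPt κ).comp
      (by fun_prop : Continuous fun r : ℝ => (r, v))).continuousOn
      fun r hr => (hok r hr).endPt_ne_zero
  obtain ⟨r, hr, rfl⟩ := intermediate_value_Icc hR hc hp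
  have := modelPt_pos_lev (κ := κ) (hok r hr).endPt_ne_zero (hok r hr).coords.1
  rw [(hok r hr).coords.2.2.1] at this
  rw [h.coords.2.2.1]
  simp only [this]
  exact ⟨hS r hr, (hok r hr).endPt_ne_zero⟩

/-- A point with small label is determined by its coordinates. -/
lemma endPt_endPos_endLev {κ : SectorType} {a : ℝ × ℝ} (ha : a ∈ bigDisc) (ha0 : a ≠ 0)
    (hl : endLev κ a < 1 / 2 ∨ κ = .parabolic) :
    endPt κ (endPos κ a) (endLev κ a) = a ∧ 0 ≤ endLev κ a ∧
      (κ = .hyperbolic ∨ 0 < endPos κ a) ∧ (0 < endLev κ a ∨ endPos κ a ≠ 0) ∧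
      modelLev κ a = endLev κ a ∧ (κ = .parabolic → endLev κ a ≤ 2) := by
  have hn := normSq_pos ha0
  cases κ
  · refine ⟨rfl, ha.2, Or.inl rfl, ?_, rfl, by simp⟩
    by_contra h
    push Not at h
    exact ha0 (Prod.ext h.2 (le_antisymm h.1 ha.2))
  · have h1 := modelPt_pos_lev (κ := .parabolic) ha0 ha.2
    have h2 := isLev_modelLev (κ := .parabolic) ha.2
    have hs : 0 < √(a.1 ^ 2 + a.2 ^ 2) := Real.sqrt_pos.2 hn
    simp only [modelPt, modelPos, Real.exp_log hs] at h1
    exact ⟨h1, h2.1, Or.inr hs, Or.inr hs.ne', rfl, h2.2⟩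
  · have hl' : endLev .elliptic a < 1 / 2 := by simpa using hl
    have hx : 0 ≤ a.1 := by
      by_contra h
      simp only [endLev, if_neg h] at hl'
      exact lt_irrefl _ hl'
    have e : endLev .elliptic a = a.2 / (a.1 ^ 2 + a.2 ^ 2) := by
      simp only [endLev, if_pos hx] at hl' ⊢
      exact min_eq_right (by
        rcases min_lt_iff.1 hl' with h | h
        · exact absurd h (lt_irrefl _)
        · exact h.le)
    have hs : 0 < √(a.1 ^ 2 + a.2 ^ 2) := Real.sqrt_pos.2 hn
    have hsq := Real.sq_sqrt hn.le
    rw [e]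
    refine ⟨?_, div_nonneg ha.2 hn.le, Or.inr hs, Or.inr hs.ne', rfl, by simp⟩
    simp only [endPt, endPos, hsq]
    rw [← Real.sqrt_mul hn.le]
    have : (a.1 ^ 2 + a.2 ^ 2) * (1 - (a.2 / (a.1 ^ 2 + a.2 ^ 2)) ^ 2 * (a.1 ^ 2 + a.2 ^ 2))
        = a.1 ^ 2 := by
      field_simp; ring
    rw [this, Real.sqrt_sq hx, div_mul_cancel₀ _ hn.ne']

lemma EndOK.of_mem {κ : SectorType} {a : ℝ × ℝ} (ha : a ∈ bigDisc) (ha0 : a ≠ 0)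
    (hl : endLev κ a < 1 / 2 ∨ κ = .parabolic) (hR : |endPos κ a| ≤ 3 / 2) :
    EndOK κ (endPos κ a) (endLev κ a) := by
  have h := endPt_endPos_endLev ha ha0 hl
  refine ⟨h.2.1, ?_, hR, h.2.2.1, h.2.2.2.1⟩
  rcases hl with h1 | h1
  exacts [Or.inl h1.le, Or.inr ⟨h1, h.2.2.2.2.2 h1⟩]

lemma abs_endPos_le {κ : SectorType} {a : ℝ × ℝ} : |endPos κ a| ≤ √(a.1 ^ 2 + a.2 ^ 2) := by
  cases κ
  · exact Real.abs_le_sqrt (by simp only [endPos]; nlinarith [sq_nonneg a.2])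
  · exact (abs_of_nonneg (Real.sqrt_nonneg _)).le
  · exact (abs_of_nonneg (Real.sqrt_nonneg _)).le

lemma abs_endPos_le_one {κ : SectorType} {a : ℝ × ℝ} (ha : a ∈ halfDisc) : |endPos κ a| ≤ 1 :=
  abs_endPos_le.trans (Real.sqrt_le_one.2 ha.1)

/-- Along model arcs the label is constant, and the position increases near the half-axis. -/
lemma ModelArc.endLev {κ : SectorType} {a b : ℝ × ℝ} (h : ModelArc κ bigDisc a b)
    (ha : a ∈ bigDisc) :
    endLev κ a = endLev κ b ∧
      (endLev κ a < 1 / 2 ∨ κ = .parabolic → endPos κ a ≤ endPos κ b) := by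
  obtain ⟨ha0, hb0, hl, hp, hm⟩ := h
  have hna := normSq_pos ha0
  have hnb := normSq_pos hb0
  cases κ
  · exact ⟨hl, fun _ => hp⟩
  · refine ⟨hl, fun _ => ?_⟩
    simp only [modelPos] at hp
    exact (Real.log_le_log_iff (Real.sqrt_pos.2 hna) (Real.sqrt_pos.2 hnb)).1 hp
  · simp only [modelLev, modelPos] at hl hp hm
    set v := a.2 / (a.1 ^ 2 + a.2 ^ 2) with hv
    have hv0 : 0 ≤ v := div_nonneg ha.2 hna.le
    by_cases hv2 : 1 / 2 ≤ v
    · have e : ∀ c : ℝ × ℝ, v = c.2 / (c.1 ^ 2 + c.2 ^ 2) → _root_.endLev .elliptic c = 1 / 2 := by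
        intro c hc
        simp only [_root_.endLev, ← hc, min_eq_left hv2, ite_self]
      rw [e a rfl, e b hl]
      exact ⟨rfl, fun h => absurd h (by simp)⟩
    · have hv2 := not_le.1 hv2
      -- Position `0` is the top `(0, 1/v)` of the circle, which lies outside the disc of radius `2`
      -- when `v < 1/2`. Hence the arc stays on one side of the imaginary axis.
      have h0 : ¬ ((0 : ℝ) ∈ Icc (-a.1 / (a.1 ^ 2 + a.2 ^ 2)) (-b.1 / (b.1 ^ 2 + b.2 ^ 2))) := by
        intro h
        obtain ⟨h1, h2⟩ := hm 0 h
        rcases hv0.eq_or_lt with h3 | h3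
        · apply h2; simp [modelPt, ← h3]
        · have h4 := h1.1
          simp only [modelPt, neg_zero, zero_div, ne_eq, OfNat.ofNat_ne_zero, not_false_eq_true,
            zero_pow, zero_add] at h4
          have : v / v ^ 2 = 1 / v := by field_simp
          rw [this] at h4
          have : 2 < 1 / v := by rw [lt_div_iff₀ h3]; linarith
          nlinarith
      have hcase : (0 < a.1 ∧ 0 < b.1) ∨ (a.1 < 0 ∧ b.1 < 0) := by
        rcases lt_or_ge 0 a.1 with h1 | h1
        · left
          refine ⟨h1, ?_⟩
          by_contra h2
          exact h0 ⟨div_nonpos_of_nonpos_of_nonneg (by linarith) hna.le,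
            div_nonneg (by linarith) hnb.le⟩
        · right
          have h3 : a.1 < 0 := by
            refine lt_of_le_of_ne h1 fun h => h0 ?_
            rw [h] at hp ⊢
            simp only [neg_zero, zero_div] at hp ⊢
            exact ⟨le_rfl, hp⟩
          have h4 : 0 < -a.1 / (a.1 ^ 2 + a.2 ^ 2) := div_pos (by linarith) hna
          have h5 := h4.trans_le hp
          refine ⟨h3, ?_⟩
          by_contra h6
          exact absurd h5 (not_lt.2 (div_nonpos_of_nonpos_of_nonneg (by linarith) hnb.le))
      rcases hcase with ⟨h1, h2⟩ | ⟨h1, h2⟩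
      · simp only [_root_.endLev, if_pos h1.le, if_pos h2.le, ← hv, ← hl, true_and]
        intro _
        simp only [endPos]
        apply Real.sqrt_le_sqrt
        have hpa : (-a.1 / (a.1 ^ 2 + a.2 ^ 2)) ^ 2 + v ^ 2 = (a.1 ^ 2 + a.2 ^ 2)⁻¹ := by
          rw [hv]; field_simp
        have hpb : (-b.1 / (b.1 ^ 2 + b.2 ^ 2)) ^ 2 + v ^ 2 = (b.1 ^ 2 + b.2 ^ 2)⁻¹ := by
          rw [hl]; field_simp
        have h3 : -b.1 / (b.1 ^ 2 + b.2 ^ 2) < 0 := div_neg_of_neg_of_pos (by linarith) hnb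
        rw [← inv_le_inv₀ hnb hna, ← hpa, ← hpb]
        nlinarith
      · simp only [_root_.endLev, if_neg (not_le.2 h1), if_neg (not_le.2 h2), true_and]
        intro h
        simp at h

/-- Points in between with respect to the coordinates lie on the arc. -/
lemma ModelArc.endPt_between {κ : SectorType} {S : Set (ℝ × ℝ)} {R R' R'' v : ℝ}
    (h : ModelArc κ S (endPt κ R v) (endPt κ R' v)) (hR : EndOK κ R v) (hR' : EndOK κ R' v)
    (hR'' : EndOK κ R'' v) (h1 : R ≤ R'') (h2 : R'' ≤ R') :
    Reaches (modelField κ) S (endPt κ R v) (endPt κ R'' v) ∧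
      Reaches (modelField κ) S (endPt κ R'' v) (endPt κ R' v) := by
  have hl := hR.coords.2.2.1
  have hl' := hR'.coords.2.2.1
  have hl'' := hR''.coords.2.2.1
  refine ⟨ModelArc.reaches ⟨h.left, hR''.endPt_ne_zero, hl.trans hl''.symm,
    hR.modelPos_le hR'' h1, fun p hp => h.mem p ⟨hp.1, hp.2.trans (hR''.modelPos_le hR' h2)⟩⟩
    hR.coords.1 hR''.coords.1, ModelArc.reaches ⟨hR''.endPt_ne_zero, h.right, hl''.trans hl'.symm,
    hR''.modelPos_le hR' h2, fun p hp => ?_⟩ hR''.coords.1 hR'.coords.1⟩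
  rw [hl'', ← hl]
  exact h.mem p ⟨(hR.modelPos_le hR'' h1).trans hp.1, hp.2⟩

/-! ### Sectors near a boundary arc -/

/-- On a compact set, what holds near the zeros of a function holds where the function is small. -/
lemma IsCompact.exists_of_eventually_of_eq_zero {X : Type*} [TopologicalSpace X] {K : Set X}
    (hK : IsCompact K) {g : X → ℝ} (hg : ContinuousOn g K) (h0 : ∀ x ∈ K, 0 ≤ g x) {p : X → Prop}
    (hp : ∀ x ∈ K, g x = 0 → ∀ᶠ y in 𝓝[K] x, p y) : ∃ ε > 0, ∀ x ∈ K, g x < ε → p x := by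
  -- On the closure of the exceptional set `g` has no zero, and its minimum there serves as `ε`.
  set C := K ∩ closure {x ∈ K | ¬ p x} with hC
  have hCc : IsCompact C := hK.inter_right isClosed_closure
  have hpos : ∀ x ∈ C, 0 < g x := by
    intro x hx
    refine lt_of_le_of_ne (h0 x hx.1) fun h => ?_
    have h1 := hp x hx.1 h.symm
    have h2 := mem_closure_iff_nhdsWithin_neBot.1 hx.2
    have h3 : ∀ᶠ y in 𝓝[{x ∈ K | ¬ p x}] x, p y := h1.filter_mono (nhdsWithin_mono _ fun y hy => hy.1)
    have h4 : ∀ᶠ y in 𝓝[{x ∈ K | ¬ p x}] x, ¬ p y :=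
      Filter.mem_of_superset self_mem_nhdsWithin fun y hy => hy.2
    obtain ⟨y, hy, hy'⟩ := (h3.and h4).exists
    exact hy' hy
  by_cases hne : C.Nonempty
  · obtain ⟨x, hx, hmin⟩ := hCc.exists_isMinOn hne (hg.mono inter_subset_left)
    refine ⟨g x, hpos x hx, fun y hy hlt => ?_⟩
    by_contra hcon
    exact absurd (hmin ⟨hy, subset_closure ⟨hy, hcon⟩⟩) (not_le.2 hlt)
  · refine ⟨1, one_pos, fun y hy _ => ?_⟩
    by_contra hcon
    exact hne ⟨y, hy, subset_closure ⟨hy, hcon⟩⟩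

lemma endPt_zero_right (κ : SectorType) (R : ℝ) : endPt κ R 0 = (R, 0) := by
  cases κ <;> simp [endPt]

lemma endOK_of_mem {κ : SectorType} {R v : ℝ} (hR : R ∈ Ioc 0 (3 / 2)) (hv : v ∈ Icc 0 (1 / 2)) :
    EndOK κ R v :=
  ⟨hv.1, Or.inl hv.2, by rw [abs_of_pos hR.1]; exact hR.2, Or.inr hR.1, Or.inr hR.1.ne'⟩

/-- A chart of a part of the set `S` near the vertex `(θ₀, 0)` by the model on the disc of radius
two, with the positive half-axis on the line `ρ = 0`, on the side of `θ₀` given by the sign `σ`. -/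
structure IsLocalChart (F : ℝ × ℝ → ℝ × ℝ) (κ : SectorType) (S : Set (ℝ × ℝ)) (σ θ₀ d : ℝ)
    (k : ℝ × ℝ → ℝ × ℝ) : Prop where
  sign : σ = 1 ∨ σ = -1
  cont : ContinuousOn k bigDisc
  inj : InjOn k bigDisc
  vertex : k 0 = (θ₀, 0)
  axis : ∀ x ∈ Icc (0 : ℝ) 2, (k (x, 0)).2 = 0
  axis_mono : StrictMonoOn (fun x => σ * (k (x, 0)).1) (Icc 0 2)
  pos : ∀ a ∈ bigDisc, ¬ (a.2 = 0 ∧ 0 ≤ a.1) → 0 < (k a).2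
  arcs : ∀ a b, Reaches (modelField κ) bigDisc a b →
    Reaches F (k '' {c | Reaches (modelField κ) bigDisc a c ∧ Reaches (modelField κ) bigDisc c b})
      (k a) (k b)
  subset : ∀ a ∈ bigDisc, k a ∈ S
  near : ∀ a ∈ bigDisc, |(k a).1 - θ₀| < d
  cover : ∀ c > 0, ∃ ε > 0, ∀ q ∈ S, q.2 < ε →
    (∃ a ∈ halfDisc, k a = q) ∨
    (∃ a ∈ bigDisc \ {0}, endPos κ a ∈ Ioo (1 / 2) (3 / 2) ∧ endLev κ a < c ∧ k a = q) ∨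
    σ * (k (5 / 4, 0)).1 < σ * q.1

/-! ### Local charts inside a flow box -/

namespace IsLocalChart

variable {F F' : ℝ × ℝ → ℝ × ℝ} {κ : SectorType} {S : Set (ℝ × ℝ)} {σ θ₀ d : ℝ} {k : ℝ × ℝ → ℝ × ℝ}

lemma snd_nonneg (hk : IsLocalChart F κ S σ θ₀ d k) {a : ℝ × ℝ} (ha : a ∈ bigDisc) :
    0 ≤ (k a).2 := by
  by_cases h : a.2 = 0 ∧ 0 ≤ a.1
  · have h2 : a.1 ≤ 2 := by nlinarith [ha.1, h.1, h.2]
    have := hk.axis a.1 ⟨h.2, h2⟩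
    have e : (a.1, (0 : ℝ)) = a := Prod.ext rfl h.1.symm
    rw [e] at this
    exact this.ge
  · exact (hk.pos a ha h).le

lemma eq_of_snd_eq_zero (hk : IsLocalChart F κ S σ θ₀ d k) {a : ℝ × ℝ} (ha : a ∈ bigDisc)
    (h : (k a).2 = 0) : a = (a.1, 0) ∧ a.1 ∈ Icc (0 : ℝ) 2 := by
  by_cases h' : a.2 = 0 ∧ 0 ≤ a.1
  · exact ⟨Prod.ext rfl h'.1, h'.2, by nlinarith [ha.1, h'.1, h'.2]⟩
  · exact absurd h (hk.pos a ha h').ne'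

/-- The chart takes segments of constant label to trajectory arcs. -/
lemma reaches_endPt (hk : IsLocalChart F κ S σ θ₀ d k) {R R' v : ℝ} (h : EndOK κ R v)
    (h' : EndOK κ R' v) (hv : v < 1 / 2 ∨ κ = .parabolic) (hne : 0 < v ∨ 0 < R ∨ R' < 0)
    (hR : R ≤ R') :
    Reaches F ((fun r => k (endPt κ r v)) '' Icc R R') (k (endPt κ R v)) (k (endPt κ R' v)) := by
  have harc : ModelArc κ bigDisc (endPt κ R v) (endPt κ R' v) :=
    endPt_modelArc h h' hne hR fun r hr => (h.mono h' hne hr).mem_bigDisc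
  refine (hk.arcs _ _ (harc.reaches h.coords.1 h'.coords.1)).mono ?_
  rintro _ ⟨c, ⟨h1, h2⟩, rfl⟩
  have hup : ∀ a ∈ bigDisc, 0 ≤ a.2 := fun a ha => ha.2
  have hc : c ∈ bigDisc := h1.right_mem
  have hc0 : c ≠ 0 := fun hc0 => h.endPt_ne_zero ((reaches_model_zero_iff h1).2 hc0)
  have a1 := (h1.modelArc hup h.endPt_ne_zero).endLev h.mem_bigDisc
  have a2 := (h2.modelArc hup hc0).endLev hc
  have e := h.coords.2.2.2.1 hv
  have p := h.coords.2.1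
  have p' := h'.coords.2.1
  have ec : endLev κ c = v := by rw [← a1.1, e]
  have hcl : endLev κ c < 1 / 2 ∨ κ = .parabolic := by rw [ec]; exact hv
  have b1 := a1.2 (by rw [e]; exact hv)
  have b2 := a2.2 hcl
  rw [p] at b1; rw [p'] at b2
  refine ⟨endPos κ c, ⟨b1, b2⟩, ?_⟩
  have := (endPt_endPos_endLev hc hc0 hcl).1
  rw [ec] at this
  simp only [this]

/-- The normal form of a chart in a flow box. -/
structure IsNormal (k : ℝ × ℝ → ℝ × ℝ) (κ : SectorType) (σ α β l₀ : ℝ) (Y : ℝ → ℝ → ℝ) (c : ℝ)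
    (r : ℝ → ℝ) : Prop where
  pos : 0 < c
  le : c ≤ 1 / 4
  cont : ContinuousOn r (Icc 0 c)
  mono : StrictMonoOn r (Icc 0 c)
  zero : r 0 = 0
  mapsTo : MapsTo r (Icc 0 c) (Icc 0 l₀)
  mem : ∀ v ∈ Icc 0 c, ∀ R ∈ Icc (1 / 2 : ℝ) (3 / 2), (k (endPt κ R v)).1 ∈ Icc α β
  eq : ∀ v ∈ Icc 0 c, ∀ R ∈ Icc (1 / 2 : ℝ) (3 / 2),
    (k (endPt κ R v)).2 = Y (k (endPt κ R v)).1 (r v)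
  strict : ∀ v ∈ Icc 0 c, StrictMonoOn (fun R => σ * (k (endPt κ R v)).1) (Icc (1 / 2) (3 / 2))
  cross : ∀ v ∈ Icc 0 c, σ * (k (5 / 4, 0)).1 ∈
    Ioo (σ * (k (endPt κ 1 v)).1) (σ * (k (endPt κ (3 / 2) v)).1)

lemma continuousOn_endPt (hk : IsLocalChart F κ S σ θ₀ d k) :
    ContinuousOn (fun q : ℝ × ℝ => k (endPt κ q.1 q.2)) (Icc (1 / 2) (3 / 2) ×ˢ Icc 0 (1 / 2)) :=
  hk.cont.comp (continuous_endPt κ).continuousOn fun q hq =>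
    (endOK_of_mem ⟨by linarith [hq.1.1], hq.1.2⟩ hq.2).mem_bigDisc

/-- For small `v` the segment of label `v` is mapped to a trajectory arc inside the flow box, hence
to a piece of a single graph, whose label is `r v`. The function `r` is continuous, injective and
vanishes at `0`, so it increases strictly; likewise the angle is injective along each segment and
therefore strictly monotone. -/
lemma exists_isNormal (hk : IsLocalChart F' κ S σ θ₀ d k)
    (hF : F' = F ∧ σ = 1 ∨ F' = -F ∧ σ = -1) {α β l₀ ε₀ : ℝ} {Y : ℝ → ℝ → ℝ}
    (hB : IsFlowBox F α β l₀ ε₀ Y)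
    (hin : ∀ R ∈ Icc (1 / 2 : ℝ) (3 / 2), (k (R, 0)).1 ∈ Ioo α β) :
    ∃ c r, IsNormal k κ σ α β l₀ Y c r := by
  set E : ℝ × ℝ → ℝ × ℝ := fun q => k (endPt κ q.1 q.2) with hE
  have hEc : ContinuousOn E (Icc (1 / 2) (3 / 2) ×ˢ Icc 0 (1 / 2)) := hk.continuousOn_endPt
  have hE0 : ∀ R, E (R, 0) = k (R, 0) := fun R => by simp only [hE, endPt_zero_right]
  have hax : ∀ R ∈ Icc (1 / 2 : ℝ) (3 / 2), R ∈ Icc (0 : ℝ) 2 := fun R hR =>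
    ⟨by linarith [hR.1], by linarith [hR.2]⟩
  have hσ : σ ≠ 0 := by rcases hk.sign with h | h <;> rw [h] <;> norm_num
  -- Labels below `c₁` keep the whole rectangle inside the box, by compactness from label `0`.
  obtain ⟨c₁, hc₁, hc₁'⟩ : ∃ ε > 0, ∀ q ∈ Icc (1 / 2 : ℝ) (3 / 2) ×ˢ Icc (0 : ℝ) (1 / 2), q.2 < ε →
      ((E q).1 ∈ Ioo α β ∧ (E q).2 < ε₀) := by
    refine (isCompact_Icc.prod isCompact_Icc).exists_of_eventually_of_eq_zero
      continuous_snd.continuousOn (fun q hq => hq.2.1) ?_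
    rintro ⟨R, v⟩ hq h
    obtain rfl : v = 0 := h
    have h1 := hEc _ hq
    have h2 : E (R, 0) ∈ Ioo α β ×ˢ Iio ε₀ := by
      rw [hE0]
      exact ⟨hin R hq.1, by rw [mem_Iio, hk.axis R (hax R hq.1)]; exact hB.ε_pos⟩
    exact h1.eventually ((isOpen_Ioo.prod isOpen_Iio).mem_nhds h2)
  have m1 := hk.axis_mono (hax (1 / 2) (by norm_num)) (hax 1 (by norm_num)) (by norm_num)
  have m2 := hk.axis_mono (hax 1 (by norm_num)) (hax (5 / 4) (by norm_num)) (by norm_num)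
  have m3 := hk.axis_mono (hax (5 / 4) (by norm_num)) (hax (3 / 2) (by norm_num)) (by norm_num)
  simp only at m1 m2 m3
  -- Two thresholds that, for labels below `c₂`, separate the angles at `R = 1/2`, `1` and `3/2`
  -- simultaneously for all labels.
  set t₀ := (σ * (k (1 / 2, 0)).1 + σ * (k (1, 0)).1) / 2 with ht₀
  set t₁ := σ * (k (5 / 4, 0)).1 with ht₁
  obtain ⟨c₂, hc₂, hc₂'⟩ : ∃ ε > 0, ∀ v ∈ Icc (0 : ℝ) (1 / 2), v < ε →
      (σ * (E (1 / 2, v)).1 < t₀ ∧ σ * (E (1, v)).1 ∈ Ioo t₀ t₁ ∧ t₁ < σ * (E (3 / 2, v)).1) := by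
    refine isCompact_Icc.exists_of_eventually_of_eq_zero continuousOn_id (fun q hq => hq.1) ?_
    rintro v hv h
    obtain rfl : v = 0 := h
    have hc : ∀ R ∈ Icc (1 / 2 : ℝ) (3 / 2), ContinuousWithinAt (fun v => σ * (E (R, v)).1)
        (Icc 0 (1 / 2)) 0 := fun R hR =>
      (continuousOn_const.mul (continuous_fst.comp_continuousOn (hEc.comp
        (by fun_prop : Continuous fun v : ℝ => (R, v)).continuousOn fun v hv => ⟨hR, hv⟩))) 0 hv
    refine ((hc (1 / 2) (by norm_num)).eventually (Iio_mem_nhds ?_)).and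
      (((hc 1 (by norm_num)).eventually (Ioo_mem_nhds ?_ ?_)).and
      ((hc (3 / 2) (by norm_num)).eventually (Ioi_mem_nhds ?_))) <;> simp only [hE0] <;> linarith
  set c := min (1 / 4) (min (c₁ / 2) (c₂ / 2)) with hc
  have hcpos : 0 < c := by positivity
  have hc4 : c ≤ 1 / 4 := min_le_left _ _
  have hcc₁ : c < c₁ := by
    have := (min_le_right (1 / 4) (min (c₁ / 2) (c₂ / 2))).trans (min_le_left _ _); linarith
  have hcc₂ : c < c₂ := by
    have := (min_le_right (1 / 4) (min (c₁ / 2) (c₂ / 2))).trans (min_le_right _ _); linarith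
  have hv2 : ∀ v ∈ Icc 0 c, v ∈ Icc (0 : ℝ) (1 / 2) := fun v hv => ⟨hv.1, by linarith [hv.2]⟩
  have hok : ∀ v ∈ Icc 0 c, ∀ R ∈ Icc (1 / 2 : ℝ) (3 / 2), EndOK κ R v := fun v hv R hR =>
    endOK_of_mem ⟨by linarith [hR.1], hR.2⟩ (hv2 v hv)
  have hbox : ∀ v ∈ Icc 0 c, ∀ R ∈ Icc (1 / 2 : ℝ) (3 / 2), E (R, v) ∈ Icc α β ×ˢ Icc 0 ε₀ := by
    intro v hv R hR
    have := hc₁' (R, v) ⟨hR, hv2 v hv⟩ (hv.2.trans_lt hcc₁)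
    exact ⟨Ioo_subset_Icc_self this.1, hk.snd_nonneg (hok v hv R hR).mem_bigDisc, this.2.le⟩
  have hlab : ∀ v ∈ Icc 0 c, ∀ R ∈ Icc (1 / 2 : ℝ) (3 / 2), ∀ R' ∈ Icc (1 / 2 : ℝ) (3 / 2),
      ∀ l ∈ Icc 0 l₀, (E (R, v)).2 = Y (E (R, v)).1 l → (E (R', v)).2 = Y (E (R', v)).1 l := by
    have aux : ∀ v ∈ Icc 0 c, ∀ R ∈ Icc (1 / 2 : ℝ) (3 / 2), ∀ R' ∈ Icc (1 / 2 : ℝ) (3 / 2),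
        R ≤ R' → ∀ l ∈ Icc 0 l₀,
        ((E (R, v)).2 = Y (E (R, v)).1 l ↔ (E (R', v)).2 = Y (E (R', v)).1 l) := by
      intro v hv R hR R' hR' hRR l hl
      have h := hk.reaches_endPt (hok v hv R hR) (hok v hv R' hR') (Or.inl (by linarith [hv.2]))
        (Or.inr (Or.inl (by linarith [hR.1]))) hRR
      have hsub : (fun r => k (endPt κ r v)) '' Icc R R' ⊆ Icc α β ×ˢ Icc 0 ε₀ := by
        rintro _ ⟨r, hr, rfl⟩
        exact hbox v hv r ⟨hR.1.trans hr.1, hr.2.trans hR'.2⟩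
      rcases hF with ⟨rfl, -⟩ | ⟨rfl, -⟩
      · exact hB.label _ _ _ h hsub l hl
      · exact (hB.label _ _ _ (reaches_neg_iff.1 h) hsub l hl).symm
    intro v hv R hR R' hR' l hl h
    rcases le_total R R' with h1 | h1
    · exact (aux v hv R hR R' hR' h1 l hl).1 h
    · exact (aux v hv R' hR' R hR h1 l hl).2 h
  have h1m : (1 : ℝ) ∈ Icc (1 / 2 : ℝ) (3 / 2) := by norm_num
  choose! r hr hrY using fun v (hv : v ∈ Icc 0 c) =>
    hB.cover _ (hbox v hv 1 h1m).1 _ (hbox v hv 1 h1m).2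
  have heq : ∀ v ∈ Icc 0 c, ∀ R ∈ Icc (1 / 2 : ℝ) (3 / 2), (E (R, v)).2 = Y (E (R, v)).1 (r v) :=
    fun v hv R hR => hlab v hv 1 h1m R hR (r v) (hr v hv) (hrY v hv).symm
  have hEinj : ∀ v ∈ Icc 0 c, ∀ v' ∈ Icc 0 c, ∀ R ∈ Icc (1 / 2 : ℝ) (3 / 2),
      ∀ R' ∈ Icc (1 / 2 : ℝ) (3 / 2), E (R, v) = E (R', v') → R = R' ∧ v = v' := by
    intro v hv v' hv' R hR R' hR' h
    have h1 := hok v hv R hR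
    have h2 := hok v' hv' R' hR'
    have h3 := hk.inj h1.mem_bigDisc h2.mem_bigDisc h
    have h4 := congrArg (endPos κ) h3
    have h5 := congrArg (modelLev κ) h3
    rw [h1.coords.2.1, h2.coords.2.1] at h4
    rw [h1.coords.2.2.1, h2.coords.2.2.1] at h5
    exact ⟨h4, h5⟩
  have hRc : ∀ v ∈ Icc 0 c, ContinuousOn (fun R => σ * (E (R, v)).1) (Icc (1 / 2) (3 / 2)) :=
    fun v hv => continuousOn_const.mul (continuous_fst.comp_continuousOn (hEc.comp
      (by fun_prop : Continuous fun R : ℝ => (R, v)).continuousOn fun R hR => ⟨hR, hv2 v hv⟩))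
  -- The segment of label `v` passes over the angle of the point `(1, v')` of the other segment. If
  -- both lay on the same graph they would share a point, against the injectivity of the chart.
  have hrinj : InjOn r (Icc 0 c) := by
    intro v hv v' hv' h
    have a1 := hc₂' v (hv2 v hv) (hv.2.trans_lt hcc₂)
    have a2 := hc₂' v' (hv2 v' hv') (hv'.2.trans_lt hcc₂)
    obtain ⟨R, hR, hRe⟩ := intermediate_value_Icc (by norm_num) (hRc v hv)
      (show σ * (E (1, v')).1 ∈ Icc (σ * (E (1 / 2, v)).1) (σ * (E (3 / 2, v)).1) from
        ⟨by linarith [a1.1, a2.2.1.1], by linarith [a1.2.2, a2.2.1.2]⟩)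
    have e1 : (E (R, v)).1 = (E (1, v')).1 := mul_left_cancel₀ hσ hRe
    have e2 : (E (R, v)).2 = (E (1, v')).2 := by
      rw [heq v hv R hR, heq v' hv' 1 h1m, e1, h]
    exact (hEinj v hv v' hv' R hR 1 h1m (Prod.ext e1 e2)).2
  have hr0 : r 0 = 0 := by
    have h0 : (0 : ℝ) ∈ Icc 0 c := ⟨le_rfl, hcpos.le⟩
    have hb := hbox 0 h0 1 h1m
    refine hB.inj _ hb.1 (hr 0 h0) ⟨le_rfl, hB.l_pos.le⟩ ?_
    rw [hrY 0 h0, hB.zero _ hb.1, hE0, hk.axis 1 (by norm_num)]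
  -- `r v` is read off by inverting `(θ, l) ↦ (θ, Y θ l)`, an embedding on a compact rectangle.
  have hrc : ContinuousOn r (Icc 0 c) := by
    set Bx : ℝ × ℝ → ℝ × ℝ := fun q => (q.1, Y q.1 q.2) with hBx
    have hBc : ContinuousOn Bx (Icc α β ×ˢ Icc 0 l₀) := continuous_fst.continuousOn.prodMk hB.cont
    have hBi : InjOn Bx (Icc α β ×ˢ Icc 0 l₀) := by
      rintro ⟨θ, l⟩ h ⟨θ', l'⟩ h' he
      simp only [hBx, Prod.mk.injEq] at he
      obtain ⟨rfl, he⟩ := he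
      exact Prod.ext rfl (hB.inj θ h.1 h.2 h'.2 he)
    have hinv := (isCompact_Icc.prod isCompact_Icc).continuousOn_of_leftInvOn hBc
      hBi.leftInvOn_invFunOn
    have hE1 : ContinuousOn (fun v => E (1, v)) (Icc 0 c) := hEc.comp
      (by fun_prop : Continuous fun v : ℝ => ((1 : ℝ), v)).continuousOn fun v hv => ⟨h1m, hv2 v hv⟩
    have hBE : ∀ v ∈ Icc 0 c, Bx ((E (1, v)).1, r v) = E (1, v) := fun v hv =>
      Prod.ext rfl (hrY v hv)
    have := continuous_snd.comp_continuousOn (hinv.comp hE1 fun v hv =>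
      ⟨((E (1, v)).1, r v), ⟨(hbox v hv 1 h1m).1, hr v hv⟩, hBE v hv⟩)
    refine this.congr fun v hv => ?_
    have e := hBi.leftInvOn_invFunOn (show ((E (1, v)).1, r v) ∈ Icc α β ×ˢ Icc 0 l₀ from
      ⟨(hbox v hv 1 h1m).1, hr v hv⟩)
    rw [hBE v hv] at e
    simp only [Function.comp, e]
  refine ⟨c, r, hcpos, hc4, hrc, ?_, hr0, hr, fun v hv R hR => (hbox v hv R hR).1, heq,
    fun v hv => ?_, fun v hv => ?_⟩
  · refine hrc.strictMonoOn_of_injOn_Icc hcpos.le ?_ hrinj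
    rw [hr0]; exact (hr c ⟨hcpos.le, le_rfl⟩).1
  · have a1 := hc₂' v (hv2 v hv) (hv.2.trans_lt hcc₂)
    refine (hRc v hv).strictMonoOn_of_injOn_Icc (by norm_num) ?_ ?_
    · show σ * (E (1 / 2, v)).1 ≤ σ * (E (3 / 2, v)).1
      linarith [a1.1, a1.2.1.1, a1.2.1.2, a1.2.2]
    · intro R hR R' hR' h
      have e1 : (E (R, v)).1 = (E (R', v)).1 := mul_left_cancel₀ hσ h
      exact (hEinj v hv v hv R hR R' hR' (Prod.ext e1 (by
        rw [heq v hv R hR, heq v hv R' hR', e1]))).1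
  · have a1 := hc₂' v (hv2 v hv) (hv.2.trans_lt hcc₂)
    exact ⟨a1.2.1.2, a1.2.2⟩

lemma IsNormal.of_le {α β l₀ c c' : ℝ} {Y : ℝ → ℝ → ℝ} {r : ℝ → ℝ}
    (h : IsNormal k κ σ α β l₀ Y c r) (h0 : 0 < c') (hc : c' ≤ c) :
    IsNormal k κ σ α β l₀ Y c' r := by
  have hs : Icc 0 c' ⊆ Icc 0 c := Icc_subset_Icc_right hc
  exact ⟨h0, hc.trans h.le, h.cont.mono hs, h.mono.mono hs, h.zero, h.mapsTo.mono_left hs,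
    fun v hv => h.mem v (hs hv), fun v hv => h.eq v (hs hv), fun v hv => h.strict v (hs hv),
    fun v hv => h.cross v (hs hv)⟩

/-- Beyond the transversal the flow box does not meet the chart. -/
lemma exists_avoid (hk : IsLocalChart F' κ S σ θ₀ d k) {α β l₀ ε₀ : ℝ} {Y : ℝ → ℝ → ℝ}
    (hB : IsFlowBox F α β l₀ ε₀ Y) {c : ℝ} {r : ℝ → ℝ} (hn : IsNormal k κ σ α β l₀ Y c r) :
    ∃ c' ∈ Ioc 0 c, ∀ v ∈ Icc 0 c', ∀ θ ∈ Icc α β, ∀ a ∈ bigDisc, endPos κ a ≤ 1 →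
      k a = (θ, Y θ (r v)) → σ * θ ≤ σ * (k (endPt κ 1 v)).1 := by
  have hσ : σ ≠ 0 := by rcases hk.sign with h | h <;> rw [h] <;> norm_num
  have hcp := hn.pos
  have hc4 := hn.le
  set K₀ : Set ((ℝ × ℝ) × (ℝ × ℝ)) := (bigDisc ∩ {a | endPos κ a ≤ 1}) ×ˢ (Icc α β ×ˢ Icc 0 c)
  have hK₀ : IsCompact K₀ := (isCompact_bigDisc.inter_right
    (isClosed_le (continuous_endPos κ) continuous_const)).prod (isCompact_Icc.prod isCompact_Icc)
  have h1m : (1 : ℝ) ∈ Icc (1 / 2 : ℝ) (3 / 2) := by norm_num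
  have c1 : ContinuousOn (fun z : (ℝ × ℝ) × (ℝ × ℝ) => k z.1) K₀ :=
    hk.cont.comp continuous_fst.continuousOn fun z hz => hz.1.1
  have c2 : ContinuousOn (fun z : (ℝ × ℝ) × (ℝ × ℝ) => (z.2.1, Y z.2.1 (r z.2.2))) K₀ := by
    have hr : ContinuousOn (fun z : (ℝ × ℝ) × (ℝ × ℝ) => r z.2.2) K₀ :=
      hn.cont.comp (by fun_prop) fun z hz => hz.2.2
    have h1 : ContinuousOn (fun z : (ℝ × ℝ) × (ℝ × ℝ) => z.2.1) K₀ := by fun_prop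
    exact h1.prodMk (hB.cont.comp (h1.prodMk hr) fun z hz => ⟨hz.2.1, hn.mapsTo hz.2.2⟩)
  have c3 : ContinuousOn (fun z : (ℝ × ℝ) × (ℝ × ℝ) =>
      σ * z.2.1 - σ * (k (endPt κ 1 z.2.2)).1) K₀ := by
    refine ContinuousOn.sub (by fun_prop) (continuousOn_const.mul
      (continuous_fst.comp_continuousOn ?_))
    exact hk.continuousOn_endPt.comp (f := fun z : (ℝ × ℝ) × (ℝ × ℝ) => ((1 : ℝ), z.2.2))
      (by fun_prop) fun z hz => ⟨h1m, hz.2.2.1, by linarith [hz.2.2.2]⟩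
  -- The configurations in which a point of position at most `1` lies on the graph of label `r v`,
  -- at or beyond the angle of the transversal `R = 1`.
  set K := (K₀ ∩ (fun z => k z.1 - (z.2.1, Y z.2.1 (r z.2.2))) ⁻¹' {0}) ∩
    (fun z => σ * z.2.1 - σ * (k (endPt κ 1 z.2.2)).1) ⁻¹' Ici 0 with hK
  have hcl1 := (c1.sub c2).preimage_isClosed_of_isClosed hK₀.isClosed
    (isClosed_singleton (x := (0 : ℝ × ℝ)))
  have hcl2 := c3.preimage_isClosed_of_isClosed hK₀.isClosed (isClosed_Ici (a := (0 : ℝ)))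
  have hKc : IsCompact K := by
    have := (hK₀.of_isClosed_subset hcl1 inter_subset_left).inter_right hcl2
    refine this.of_isClosed_subset ?_ fun z hz => ⟨hz.1, hz.1.1, hz.2⟩
    convert hcl1.inter hcl2 using 1
    ext z
    simp only [hK, mem_inter_iff]
    tauto
  -- For `v = 0` the graph is the line `ρ = 0`, and monotonicity along the axis leaves only `a = (1,
  -- 0)`. By compactness, for small `v` the point `a` is so near to `(1, 0)` that the normal form
  -- applies to it.
  obtain ⟨ε, hε, h⟩ := hKc.exists_of_eventually_of_eq_zero (g := fun z => z.2.2)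
    (p := fun z => z.1 ≠ 0 ∧ 1 / 2 < endPos κ z.1 ∧ endLev κ z.1 < c)
    (by fun_prop) (fun z hz => hz.1.1.2.2.1) (by
      rintro ⟨a, θ, v⟩ ⟨⟨⟨⟨ha, ha1⟩, hθ, hv⟩, he⟩, hge⟩ h0
      obtain rfl : v = 0 := h0
      simp only [mem_preimage, mem_singleton_iff, sub_eq_zero, hn.zero, hB.zero θ hθ] at he
      simp only [mem_preimage, mem_Ici, sub_nonneg, endPt_zero_right] at hge
      simp only [mem_ofPred_eq] at ha1
      obtain ⟨e, hx⟩ := hk.eq_of_snd_eq_zero ha (by rw [he])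
      simp only at e hx ha he hge
      have hx1 : a.1 ≤ 1 := by
        rw [e] at ha1
        cases κ
        · exact ha1
        · simpa [endPos, Real.sqrt_sq hx.1] using ha1
        · simpa [endPos, Real.sqrt_sq hx.1] using ha1
      have hθa : (k (a.1, 0)).1 = θ := by rw [← e, he]
      have hx2 : a.1 = 1 := by
        refine le_antisymm hx1 ?_
        by_contra hlt
        have := hk.axis_mono hx (by norm_num : (1 : ℝ) ∈ Icc (0 : ℝ) 2) (not_le.1 hlt)
        simp only [hθa] at this
        linarith
      rw [hx2] at e
      subst e
      have h10 : ((1 : ℝ), (0 : ℝ)) ∈ bigDisc \ {0} := ⟨ha, by simp⟩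
      have e1 := (endOK_of_mem (κ := κ) (R := 1) (v := 0) (by norm_num) (by norm_num)).coords
      rw [endPt_zero_right] at e1
      have hev : ∀ᶠ a in 𝓝[bigDisc] ((1 : ℝ), (0 : ℝ)), a ≠ 0 ∧ 1 / 2 < endPos κ a ∧
          endLev κ a < c := by
        have n0 : ∀ᶠ a in 𝓝[bigDisc] ((1 : ℝ), (0 : ℝ)), a ≠ 0 :=
          mem_nhdsWithin_of_mem_nhds (isOpen_compl_singleton.mem_nhds (by simp))
        have n1 : ∀ᶠ a in 𝓝[bigDisc] ((1 : ℝ), (0 : ℝ)), 1 / 2 < endPos κ a :=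
          mem_nhdsWithin_of_mem_nhds ((continuous_endPos κ).continuousAt.eventually
            (Ioi_mem_nhds (by rw [e1.2.1]; norm_num)))
        have n2 : ∀ᶠ a in 𝓝[bigDisc \ {0}] ((1 : ℝ), (0 : ℝ)), endLev κ a < c :=
          (continuousOn_endLev κ _ h10).eventually (Iio_mem_nhds (by
            rw [e1.2.2.2.1 (Or.inl (by norm_num))]; exact hcp))
        rw [Set.sdiff_eq, nhdsWithin_inter_of_mem' (mem_nhdsWithin_of_mem_nhds
          (isOpen_compl_singleton.mem_nhds (by simp)))] at n2
        filter_upwards [n0, n1, n2] with a a0 a1 a2 using ⟨a0, a1, a2⟩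
      have ht : Filter.Tendsto (fun z : (ℝ × ℝ) × (ℝ × ℝ) => z.1) (𝓝[K] (((1 : ℝ), (0 : ℝ)), θ, 0))
          (𝓝[bigDisc] ((1 : ℝ), (0 : ℝ))) :=
        tendsto_nhdsWithin_iff.2 ⟨continuous_fst.continuousAt.mono_left nhdsWithin_le_nhds, by
          filter_upwards [self_mem_nhdsWithin] with z hz using hz.1.1.1.1⟩
      exact ht.eventually hev)
  refine ⟨min c (ε / 2), ⟨by positivity, min_le_left _ _⟩, fun v hv θ hθ a ha ha1 he => ?_⟩
  have hvc : v ∈ Icc 0 c := ⟨hv.1, hv.2.trans (min_le_left _ _)⟩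
  by_contra hcon
  have hcon := not_le.1 hcon
  have hmem : (a, θ, v) ∈ K := ⟨⟨⟨⟨ha, ha1⟩, hθ, hvc⟩, by simp [he]⟩, by
    simp only [mem_preimage, mem_Ici]; linarith⟩
  obtain ⟨ha0, h2, h3⟩ := h _ hmem (by
    have := hv.2.trans (min_le_right c (ε / 2))
    simp only; linarith)
  simp only at ha0 h2 h3
  -- Now `a` has a small label `w`, with `r w = r v` and hence `w = v`; since its position is at
  -- most `1`, monotonicity of the angle contradicts its lying beyond the transversal.
  have hl : endLev κ a < 1 / 2 := by linarith
  have hE := endPt_endPos_endLev ha ha0 (Or.inl hl)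
  set R := endPos κ a
  set w := endLev κ a
  have hR : R ∈ Icc (1 / 2 : ℝ) (3 / 2) := ⟨h2.le, by linarith⟩
  have hw : w ∈ Icc 0 c := ⟨hE.2.1, h3.le⟩
  have e1 : (k (endPt κ R w)).1 = θ := by rw [hE.1, he]
  have e2 := hn.eq w hw R hR
  rw [e1] at e2
  rw [hE.1, he] at e2
  have e3 := hn.mono.injOn hvc hw (hB.inj θ hθ (hn.mapsTo hvc) (hn.mapsTo hw) e2)
  have := (hn.strict w hw).monotoneOn hR h1m ha1
  rw [← e3] at e1
  simp only [← e3, e1] at this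
  linarith

end IsLocalChart

/-! ### Local charts from sectors -/

/-- In all three models the positive half-axis is a trajectory directed away from the vertex. This
fixes the orientation of the charts. -/
lemma Reaches.axis_of_left {κ : SectorType} {x : ℝ} (hx : x ∈ Ioc (0 : ℝ) 1) {c : ℝ × ℝ}
    (h : Reaches (modelField κ) halfDisc (x, 0) c) : c = (c.1, 0) ∧ x ≤ c.1 := by
  have hok : EndOK κ x 0 := endOK_of_mem ⟨hx.1, by linarith [hx.2]⟩ (by norm_num)
  have e0 : endPt κ x 0 = (x, 0) := endPt_zero_right κ x
  have h' := h.mono halfDisc_subset_bigDisc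
  have hx0 : ((x, 0) : ℝ × ℝ) ≠ 0 := by rw [← e0]; exact hok.endPt_ne_zero
  have hc0 : c ≠ 0 := fun hc => hx0 ((reaches_model_zero_iff h).2 hc)
  have a1 := (h'.modelArc (fun a ha => ha.2) hx0).endLev h'.left_mem
  have e1 := hok.coords.2.2.2.1 (Or.inl (by norm_num))
  have e2 := hok.coords.2.1
  rw [e0] at e1 e2
  rw [e1, e2] at a1
  have hl : endLev κ c < 1 / 2 ∨ κ = .parabolic := Or.inl (by rw [← a1.1]; norm_num)
  have e3 := (endPt_endPos_endLev h'.right_mem hc0 hl).1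
  rw [← a1.1, endPt_zero_right] at e3
  have e4 : endPos κ c = c.1 := by rw [← e3, e3]; exact congrArg Prod.fst e3
  refine ⟨by rw [← e4]; exact e3.symm, ?_⟩
  rw [← e4]
  exact a1.2 (Or.inl (by norm_num))

lemma IsSectorChart.neg {F : ℝ × ℝ → ℝ × ℝ} {p : ℝ × ℝ} {κ : SectorType} {S : Set (ℝ × ℝ)}
    {h : ℝ × ℝ → ℝ × ℝ} (hh : IsSectorChart F p κ S h) : IsSectorChart (-F) p κ S h := by
  refine ⟨hh.continuousOn, hh.injOn, hh.image, hh.vertex, ?_⟩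
  rcases hh.trajectories with ht | ht
  · exact Or.inr fun a ha b hb => reaches_neg_iff.trans (ht b hb a ha)
  · exact Or.inl fun a ha b hb => reaches_neg_iff.trans (ht b hb a ha)

/-- A sector of `(θ₀, 0)` with one bounding half-trajectory on the segment of the line `ρ = 0`
from `θ₀` to `θ'`, on which the movement is away from `θ₀`. The sign `σ` is that of `θ' - θ₀`. -/
structure IsSideSector (F : ℝ × ℝ → ℝ × ℝ) (κ : SectorType) (S : Set (ℝ × ℝ)) (σ θ₀ θ' : ℝ)
    (h : ℝ × ℝ → ℝ × ℝ) : Prop where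
  sign : σ = 1 ∨ σ = -1
  chart : IsSectorChart F (θ₀, 0) κ S h
  axis : ∀ x ∈ Ioc (0 : ℝ) 1, σ * θ₀ < σ * (h (x, 0)).1 ∧ σ * (h (x, 0)).1 < σ * θ' ∧
    (h (x, 0)).2 = 0
  pos : ∀ a ∈ halfDisc, ¬ (a.2 = 0 ∧ 0 ≤ a.1) → 0 < (h a).2
  dir : ∀ x ∈ Ioc (0 : ℝ) 1, 0 < σ * (F (h (x, 0))).1

namespace IsSideSector

variable {F : ℝ × ℝ → ℝ × ℝ} {κ : SectorType} {S : Set (ℝ × ℝ)} {σ θ₀ θ' : ℝ}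
  {h : ℝ × ℝ → ℝ × ℝ}

lemma axis_mem {x : ℝ} (hx : x ∈ Icc (0 : ℝ) 1) : ((x, 0) : ℝ × ℝ) ∈ halfDisc :=
  ⟨by simp only; nlinarith [hx.1, hx.2], le_rfl⟩

lemma snd_axis (hs : IsSideSector F κ S σ θ₀ θ' h) {x : ℝ} (hx : x ∈ Icc (0 : ℝ) 1) :
    (h (x, 0)).2 = 0 := by
  rcases hx.1.eq_or_lt with rfl | h0
  · have : h (0, 0) = (θ₀, 0) := hs.chart.vertex
    rw [this]
  · exact (hs.axis x ⟨h0, hx.2⟩).2.2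

lemma sign_ne (hs : IsSideSector F κ S σ θ₀ θ' h) : σ ≠ 0 := by
  rcases hs.sign with h | h <;> rw [h] <;> norm_num

/-- On the axis `ρ = 0`, so injectivity of the chart is injectivity of the angle; a continuous
injective function is monotone, and its values lie on the side `σ` of `θ₀`. -/
lemma strictMonoOn_axis (hs : IsSideSector F κ S σ θ₀ θ' h) :
    StrictMonoOn (fun x => σ * (h (x, 0)).1) (Icc 0 1) := by
  have hc : ContinuousOn (fun x => σ * (h (x, 0)).1) (Icc 0 1) :=
    continuousOn_const.mul (continuous_fst.comp_continuousOn (hs.chart.continuousOn.comp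
      (by fun_prop : Continuous fun x : ℝ => (x, (0 : ℝ))).continuousOn fun x hx => axis_mem hx))
  have hv : h (0, 0) = (θ₀, 0) := hs.chart.vertex
  refine hc.strictMonoOn_of_injOn_Icc zero_le_one ?_ ?_
  · simp only [hv]
    exact (hs.axis 1 (by norm_num)).1.le
  · intro x hx y hy he
    have e := mul_left_cancel₀ hs.sign_ne he
    have := hs.chart.injOn (axis_mem hx) (axis_mem hy)
      (Prod.ext e (by rw [hs.snd_axis hx, hs.snd_axis hy]))
    exact congrArg Prod.fst this

lemma snd_nonneg (hs : IsSideSector F κ S σ θ₀ θ' h) {a : ℝ × ℝ} (ha : a ∈ halfDisc) :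
    0 ≤ (h a).2 := by
  by_cases h0 : a.2 = 0 ∧ 0 ≤ a.1
  · have h1 : a.1 ≤ 1 := by nlinarith [ha.1, h0.1, h0.2]
    have := hs.snd_axis ⟨h0.2, h1⟩
    have e : (a.1, (0 : ℝ)) = a := Prod.ext rfl h0.1.symm
    rw [e] at this
    exact this.ge
  · exact (hs.pos a ha h0).le

lemma axis_of_snd (hs : IsSideSector F κ S σ θ₀ θ' h) {a : ℝ × ℝ} (ha : a ∈ halfDisc)
    (h0 : (h a).2 = 0) : a = (a.1, 0) ∧ a.1 ∈ Icc (0 : ℝ) 1 := by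
  by_cases h' : a.2 = 0 ∧ 0 ≤ a.1
  · exact ⟨Prod.ext rfl h'.1, h'.2, by nlinarith [ha.1, h'.1, h'.2]⟩
  · exact absurd h0 (hs.pos a ha h').ne'

/-- The chart preserves the direction of movement. -/
lemma trajectories (hs : IsSideSector F κ S σ θ₀ θ' h) : ∀ a ∈ halfDisc, ∀ b ∈ halfDisc,
    (Reaches F S (h a) (h b) ↔ Reaches (modelField κ) halfDisc a b) := by
  rcases hs.chart.trajectories with ht | ht
  · exact ht
  exfalso
  have ha : ((1 / 2, 0) : ℝ × ℝ) ∈ halfDisc := axis_mem (by norm_num)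
  have hb : ((1, 0) : ℝ × ℝ) ∈ halfDisc := axis_mem (by norm_num)
  have hok : ∀ R ∈ Icc (1 / 2 : ℝ) 1, EndOK κ R 0 := fun R hR =>
    endOK_of_mem ⟨by linarith [hR.1], by linarith [hR.2]⟩ (by norm_num)
  have h12 := hok (1 / 2) (by norm_num)
  have h1 := hok 1 (by norm_num)
  have harc : ModelArc κ halfDisc (endPt κ (1 / 2) 0) (endPt κ 1 0) :=
    endPt_modelArc h12 h1 (Or.inr (Or.inl (by norm_num))) (by norm_num)
      fun R hR => by rw [endPt_zero_right]; exact axis_mem ⟨by linarith [hR.1], hR.2⟩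
  have hm := harc.reaches h12.coords.1 h1.coords.1
  rw [endPt_zero_right, endPt_zero_right] at hm
  obtain ⟨τ, γ, hτ, hγ0, hγτ, hγ⟩ := (ht _ hb _ ha).2 hm
  -- If the chart reversed the movement, every point of the arc from `h (1, 0)` to `h (1/2, 0)`
  -- would come from the axis segment beyond `1/2`, where the field moves away from `θ₀`. The arc
  -- nevertheless ends nearer to `θ₀` than it starts.
  have hr : Reaches F {q | 0 ≤ σ * (F q).1} (h (1, 0)) (h (1 / 2, 0)) := by
    refine ⟨τ, γ, hτ, hγ0, hγτ, fun t ht' => ⟨?_, (hγ t ht').2⟩⟩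
    have hmem := (hγ t ht').1
    rw [← hs.chart.image] at hmem
    obtain ⟨c, hc, hce⟩ := hmem
    have h1 := reaches_of_integralCurve hγ ht'.1 ht'.2 le_rfl
    rw [hγτ, ← hce] at h1
    obtain ⟨e, hx⟩ := Reaches.axis_of_left (by norm_num) ((ht _ hc _ ha).1 h1)
    have hc1 : c.1 ≤ 1 := by
      have := hc.1
      rw [e] at this
      simp only at this
      nlinarith
    rw [← hce, e]
    exact (hs.dir c.1 ⟨by linarith, hc1⟩).le
  have hlt := hs.strictMonoOn_axis (by norm_num : (1 / 2 : ℝ) ∈ Icc (0 : ℝ) 1)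
    (by norm_num : (1 : ℝ) ∈ Icc (0 : ℝ) 1) (by norm_num)
  simp only at hlt
  rcases hs.sign with hσ | hσ
  · have := hr.fst_le fun q hq => by simpa [hσ] using hq
    rw [hσ] at hlt; linarith
  · have := hr.reverse.fst_le fun q hq => by simpa [hσ] using hq
    rw [hσ] at hlt; linarith

/-- Near the line `ρ = 0` a sector stays away from the end of the segment. -/
lemma exists_far (hs : IsSideSector F κ S σ θ₀ θ' h) :
    ∃ μ < σ * θ', ∃ ε > 0, ∀ q ∈ S, q.2 < ε → σ * q.1 < μ := by
  have h1 := (hs.axis 1 (by norm_num)).2.1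
  refine ⟨(σ * (h (1, 0)).1 + σ * θ') / 2, by linarith, ?_⟩
  obtain ⟨ε, hε, hh⟩ := isCompact_halfDisc.exists_of_eventually_of_eq_zero
    (g := fun a => (h a).2) (p := fun a => σ * (h a).1 < (σ * (h (1, 0)).1 + σ * θ') / 2)
    (continuous_snd.comp_continuousOn hs.chart.continuousOn) (fun a ha => hs.snd_nonneg ha) (by
      intro a ha h0
      obtain ⟨e, hx⟩ := hs.axis_of_snd ha h0
      refine ((continuousOn_const.mul (continuous_fst.comp_continuousOn hs.chart.continuousOn)) a
        ha).eventually (Iio_mem_nhds ?_)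
      have := hs.strictMonoOn_axis.monotoneOn hx (by norm_num : (1 : ℝ) ∈ Icc (0 : ℝ) 1) hx.2
      simp only [← e] at this
      show σ * (h a).1 < _
      linarith)
  refine ⟨ε, hε, fun q hq hq2 => ?_⟩
  rw [← hs.chart.image] at hq
  obtain ⟨a, ha, rfl⟩ := hq
  exact hh a ha hq2

lemma smul_bigDisc {δ : ℝ} (h0 : 0 < δ) (h1 : δ ≤ 1 / 2) {a : ℝ × ℝ} (ha : a ∈ bigDisc) :
    δ • a ∈ halfDisc := by
  obtain ⟨h, h'⟩ := ha
  refine ⟨?_, mul_nonneg h0.le h'⟩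
  simp only [Prod.smul_fst, Prod.smul_snd, smul_eq_mul, mul_pow]
  have : δ ^ 2 ≤ 1 / 4 := by nlinarith
  nlinarith [sq_nonneg a.1, sq_nonneg a.2]

/-- The local chart is `a ↦ h (δ a)` with small `δ ≤ 1/2`, so that the disc of radius two fits into
the domain of `h` and its image lies within `d` of `θ₀` in angle. -/
lemma exists_isLocalChart (hs : IsSideSector F κ S σ θ₀ θ' h) {d : ℝ} (hd : 0 < d) :
    ∃ k, IsLocalChart F κ S σ θ₀ d k := by
  have hv : h 0 = (θ₀, 0) := hs.chart.vertex
  obtain ⟨δ, hδ0, hδ1, hδn⟩ : ∃ δ : ℝ, 0 < δ ∧ δ ≤ 1 / 2 ∧ ∀ a ∈ bigDisc, |(h (δ • a)).1 - θ₀| < d := by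
    have hc := (continuous_fst.comp_continuousOn hs.chart.continuousOn) 0 zero_mem_halfDisc
    obtain ⟨δ, hδ, hh⟩ := Metric.continuousWithinAt_iff.1 hc d hd
    have hδ' : 0 < min (1 / 2) (δ / 3) := by positivity
    refine ⟨min (1 / 2) (δ / 3), hδ', min_le_left _ _, fun a ha => ?_⟩
    have := hh (smul_bigDisc hδ' (min_le_left _ _) ha) (by
      rw [dist_zero_right, norm_smul, Real.norm_of_nonneg hδ'.le]
      have h3 : ‖a‖ ≤ 2 := by
        have h := ha.1
        rw [Prod.norm_def, Real.norm_eq_abs, Real.norm_eq_abs]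
        exact max_le (abs_le_of_sq_le_sq (by nlinarith [sq_nonneg a.2]) (by norm_num))
          (abs_le_of_sq_le_sq (by nlinarith [sq_nonneg a.1]) (by norm_num))
      have := min_le_right (1 / 2 : ℝ) (δ / 3)
      nlinarith [norm_nonneg a])
    simpa [Real.dist_eq, hv] using this
  have hm : ∀ a ∈ bigDisc, δ • a ∈ halfDisc := fun a ha => smul_bigDisc hδ0 hδ1 ha
  have hax : ∀ x : ℝ, δ • ((x, 0) : ℝ × ℝ) = (δ * x, 0) := fun x => by simp
  have haxm : ∀ x ∈ Icc (0 : ℝ) 2, δ * x ∈ Icc (0 : ℝ) 1 := fun x hx =>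
    ⟨by have := hx.1; positivity, by nlinarith [hx.1, hx.2]⟩
  have hinv : ∀ a : ℝ × ℝ, δ • δ⁻¹ • a = a := fun a => smul_inv_smul₀ hδ0.ne' a
  have hinv' : ∀ a : ℝ × ℝ, δ⁻¹ • δ • a = a := fun a => inv_smul_smul₀ hδ0.ne' a
  refine ⟨fun a => h (δ • a), hs.sign, hs.chart.continuousOn.comp
    (continuous_const_smul δ).continuousOn hm, fun a ha b hb he => ?_, by simp [hv], fun x hx => ?_,
    fun x hx y hy hxy => ?_, fun a ha h0 => hs.pos _ (hm a ha) fun h1 => h0 ?_,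
    fun a b hab => ?_, fun a ha => ?_, hδn, fun c hc => ?_⟩
  · exact smul_right_injective _ hδ0.ne' (hs.chart.injOn (hm a ha) (hm b hb) he)
  · simp only [hax]; exact hs.snd_axis (haxm x hx)
  · simp only [hax]
    exact hs.strictMonoOn_axis (haxm x hx) (haxm y hy) (mul_lt_mul_of_pos_left hxy hδ0)
  · simp only [Prod.smul_fst, Prod.smul_snd, smul_eq_mul] at h1
    exact ⟨by simpa [hδ0.ne'] using h1.1, by simpa [hδ0] using h1.2⟩
  · have hab' := hab.model_smul hδ0
    have hsub : (fun x => δ • x) '' bigDisc ⊆ halfDisc := by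
      rintro _ ⟨x, hx, rfl⟩; exact hm x hx
    have hback : ∀ x y, Reaches (modelField κ) ((fun x => δ • x) '' bigDisc) x y →
        Reaches (modelField κ) bigDisc (δ⁻¹ • x) (δ⁻¹ • y) := fun x y hxy => by
      have := hxy.model_smul (inv_pos.2 hδ0)
      rw [image_image] at this
      simpa only [hinv', image_id'] using this
    -- The chart `h` gives an arc somewhere in `S`. Each of its points lies between the ends in the
    -- model of `halfDisc`, hence on the model arc, which lies in the scaled disc.
    obtain ⟨τ, γ, hτ, hγ0, hγτ, hγ⟩ :=
      (hs.trajectories _ (hm a hab.left_mem) _ (hm b hab.right_mem)).2 (hab'.mono hsub)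
    refine ⟨τ, γ, hτ, hγ0, hγτ, fun t ht => ⟨?_, (hγ t ht).2⟩⟩
    have hmem := (hγ t ht).1
    rw [← hs.chart.image] at hmem
    obtain ⟨e, he, hee⟩ := hmem
    have h1 := reaches_of_integralCurve hγ le_rfl ht.1 ht.2
    have h2 := reaches_of_integralCurve hγ ht.1 ht.2 le_rfl
    rw [hγ0, ← hee] at h1
    rw [hγτ, ← hee] at h2
    have h3 := hab'.model_between (fun x hx => (hsub hx).2) (fun x hx => hx.2)
      ((hs.trajectories _ (hm a hab.left_mem) _ he).1 h1)
      ((hs.trajectories _ he _ (hm b hab.right_mem)).1 h2)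
    refine ⟨δ⁻¹ • e, ⟨?_, ?_⟩, by simp only [hinv, hee]⟩
    · simpa only [hinv'] using hback _ _ h3.1
    · simpa only [hinv'] using hback _ _ h3.2
  · rw [← hs.chart.image]; exact mem_image_of_mem h (hm a ha)
  -- By compactness only points near `(x, 0)` with `0 ≤ x ≤ 1` matter, and the three alternatives
  -- correspond to `x < δ`, `δ ≤ x < 3δ/2` and `x ≥ 3δ/2`.
  · obtain ⟨ε, hε, hh⟩ := isCompact_halfDisc.exists_of_eventually_of_eq_zero
      (g := fun a => (h a).2)
      (p := fun b => δ⁻¹ • b ∈ halfDisc ∨ (δ⁻¹ • b ∈ bigDisc \ {0} ∧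
        endPos κ (δ⁻¹ • b) ∈ Ioo (1 / 2) (3 / 2) ∧ endLev κ (δ⁻¹ • b) < c) ∨
        σ * (h (δ * (5 / 4), 0)).1 < σ * (h b).1)
      (continuous_snd.comp_continuousOn hs.chart.continuousOn) (fun a ha => hs.snd_nonneg ha) (by
        intro b hb h0
        obtain ⟨e, hx⟩ := hs.axis_of_snd hb h0
        set x := b.1 with hxdef
        rw [e]
        rw [e] at hb
        rcases lt_or_ge x δ with h1 | h1
        · have : ∀ᶠ b in 𝓝[halfDisc] ((x, 0) : ℝ × ℝ), b.1 ^ 2 + b.2 ^ 2 < δ ^ 2 :=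
            mem_nhdsWithin_of_mem_nhds ((isOpen_lt (by fun_prop) (by fun_prop)).mem_nhds
              (by simp only [mem_ofPred_eq]; nlinarith [hx.1]))
          filter_upwards [this, self_mem_nhdsWithin] with b hb1 hb2
          left
          refine ⟨?_, ?_⟩
          · simp only [Prod.smul_fst, Prod.smul_snd, smul_eq_mul, mul_pow, ← mul_add, inv_pow]
            rw [inv_mul_le_iff₀ (by positivity), mul_one]
            exact hb1.le
          · have := hb2.2
            simp only [Prod.smul_snd, smul_eq_mul]; positivity
        rcases lt_or_ge x (δ * (3 / 2)) with h2 | h2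
        · have hx0 : 0 < x := hδ0.trans_le h1
          set R := δ⁻¹ * x with hR
          have hxR : x = δ * R := by rw [hR, mul_inv_cancel_left₀ hδ0.ne']
          have hR1 : R ∈ Ioo (1 / 2 : ℝ) (3 / 2) := by
            constructor
            · rw [hxR] at h1; nlinarith
            · rw [hxR] at h2; exact lt_of_mul_lt_mul_left h2 hδ0.le
          have hok := endOK_of_mem (κ := κ) (R := R) (v := 0)
            ⟨by linarith [hR1.1], hR1.2.le⟩ (by norm_num)
          have hRb := hok.mem_bigDisc
          have hR0 := hok.endPt_ne_zero
          have hco := hok.coords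
          rw [endPt_zero_right] at hRb hR0 hco
          have hsm : δ⁻¹ • ((x, 0) : ℝ × ℝ) = (R, 0) := by simp [hR]
          have hcs : ContinuousAt (fun b : ℝ × ℝ => δ⁻¹ • b) (x, 0) :=
            (continuous_const_smul _).continuousAt
          have n1 : ∀ᶠ b in 𝓝[halfDisc] ((x, 0) : ℝ × ℝ), δ⁻¹ • b ∈ bigDisc \ {0} := by
            have m1 : ∀ᶠ a in 𝓝 ((R, 0) : ℝ × ℝ), a.1 ^ 2 + a.2 ^ 2 < 4 ∧ a ≠ 0 :=
              Filter.Eventually.and ((isOpen_lt (by fun_prop) (by fun_prop)).mem_nhds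
                (by simp only [mem_ofPred_eq]; nlinarith [hR1.1, hR1.2]))
                (isOpen_compl_singleton.mem_nhds hR0)
            rw [← hsm] at m1
            filter_upwards [mem_nhdsWithin_of_mem_nhds (hcs.eventually m1), self_mem_nhdsWithin]
              with b hb1 hb2
            refine ⟨⟨hb1.1.le, ?_⟩, hb1.2⟩
            have := hb2.2
            simp only [Prod.smul_snd, smul_eq_mul]; positivity
          have ht : Filter.Tendsto (fun b : ℝ × ℝ => δ⁻¹ • b) (𝓝[halfDisc] (x, 0))
              (𝓝[bigDisc \ {0}] (R, 0)) := tendsto_nhdsWithin_iff.2 ⟨by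
                rw [← hsm]; exact hcs.mono_left nhdsWithin_le_nhds, n1⟩
          have n2 : ∀ᶠ a in 𝓝[bigDisc \ {0}] ((R, 0) : ℝ × ℝ), endPos κ a ∈ Ioo (1 / 2 : ℝ) (3 / 2) :=
            mem_nhdsWithin_of_mem_nhds ((continuous_endPos κ).continuousAt.eventually
              (Ioo_mem_nhds (by rw [hco.2.1]; exact hR1.1) (by rw [hco.2.1]; exact hR1.2)))
          have n3 : ∀ᶠ a in 𝓝[bigDisc \ {0}] ((R, 0) : ℝ × ℝ), endLev κ a < c :=
            (continuousOn_endLev κ _ ⟨hRb, hR0⟩).eventually (Iio_mem_nhds (by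
              rw [hco.2.2.2.1 (Or.inl (by norm_num))]; exact hc))
          filter_upwards [n1, ht.eventually n2, ht.eventually n3] with b b1 b2 b3
          exact Or.inr (Or.inl ⟨b1, b2, b3⟩)
        · have : σ * (h (δ * (5 / 4), 0)).1 < σ * (h (x, 0)).1 :=
            hs.strictMonoOn_axis (haxm _ (by norm_num)) hx (by nlinarith)
          filter_upwards [((continuousOn_const.mul (continuous_fst.comp_continuousOn
            hs.chart.continuousOn)) _ hb).eventually (Ioi_mem_nhds this)] with b hb
          exact Or.inr (Or.inr hb))
    refine ⟨ε, hε, fun q hq hq2 => ?_⟩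
    rw [← hs.chart.image] at hq
    obtain ⟨b, hb, rfl⟩ := hq
    rcases hh b hb hq2 with h1 | h1 | h1
    · exact Or.inl ⟨_, h1, by simp only [hinv]⟩
    · exact Or.inr (Or.inl ⟨_, h1.1, h1.2.1, h1.2.2, by simp only [hinv]⟩)
    · exact Or.inr (Or.inr (by simpa only [hax] using h1))

end IsSideSector

/-! ### Transition between two normal forms -/

/-- Continuity can be checked on the two parts into which a function divides the domain. -/
lemma ContinuousOn.of_le_of_ge {X Z : Type*} [TopologicalSpace X] [TopologicalSpace Z] {D : Set X}
    {f : X → Z} {g : X → ℝ} {a : ℝ} (hg : ContinuousOn g D) (h1 : ContinuousOn f (D ∩ {x | g x ≤ a}))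
    (h2 : ContinuousOn f (D ∩ {x | a ≤ g x})) : ContinuousOn f D := by
  intro x hx
  have hmem : ∀ t : Set ℝ, t ∈ 𝓝 (g x) → D ∩ g ⁻¹' t ∈ 𝓝[D] x := fun t ht =>
    Filter.inter_mem self_mem_nhdsWithin ((hg x hx) ht)
  rcases lt_trichotomy (g x) a with h | h | h
  · exact (h1 x ⟨hx, h.le⟩).mono_of_mem_nhdsWithin (hmem _ (Iic_mem_nhds h))
  · refine ((h1 x ⟨hx, h.le⟩).union (h2 x ⟨hx, h.ge⟩)).mono fun y hy => ?_
    rcases le_total (g y) a with h' | h'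
    exacts [Or.inl ⟨hy, h'⟩, Or.inr ⟨hy, h'⟩]
  · exact (h2 x ⟨hx, h.le⟩).mono_of_mem_nhdsWithin (hmem _ (Ici_mem_nhds h))

/-- Near `0` the function is `r₂⁻¹ ∘ r₁`, which matches labels of the two charts that belong to the
same graph. Its linear continuation up to `lam 2 = 2` is a mere extension, needed because labels in
a parabolic model run through `[0, 2]`. -/
lemma exists_transition {r₁ r₂ : ℝ → ℝ} {c₁ c₂ : ℝ} (h₁ : 0 < c₁) (h₁' : c₁ ≤ 1 / 4) (h₂ : 0 < c₂)
    (h₂' : c₂ ≤ 1 / 4) (hc₁ : ContinuousOn r₁ (Icc 0 c₁)) (hc₂ : ContinuousOn r₂ (Icc 0 c₂))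
    (hm₁ : StrictMonoOn r₁ (Icc 0 c₁)) (hm₂ : StrictMonoOn r₂ (Icc 0 c₂)) (hr₁ : r₁ 0 = 0)
    (hr₂ : r₂ 0 = 0) :
    ∃ c ∈ Ioc 0 c₁, ∃ lam : ℝ → ℝ, ContinuousOn lam (Icc 0 2) ∧ StrictMonoOn lam (Icc 0 2) ∧
      lam 0 = 0 ∧ lam 2 = 2 ∧ ∀ v ∈ Icc 0 c, lam v ∈ Icc 0 c₂ ∧ r₂ (lam v) = r₁ v := by
  have h0₁ : (0 : ℝ) ∈ Icc 0 c₁ := ⟨le_rfl, h₁.le⟩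
  have h0₂ : (0 : ℝ) ∈ Icc 0 c₂ := ⟨le_rfl, h₂.le⟩
  have hp : 0 < r₂ c₂ := by
    have := hm₂ h0₂ ⟨h₂.le, le_rfl⟩ h₂
    rwa [hr₂] at this
  have hp₁ : 0 < r₁ c₁ := by
    have := hm₁ h0₁ ⟨h₁.le, le_rfl⟩ h₁
    rwa [hr₁] at this
  -- `c` is chosen with `r₁ c = min (r₁ c₁) (r₂ c₂)`, so that on `[0, c]` the values of `r₁` are
  -- values of `r₂`.
  obtain ⟨c, hc, hce⟩ := intermediate_value_Icc h₁.le hc₁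
    (show min (r₁ c₁) (r₂ c₂) ∈ Icc (r₁ 0) (r₁ c₁) by
      rw [hr₁]; exact ⟨(lt_min hp₁ hp).le, min_le_left _ _⟩)
  have hc0 : 0 < c := by
    refine lt_of_le_of_ne hc.1 fun h => ?_
    rw [← h, hr₁] at hce
    exact (lt_min hp₁ hp).ne hce
  have hsub : Icc 0 c ⊆ Icc 0 c₁ := Icc_subset_Icc_right hc.2
  have himg : ∀ v ∈ Icc 0 c, r₁ v ∈ r₂ '' Icc 0 c₂ := fun v hv =>
    intermediate_value_Icc h₂.le hc₂ (by
      rw [hr₂]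
      have a1 := hm₁.monotoneOn h0₁ (hsub hv) hv.1
      have a2 := hm₁.monotoneOn (hsub hv) hc hv.2
      rw [hr₁] at a1
      exact ⟨a1, a2.trans (hce.trans_le (min_le_right _ _))⟩)
  set μ : ℝ → ℝ := fun v => Function.invFunOn r₂ (Icc 0 c₂) (r₁ v) with hμ
  have hμm : ∀ v ∈ Icc 0 c, μ v ∈ Icc 0 c₂ := fun v hv => Function.invFunOn_mem (himg v hv)
  have hμe : ∀ v ∈ Icc 0 c, r₂ (μ v) = r₁ v := fun v hv => Function.invFunOn_eq (himg v hv)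
  have hμc : ContinuousOn μ (Icc 0 c) :=
    (isCompact_Icc.continuousOn_of_leftInvOn hc₂ hm₂.injOn.leftInvOn_invFunOn).comp
      (hc₁.mono hsub) himg
  have hμs : StrictMonoOn μ (Icc 0 c) := fun v hv w hw hvw => by
    rw [← hm₂.lt_iff_lt (hμm v hv) (hμm w hw), hμe v hv, hμe w hw]
    exact hm₁ (hsub hv) (hsub hw) hvw
  have h0c : (0 : ℝ) ∈ Icc 0 c := ⟨le_rfl, hc0.le⟩
  have hcc : c ∈ Icc 0 c := ⟨hc0.le, le_rfl⟩
  have hμ0 : μ 0 = 0 := hm₂.injOn (hμm 0 h0c) h0₂ (by rw [hμe 0 h0c, hr₁, hr₂])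
  have hs : 0 < (2 - μ c) / (2 - c) := by
    have := (hμm c hcc).2
    exact div_pos (by linarith) (by linarith [hc.2])
  set lam : ℝ → ℝ := fun v => if v ≤ c then μ v else μ c + (2 - μ c) / (2 - c) * (v - c) with hlam
  have e1 : ∀ v ≤ c, lam v = μ v := fun v hv => by simp [hlam, hv]
  have e2 : ∀ v, c ≤ v → lam v = μ c + (2 - μ c) / (2 - c) * (v - c) := fun v hv => by
    rcases hv.eq_or_lt with rfl | h
    · simp [hlam]
    · simp [hlam, not_le.2 h]
  refine ⟨c, ⟨hc0, hc.2⟩, lam, ?_, ?_, by rw [e1 0 hc0.le, hμ0], ?_, fun v hv => ?_⟩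
  · refine ContinuousOn.of_le_of_ge (g := id) (a := c) continuousOn_id ?_ ?_
    · exact (hμc.congr fun v hv => e1 v hv.2).mono fun v hv => ⟨hv.1.1, hv.2⟩
    · exact (by fun_prop : Continuous fun v => μ c + (2 - μ c) / (2 - c) * (v - c)).continuousOn.congr
        fun v hv => e2 v hv.2
  · intro v hv w hw hvw
    rcases le_total w c with h | h
    · rw [e1 v (hvw.le.trans h), e1 w h]
      exact hμs ⟨hv.1, hvw.le.trans h⟩ ⟨hw.1, h⟩ hvw
    · rcases le_total v c with h' | h'
      · rw [e1 v h', e2 w h]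
        rcases h'.eq_or_lt with rfl | h''
        · have := mul_pos hs (sub_pos.2 hvw); linarith
        · have := hμs ⟨hv.1, h'⟩ hcc h''
          have := mul_nonneg hs.le (sub_nonneg.2 h); linarith
      · rw [e2 v h', e2 w h]
        have := mul_lt_mul_of_pos_left (sub_lt_sub_right hvw c) hs
        linarith
  · rw [e2 2 (by linarith [hc.2]), div_mul_cancel₀ _ (by linarith [hc.2])]
    ring
  · rw [e1 v hv.2]; exact ⟨hμm v hv, hμe v hv⟩

namespace IsLocalChart

variable {F : ℝ × ℝ → ℝ × ℝ} {κ : SectorType} {S : Set (ℝ × ℝ)} {σ θ₀ d : ℝ} {k : ℝ × ℝ → ℝ × ℝ}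

/-- Points with coordinates that tend to the positive half-axis tend to the line `ρ = 0`. -/
lemma exists_snd_lt (hk : IsLocalChart F κ S σ θ₀ d k) {ε : ℝ} (hε : 0 < ε) :
    ∃ δ > 0, ∀ R v, EndOK κ R v → -δ < R → (v < δ ∨ κ ≠ .hyperbolic ∧ R < δ) →
      (k (endPt κ R v)).2 < ε := by
  obtain ⟨η, hη, h1⟩ := Metric.uniformContinuousOn_iff.1
    (isCompact_bigDisc.uniformContinuousOn_of_continuous hk.cont) ε hε
  have hKc : IsCompact (Icc (-(3 / 2) : ℝ) (3 / 2) ×ˢ Icc (0 : ℝ) 2) :=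
    isCompact_Icc.prod isCompact_Icc
  obtain ⟨δ, hδ, h2⟩ := Metric.uniformContinuousOn_iff.1
    (hKc.uniformContinuousOn_of_continuous (continuous_endPt κ).continuousOn) η hη
  have hax : ∀ x ∈ Icc (0 : ℝ) 2, ((x, 0) : ℝ × ℝ) ∈ bigDisc := fun x hx =>
    ⟨by simp only; nlinarith [hx.1, hx.2], le_rfl⟩
  have key : ∀ a ∈ bigDisc, ∀ x ∈ Icc (0 : ℝ) 2, dist a (x, 0) < η → (k a).2 < ε := by
    intro a ha x hx hd
    have := h1 a ha _ (hax x hx) hd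
    rw [Prod.dist_eq, max_lt_iff, hk.axis x hx, Real.dist_eq, Real.dist_eq, sub_zero] at this
    exact (abs_lt.1 this.2).2
  refine ⟨δ, hδ, fun R v hok hR hor => ?_⟩
  have hv2 : v ≤ 2 := by rcases hok.le with h | ⟨-, h⟩ <;> linarith
  have hRm := abs_le.1 hok.bound
  have hm : (R, v) ∈ Icc (-(3 / 2) : ℝ) (3 / 2) ×ˢ Icc (0 : ℝ) 2 := ⟨hRm, hok.nonneg, hv2⟩
  rcases hor with h | ⟨hκ, h⟩
  -- In the hyperbolic model `R` may be slightly negative; the nearest point of the half-axis is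
  -- then the vertex.
  · refine key _ hok.mem_bigDisc (max R 0) ⟨le_max_right _ _, max_le (by linarith) (by norm_num)⟩ ?_
    have := h2 (R, v) hm (max R 0, 0) ⟨⟨le_trans (by norm_num) (le_max_right _ _),
      max_le hRm.2 (by norm_num)⟩, le_rfl, by norm_num⟩ (by
        rw [Prod.dist_eq, max_lt_iff, Real.dist_eq, Real.dist_eq, sub_zero, abs_of_nonneg hok.nonneg]
        refine ⟨?_, h⟩
        rcases le_total R 0 with h' | h'
        · rw [max_eq_right h', sub_zero, abs_of_nonpos h']; linarith
        · rw [max_eq_left h', sub_self, abs_zero]; exact hδ)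
    rwa [endPt_zero_right] at this
  · have hR0 : 0 < R := hok.pos.resolve_left hκ
    have e0 : endPt κ 0 v = (0, 0) := by
      cases κ
      · exact absurd rfl hκ
      all_goals simp [endPt]
    refine key _ hok.mem_bigDisc 0 (by norm_num) ?_
    have := h2 (R, v) hm (0, v) ⟨by norm_num, hok.nonneg, hv2⟩ (by
        rw [Prod.dist_eq, max_lt_iff, Real.dist_eq, dist_self, sub_zero, abs_of_pos hR0]
        exact ⟨h, hδ⟩)
    rwa [e0] at this

end IsLocalChart

/-! ### The bridge between two sectors adjacent to the same arc -/

/-- In the parabolic model label `2` is the negative half-axis, where the ordinate vanishes but the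
abscissa is negative. This is the form in which positivity of `ρ` on the charts is used. -/
lemma EndOK.not_axis {κ : SectorType} {R v : ℝ} (h : EndOK κ R v) (h0 : 0 < v ∨ R < 0) :
    ¬ ((endPt κ R v).2 = 0 ∧ 0 ≤ (endPt κ R v).1) := by
  rintro ⟨h1, h2⟩
  obtain ⟨hv, hle, hb, hp, hne⟩ := h
  cases κ
  · simp only [endPt] at h1 h2
    rcases h0 with h | h <;> linarith
  · have hR : 0 < R := by simpa using hp
    have h0 : 0 < v := h0.resolve_right (not_lt.2 hR.le)
    have hv2 : v ≤ 2 := by rcases hle with h | ⟨-, h⟩ <;> linarith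
    simp only [endPt] at h1 h2
    rw [mul_eq_zero, or_iff_right hR.ne', Real.sqrt_eq_zero (by nlinarith)] at h1
    have : v = 2 := by
      have : v * (2 - v) = 0 := by linarith
      rcases mul_eq_zero.1 this with h | h <;> linarith
    rw [this] at h2
    nlinarith
  · have hR : 0 < R := by simpa using hp
    have h0 : 0 < v := h0.resolve_right (not_lt.2 hR.le)
    simp only [endPt] at h1
    have : 0 < v * R ^ 2 := by positivity
    linarith

/-- The pairs of a position and a label in the domain of the bridge. -/
structure BridgeOK (κ₁ κ₂ : SectorType) (c : ℝ) (lam : ℝ → ℝ) (p v : ℝ) : Prop where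
  level : v ∈ Icc (0 : ℝ) 2
  left : p ≤ 1 → EndOK κ₁ p v ∧ (v < 1 / 2 ∨ κ₁ = .parabolic)
  mid : 1 ≤ p → p ≤ 2 → v ≤ c
  right : 2 ≤ p → EndOK κ₂ (3 - p) (lam v) ∧ (lam v < 1 / 2 ∨ κ₂ = .parabolic)

/-- Local charts at both ends of a boundary arc, both in normal form in a flow box. -/
structure Junction (F : ℝ × ℝ → ℝ × ℝ) (κ₁ κ₂ : SectorType) (S₁ S₂ : Set (ℝ × ℝ)) (θ₁ θ₂ d : ℝ)
    (k₁ k₂ : ℝ × ℝ → ℝ × ℝ) (α β l₀ ε₀ : ℝ) (Y : ℝ → ℝ → ℝ) (c c₂ : ℝ) (r₁ r₂ lam : ℝ → ℝ) :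
    Prop where
  chart₁ : IsLocalChart F κ₁ S₁ 1 θ₁ d k₁
  chart₂ : IsLocalChart (-F) κ₂ S₂ (-1) θ₂ d k₂
  d_le : d ≤ 1
  sep : ∀ a ∈ bigDisc, ∀ b ∈ bigDisc, (k₁ a).1 < (k₂ b).1
  box : IsFlowBox F α β l₀ ε₀ Y
  norm₁ : IsLocalChart.IsNormal k₁ κ₁ 1 α β l₀ Y c r₁
  norm₂ : IsLocalChart.IsNormal k₂ κ₂ (-1) α β l₀ Y c₂ r₂
  lam_cont : ContinuousOn lam (Icc 0 2)
  lam_mono : StrictMonoOn lam (Icc 0 2)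
  lam_zero : lam 0 = 0
  lam_two : lam 2 = 2
  lam_mem : ∀ v ∈ Icc 0 c, lam v ∈ Icc 0 c₂ ∧ r₂ (lam v) = r₁ v
  avoid₁ : ∀ v ∈ Icc 0 c, ∀ θ ∈ Icc α β, ∀ a ∈ bigDisc, endPos κ₁ a ≤ 1 →
    k₁ a = (θ, Y θ (r₁ v)) → θ ≤ (k₁ (endPt κ₁ 1 v)).1
  avoid₂ : ∀ v ∈ Icc 0 c₂, ∀ θ ∈ Icc α β, ∀ a ∈ bigDisc, endPos κ₂ a ≤ 1 →
    k₂ a = (θ, Y θ (r₂ v)) → (k₂ (endPt κ₂ 1 v)).1 ≤ θ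
  far₁ : ∃ ε > 0, ∀ q ∈ S₁, q.2 < ε → q.1 < (k₂ (5 / 4, 0)).1
  far₂ : ∃ ε > 0, ∀ q ∈ S₂, q.2 < ε → (k₁ (5 / 4, 0)).1 < q.1

/-- The angle on the transversal side of the bridge. -/
noncomputable def bridgeAngle (κ₁ κ₂ : SectorType) (k₁ k₂ : ℝ × ℝ → ℝ × ℝ) (lam : ℝ → ℝ) (p v : ℝ) : ℝ :=
  (2 - p) * (k₁ (endPt κ₁ 1 v)).1 + (p - 1) * (k₂ (endPt κ₂ 1 (lam v))).1

/-- The map that follows the first chart, then the flow box, then the second chart. -/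
noncomputable def bridge (κ₁ κ₂ : SectorType) (k₁ k₂ : ℝ × ℝ → ℝ × ℝ) (Y : ℝ → ℝ → ℝ)
    (r₁ lam : ℝ → ℝ) (p v : ℝ) : ℝ × ℝ :=
  if p ≤ 1 then k₁ (endPt κ₁ p v) else if p ≤ 2 then
    (bridgeAngle κ₁ κ₂ k₁ k₂ lam p v, Y (bridgeAngle κ₁ κ₂ k₁ k₂ lam p v) (r₁ v))
  else k₂ (endPt κ₂ (3 - p) (lam v))

namespace Junction

variable {F : ℝ × ℝ → ℝ × ℝ} {κ₁ κ₂ : SectorType} {S₁ S₂ : Set (ℝ × ℝ)} {θ₁ θ₂ d : ℝ}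
  {k₁ k₂ : ℝ × ℝ → ℝ × ℝ} {α β l₀ ε₀ : ℝ} {Y : ℝ → ℝ → ℝ} {c c₂ : ℝ} {r₁ r₂ lam : ℝ → ℝ}

local notation "Θ" => bridgeAngle κ₁ κ₂ k₁ k₂ lam
local notation "Ψ" => bridge κ₁ κ₂ k₁ k₂ Y r₁ lam
local notation "BOK" => BridgeOK κ₁ κ₂ c lam

local notation "IsJunction" =>
  Junction F κ₁ κ₂ S₁ S₂ θ₁ θ₂ d k₁ k₂ α β l₀ ε₀ Y c c₂ r₁ r₂ lam

lemma lt₁ (J : IsJunction) {v : ℝ} (hv : v ∈ Icc 0 c) :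
    (k₁ (endPt κ₁ 1 v)).1 < (k₁ (5 / 4, 0)).1 := by
  have := (J.norm₁.cross v hv).1; linarith

lemma lt₂ (J : IsJunction) {v : ℝ} (hv : v ∈ Icc 0 c) :
    (k₂ (5 / 4, 0)).1 < (k₂ (endPt κ₂ 1 (lam v))).1 := by
  have := (J.norm₂.cross _ (J.lam_mem v hv).1).1; linarith

lemma axis_lt (J : IsJunction) : (k₁ (5 / 4, 0)).1 < (k₂ (5 / 4, 0)).1 :=
  J.sep _ ⟨by norm_num, le_rfl⟩ _ ⟨by norm_num, le_rfl⟩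

lemma angle_mem (J : IsJunction) {p v : ℝ} (hv : v ∈ Icc 0 c) (hp : p ∈ Icc (1 : ℝ) 2) :
    Θ p v ∈ Icc (k₁ (endPt κ₁ 1 v)).1 (k₂ (endPt κ₂ 1 (lam v))).1 := by
  have h := (J.lt₁ hv).trans (J.axis_lt.trans (J.lt₂ hv))
  have h1 := mul_nonneg (sub_nonneg.2 h.le) (sub_nonneg.2 hp.1)
  have h2 := mul_nonneg (sub_nonneg.2 h.le) (sub_nonneg.2 hp.2)
  unfold bridgeAngle
  constructor <;> linarith

lemma angle_lt (J : IsJunction) {p p' v : ℝ} (hv : v ∈ Icc 0 c) (hp : p < p') :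
    Θ p v < Θ p' v := by
  have h := (J.lt₁ hv).trans (J.axis_lt.trans (J.lt₂ hv))
  have h1 := mul_pos (sub_pos.2 h) (sub_pos.2 hp)
  unfold bridgeAngle
  linarith

lemma angle_one (v : ℝ) : Θ 1 v = (k₁ (endPt κ₁ 1 v)).1 := by unfold bridgeAngle; ring

lemma angle_two (v : ℝ) : Θ 2 v = (k₂ (endPt κ₂ 1 (lam v))).1 := by unfold bridgeAngle; ring

lemma angle_box (J : IsJunction) {p v : ℝ} (hv : v ∈ Icc 0 c) (hp : p ∈ Icc (1 : ℝ) 2) :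
    Θ p v ∈ Icc α β := by
  have h := J.angle_mem hv hp
  exact ⟨(J.norm₁.mem v hv 1 (by norm_num)).1.trans h.1,
    h.2.trans (J.norm₂.mem _ (J.lam_mem v hv).1 1 (by norm_num)).2⟩

lemma level_mem (J : IsJunction) {v : ℝ} (hv : v ∈ Icc 0 c) : v ∈ Icc (0 : ℝ) 2 :=
  ⟨hv.1, by linarith [hv.2, J.norm₁.le]⟩

lemma map_left {p : ℝ} (v : ℝ) (hp : p ≤ 1) : Ψ p v = k₁ (endPt κ₁ p v) := by
  simp [bridge, hp]

lemma map_mid (J : IsJunction) {p v : ℝ} (hv : v ∈ Icc 0 c) (hp : p ∈ Icc (1 : ℝ) 2) :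
    Ψ p v = (Θ p v, Y (Θ p v) (r₁ v)) := by
  rcases hp.1.eq_or_lt with rfl | h
  · rw [map_left v le_rfl, angle_one]
    exact Prod.ext rfl (J.norm₁.eq v hv 1 (by norm_num))
  · simp [bridge, not_le.2 h, hp.2]

/-- At `p = 2` the two formulas agree because `r₂ (lam v) = r₁ v`, just as `map_mid` at `p = 1`
rests on the normal form of the first chart. -/
lemma map_right (J : IsJunction) {p v : ℝ} (h : BOK p v) (hp : 2 ≤ p) :
    Ψ p v = k₂ (endPt κ₂ (3 - p) (lam v)) := by
  rcases hp.eq_or_lt with rfl | hlt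
  · have hv : v ∈ Icc 0 c := ⟨h.level.1, h.mid (by norm_num) le_rfl⟩
    have hl := J.lam_mem v hv
    rw [J.map_mid hv (by norm_num), angle_two, ← hl.2, show (3 : ℝ) - 2 = 1 by norm_num]
    exact Prod.ext rfl (J.norm₂.eq _ hl.1 1 (by norm_num)).symm
  · simp [bridge, not_le.2 hlt, not_le.2 (one_lt_two.trans hlt)]

lemma lam_nonneg (J : IsJunction) {v : ℝ} (hv : v ∈ Icc (0 : ℝ) 2) : 0 ≤ lam v := by
  have := J.lam_mono.monotoneOn ⟨le_rfl, two_pos.le⟩ hv hv.1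
  rwa [J.lam_zero] at this

lemma lam_pos (J : IsJunction) {v : ℝ} (hv : v ∈ Icc (0 : ℝ) 2) (h : 0 < v) : 0 < lam v := by
  have := J.lam_mono ⟨le_rfl, two_pos.le⟩ hv h
  rwa [J.lam_zero] at this

lemma snd_pos (J : IsJunction) {p v : ℝ} (h : BOK p v) (h0 : 0 < v ∨ p < 0 ∨ 3 < p) :
    0 < (Ψ p v).2 := by
  rcases le_or_gt p 1 with h1 | h1
  · have hok := (h.left h1).1
    rw [map_left v h1]
    exact J.chart₁.pos _ hok.mem_bigDisc (hok.not_axis (by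
      rcases h0 with h | h | h
      exacts [Or.inl h, Or.inr h, by linarith]))
  rcases le_or_gt p 2 with h2 | h2
  · have hv : v ∈ Icc 0 c := ⟨h.level.1, h.mid h1.le h2⟩
    have h0 : 0 < v := h0.resolve_right (by rintro (h | h) <;> linarith)
    rw [J.map_mid hv ⟨h1.le, h2⟩]
    refine J.box.pos _ (J.angle_box hv ⟨h1.le, h2⟩) _ ⟨?_, (J.norm₁.mapsTo hv).2⟩
    have := J.norm₁.mono ⟨le_rfl, J.norm₁.pos.le⟩ hv h0
    rwa [J.norm₁.zero] at this
  · have hok := (h.right h2.le).1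
    rw [J.map_right h h2.le]
    exact J.chart₂.pos _ hok.mem_bigDisc (hok.not_axis (by
      rcases h0 with h0 | h0 | h0
      exacts [Or.inl (J.lam_pos h.level h0), by linarith, Or.inr (by linarith)]))

/-- Up to `p = 2` this is the property `avoid₁` of the flow box; afterwards the images of the two
charts are separated by their angles. -/
lemma notMem₁ (J : IsJunction) {p v : ℝ} (h : BOK p v) (hp : 1 < p) {a : ℝ × ℝ}
    (ha : a ∈ bigDisc) (ha1 : endPos κ₁ a ≤ 1) : k₁ a ≠ Ψ p v := by
  intro he
  rcases le_or_gt p 2 with h2 | h2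
  · have hv : v ∈ Icc 0 c := ⟨h.level.1, h.mid hp.le h2⟩
    rw [J.map_mid hv ⟨hp.le, h2⟩] at he
    have h1 := J.avoid₁ v hv _ (J.angle_box hv ⟨hp.le, h2⟩) a ha ha1 he
    have h3 := J.angle_lt hv hp
    rw [angle_one] at h3
    linarith
  · rw [J.map_right h h2.le] at he
    exact absurd (congrArg Prod.fst he) (J.sep _ ha _ (h.right h2.le).1.mem_bigDisc).ne

lemma notMem₂ (J : IsJunction) {p v : ℝ} (h : BOK p v) (hp : p < 2) {a : ℝ × ℝ}
    (ha : a ∈ bigDisc) (ha1 : endPos κ₂ a ≤ 1) : k₂ a ≠ Ψ p v := by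
  intro he
  rcases le_or_gt p 1 with h1 | h1
  · rw [map_left v h1] at he
    exact absurd (congrArg Prod.fst he) (J.sep _ (h.left h1).1.mem_bigDisc _ ha).ne'
  · have hv : v ∈ Icc 0 c := ⟨h.level.1, h.mid h1.le hp.le⟩
    have hl := J.lam_mem v hv
    rw [J.map_mid hv ⟨h1.le, hp.le⟩, ← hl.2] at he
    have h1 := J.avoid₂ _ hl.1 _ (J.angle_box hv ⟨h1.le, hp.le⟩) a ha ha1 he
    have h3 := J.angle_lt hv hp
    rw [angle_two] at h3
    linarith

/-- Within each of the three pieces injectivity is that of a chart or of the box; different pieces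
are kept apart by `notMem₁` and `notMem₂`. -/
lemma map_inj (J : IsJunction) {p v p' v' : ℝ} (h : BOK p v) (h' : BOK p' v')
    (he : Ψ p v = Ψ p' v') : p = p' ∧ v = v' := by
  wlog hpp : p ≤ p' generalizing p v p' v'
  · have := this h' h he.symm (le_of_not_ge hpp)
    exact ⟨this.1.symm, this.2.symm⟩
  rcases le_or_gt p' 1 with h1' | h1'
  · have h1 := hpp.trans h1'
    have hok := (h.left h1).1
    have hok' := (h'.left h1').1
    rw [map_left v h1, map_left v' h1'] at he
    have e := J.chart₁.inj hok.mem_bigDisc hok'.mem_bigDisc he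
    have e1 := congrArg (endPos κ₁) e
    have e2 := congrArg (modelLev κ₁) e
    rw [hok.coords.2.1, hok'.coords.2.1] at e1
    rw [hok.coords.2.2.1, hok'.coords.2.2.1] at e2
    exact ⟨e1, e2⟩
  rcases le_or_gt p 1 with h1 | h1
  · have hok := (h.left h1).1
    rw [map_left v h1] at he
    exact absurd he (J.notMem₁ h' h1' hok.mem_bigDisc (by rw [hok.coords.2.1]; exact h1))
  rcases le_or_gt 2 p with h2 | h2
  · have h2' := h2.trans hpp
    have hok := (h.right h2).1
    have hok' := (h'.right h2').1
    rw [J.map_right h h2, J.map_right h' h2'] at he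
    have e := J.chart₂.inj hok.mem_bigDisc hok'.mem_bigDisc he
    have e1 := congrArg (endPos κ₂) e
    have e2 := congrArg (modelLev κ₂) e
    rw [hok.coords.2.1, hok'.coords.2.1] at e1
    rw [hok.coords.2.2.1, hok'.coords.2.2.1] at e2
    exact ⟨by linarith, J.lam_mono.injOn h.level h'.level e2⟩
  rcases le_or_gt 2 p' with h2' | h2'
  · have hok := (h'.right h2').1
    rw [J.map_right h' h2'] at he
    exact absurd he.symm (J.notMem₂ h h2 hok.mem_bigDisc (by rw [hok.coords.2.1]; linarith))
  · have hv : v ∈ Icc 0 c := ⟨h.level.1, h.mid h1.le h2.le⟩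
    have hv' : v' ∈ Icc 0 c := ⟨h'.level.1, h'.mid h1'.le h2'.le⟩
    rw [J.map_mid hv ⟨h1.le, h2.le⟩, J.map_mid hv' ⟨h1'.le, h2'.le⟩] at he
    have e1 := congrArg Prod.fst he
    have e2 := congrArg Prod.snd he
    simp only at e1 e2
    rw [← e1] at e2
    have ev := J.norm₁.mono.injOn hv hv' (J.box.inj _ (J.angle_box hv ⟨h1.le, h2.le⟩)
      (J.norm₁.mapsTo hv) (J.norm₁.mapsTo hv') e2)
    subst ev
    refine ⟨le_antisymm hpp ?_, rfl⟩
    by_contra hlt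
    exact absurd e1 (J.angle_lt hv (not_le.1 hlt)).ne

lemma arcs (J : IsJunction) {p p' v : ℝ} (hpp : p ≤ p') (h : ∀ x ∈ Icc p p', BOK x v)
    (h0 : 0 < v ∨ p' < 0 ∨ 3 < p) :
    Reaches F ((fun x => Ψ x v) '' Icc p p') (Ψ p v) (Ψ p' v) := by
  have split : ∀ x ∈ Icc p p', Reaches F ((fun x => Ψ x v) '' Icc p x) (Ψ p v) (Ψ x v) →
      Reaches F ((fun x => Ψ x v) '' Icc x p') (Ψ x v) (Ψ p' v) →
      Reaches F ((fun x => Ψ x v) '' Icc p p') (Ψ p v) (Ψ p' v) := fun x hx h1 h2 =>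
    (h1.mono (image_mono (Icc_subset_Icc_right hx.2))).trans
      (h2.mono (image_mono (Icc_subset_Icc_left hx.1)))
  have left : ∀ x y, x ≤ y → y ≤ 1 → Icc x y ⊆ Icc p p' →
      Reaches F ((fun x => Ψ x v) '' Icc x y) (Ψ x v) (Ψ y v) := by
    intro x y hxy hy hs
    have hx' := (h x (hs ⟨le_rfl, hxy⟩)).left (hxy.trans hy)
    have hy' := (h y (hs ⟨hxy, le_rfl⟩)).left hy
    have := J.chart₁.reaches_endPt hx'.1 hy'.1 hx'.2 (by
      rcases h0 with h | h | h
      exacts [Or.inl h, Or.inr (Or.inr (by linarith [(hs ⟨hxy, le_rfl⟩ : y ∈ _).2])),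
        Or.inl (by linarith [(hs ⟨le_rfl, hxy⟩ : x ∈ _).1])]) hxy
    rw [map_left v (hxy.trans hy), map_left v hy]
    refine this.mono ?_
    rintro _ ⟨r, hr, rfl⟩
    exact ⟨r, hr, map_left v (hr.2.trans hy)⟩
  have right : ∀ x y, x ≤ y → 2 ≤ x → Icc x y ⊆ Icc p p' →
      Reaches F ((fun x => Ψ x v) '' Icc x y) (Ψ x v) (Ψ y v) := by
    intro x y hxy hx hs
    have hxm := h x (hs ⟨le_rfl, hxy⟩)
    have hym := h y (hs ⟨hxy, le_rfl⟩)
    have hx' := hxm.right hx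
    have hy' := hym.right (hx.trans hxy)
    -- The second chart belongs to `-F`, for which movement along the arc is away from `L₂`; as its
    -- position is `3 - p`, reversing it gives arcs of `F` with increasing `p`.
    have := reaches_neg_iff.1 (J.chart₂.reaches_endPt hy'.1 hx'.1 hy'.2 (by
      rcases h0 with h | h | h
      exacts [Or.inl (J.lam_pos hxm.level h), Or.inl (by linarith [(hs ⟨hxy, le_rfl⟩ : y ∈ _).2]),
        Or.inr (Or.inr (by linarith [(hs ⟨le_rfl, hxy⟩ : x ∈ _).1]))]) (by linarith))
    rw [J.map_right hxm hx, J.map_right hym (hx.trans hxy)]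
    refine this.mono ?_
    rintro _ ⟨r, hr, rfl⟩
    have hr' : 3 - r ∈ Icc x y := ⟨by linarith [hr.2], by linarith [hr.1]⟩
    refine ⟨3 - r, hr', ?_⟩
    simp only [J.map_right (h _ (hs hr')) (hx.trans hr'.1), sub_sub_cancel]
  have mid : ∀ x y, x ≤ y → 1 ≤ x → y ≤ 2 → Icc x y ⊆ Icc p p' →
      Reaches F ((fun x => Ψ x v) '' Icc x y) (Ψ x v) (Ψ y v) := by
    intro x y hxy hx hy hs
    have hxm := h x (hs ⟨le_rfl, hxy⟩)
    have hv : v ∈ Icc 0 c := ⟨hxm.level.1, hxm.mid hx (hxy.trans hy)⟩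
    have bx := J.angle_box hv ⟨hx, hxy.trans hy⟩
    have by' := J.angle_box hv ⟨hx.trans hxy, hy⟩
    have hle : Θ x v ≤ Θ y v := by
      rcases hxy.eq_or_lt with rfl | hlt
      exacts [le_rfl, (J.angle_lt hv hlt).le]
    have := J.box.arc _ _ _ bx.1 hle by'.2 (J.norm₁.mapsTo hv)
    rw [J.map_mid hv ⟨hx, hxy.trans hy⟩, J.map_mid hv ⟨hx.trans hxy, hy⟩]
    refine this.mono ?_
    rintro _ ⟨θ, hθ, rfl⟩
    obtain ⟨r, hr, rfl⟩ := intermediate_value_Icc (f := fun r => Θ r v) hxy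
      (by unfold bridgeAngle; fun_prop) hθ
    exact ⟨r, hr, J.map_mid hv ⟨hx.trans hr.1, hr.2.trans hy⟩⟩
  have right' : ∀ x y, x ≤ y → 1 ≤ x → Icc x y ⊆ Icc p p' →
      Reaches F ((fun x => Ψ x v) '' Icc x y) (Ψ x v) (Ψ y v) := by
    intro x y hxy hx hs
    rcases le_total y 2 with hy | hy
    · exact mid x y hxy hx hy hs
    rcases le_total 2 x with hx' | hx'
    · exact right x y hxy hx' hs
    · exact ((mid x 2 hx' hx le_rfl ((Icc_subset_Icc_right hy).trans hs)).mono
        (image_mono (Icc_subset_Icc_right hy))).trans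
        ((right 2 y hy le_rfl ((Icc_subset_Icc_left hx').trans hs)).mono
        (image_mono (Icc_subset_Icc_left hx')))
  rcases le_total p' 1 with h1 | h1
  · exact left p p' hpp h1 subset_rfl
  rcases le_total 1 p with h2 | h2
  · exact right' p p' hpp h2 subset_rfl
  · exact split 1 ⟨h2, h1⟩ (left p 1 h2 le_rfl (Icc_subset_Icc_right h1))
      (right' 1 p' h1 le_rfl (Icc_subset_Icc_left h2))

end Junction

/-! ### Continuity of the bridge and the set that it fills -/

namespace Junction

variable {F : ℝ × ℝ → ℝ × ℝ} {κ₁ κ₂ : SectorType} {S₁ S₂ : Set (ℝ × ℝ)} {θ₁ θ₂ d : ℝ}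
  {k₁ k₂ : ℝ × ℝ → ℝ × ℝ} {α β l₀ ε₀ : ℝ} {Y : ℝ → ℝ → ℝ} {c c₂ : ℝ} {r₁ r₂ lam : ℝ → ℝ}

local notation "Θ" => bridgeAngle κ₁ κ₂ k₁ k₂ lam
local notation "Ψ" => bridge κ₁ κ₂ k₁ k₂ Y r₁ lam
local notation "BOK" => BridgeOK κ₁ κ₂ c lam
local notation "IsJunction" =>
  Junction F κ₁ κ₂ S₁ S₂ θ₁ θ₂ d k₁ k₂ α β l₀ ε₀ Y c c₂ r₁ r₂ lam

lemma continuousOn_bridge (J : IsJunction) :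
    ContinuousOn (fun q : ℝ × ℝ => Ψ q.1 q.2) {q | BOK q.1 q.2} := by
  refine ContinuousOn.of_le_of_ge (g := Prod.fst) (a := 1) continuous_fst.continuousOn ?_ ?_
  · refine (J.chart₁.cont.comp (continuous_endPt κ₁).continuousOn fun q hq =>
      ((hq.1 : BOK q.1 q.2).left hq.2).1.mem_bigDisc).congr fun q hq => map_left _ hq.2
  refine ContinuousOn.of_le_of_ge (g := Prod.fst) (a := 2) continuous_fst.continuousOn ?_ ?_
  · have hm : ∀ q ∈ ({q : ℝ × ℝ | BOK q.1 q.2} ∩ {q | 1 ≤ q.1}) ∩ {q | q.1 ≤ 2},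
        q.2 ∈ Icc 0 c ∧ q.1 ∈ Icc (1 : ℝ) 2 := fun q hq =>
      ⟨⟨(hq.1.1 : BOK q.1 q.2).level.1, (hq.1.1 : BOK q.1 q.2).mid hq.1.2 hq.2⟩, hq.1.2, hq.2⟩
    have h1 : ContinuousOn (fun q : ℝ × ℝ => Θ q.1 q.2)
        (({q : ℝ × ℝ | BOK q.1 q.2} ∩ {q | 1 ≤ q.1}) ∩ {q | q.1 ≤ 2}) := by
      have a1 : ContinuousOn (fun q : ℝ × ℝ => (k₁ (endPt κ₁ 1 q.2)).1)
          (({q : ℝ × ℝ | BOK q.1 q.2} ∩ {q | 1 ≤ q.1}) ∩ {q | q.1 ≤ 2}) :=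
        continuous_fst.comp_continuousOn (J.chart₁.continuousOn_endPt.comp
          (f := fun q : ℝ × ℝ => ((1 : ℝ), q.2)) (by fun_prop) fun q hq =>
            ⟨by norm_num, (hm q hq).1.1, by
              have := (hm q hq).1.2.trans J.norm₁.le; simp only; linarith⟩)
      have al : ContinuousOn (fun q : ℝ × ℝ => lam q.2)
          (({q : ℝ × ℝ | BOK q.1 q.2} ∩ {q | 1 ≤ q.1}) ∩ {q | q.1 ≤ 2}) :=
        J.lam_cont.comp continuous_snd.continuousOn fun q hq => (hq.1.1 : BOK q.1 q.2).level
      have a2 : ContinuousOn (fun q : ℝ × ℝ => (k₂ (endPt κ₂ 1 (lam q.2))).1)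
          (({q : ℝ × ℝ | BOK q.1 q.2} ∩ {q | 1 ≤ q.1}) ∩ {q | q.1 ≤ 2}) :=
        continuous_fst.comp_continuousOn (J.chart₂.continuousOn_endPt.comp
          (f := fun q : ℝ × ℝ => ((1 : ℝ), lam q.2)) (continuousOn_const.prodMk al) fun q hq =>
            ⟨by norm_num, (J.lam_mem _ (hm q hq).1).1.1, by
              have := (J.lam_mem _ (hm q hq).1).1.2.trans J.norm₂.le; simp only; linarith⟩)
      unfold bridgeAngle
      exact ((continuousOn_const.sub continuous_fst.continuousOn).mul a1).add
        ((continuous_fst.continuousOn.sub continuousOn_const).mul a2)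
    have h2 := J.norm₁.cont.comp continuous_snd.continuousOn fun q hq => (hm q hq).1
    refine (h1.prodMk (J.box.cont.comp (h1.prodMk h2) fun q hq =>
      ⟨J.angle_box (hm q hq).1 (hm q hq).2, J.norm₁.mapsTo (hm q hq).1⟩)).congr fun q hq => ?_
    exact J.map_mid (hm q hq).1 (hm q hq).2
  · have al : ContinuousOn (fun q : ℝ × ℝ => (3 - q.1, lam q.2))
        (({q : ℝ × ℝ | BOK q.1 q.2} ∩ {q | 1 ≤ q.1}) ∩ {q | 2 ≤ q.1}) :=
      (continuousOn_const.sub continuous_fst.continuousOn).prodMk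
        (J.lam_cont.comp continuous_snd.continuousOn fun q hq => (hq.1.1 : BOK q.1 q.2).level)
    exact (J.chart₂.cont.comp ((continuous_endPt κ₂).comp_continuousOn al) fun q hq =>
      ((hq.1.1 : BOK q.1 q.2).right hq.2).1.mem_bigDisc).congr fun q hq => J.map_right hq.1.1 hq.2

lemma range (J : IsJunction) {p v : ℝ} (h : BOK p v) : (Ψ p v).1 ∈ Ioo (θ₁ - 1) (θ₂ + 1) := by
  have n₁ : ∀ a ∈ bigDisc, θ₁ - 1 < (k₁ a).1 := fun a ha => by
    have := (abs_lt.1 (J.chart₁.near a ha)).1; linarith [J.d_le]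
  have n₂ : ∀ a ∈ bigDisc, (k₂ a).1 < θ₂ + 1 := fun a ha => by
    have := (abs_lt.1 (J.chart₂.near a ha)).2; linarith [J.d_le]
  have h0 : (0 : ℝ × ℝ) ∈ bigDisc := ⟨by norm_num, le_rfl⟩
  rcases le_or_gt p 1 with h1 | h1
  · have hm := (h.left h1).1.mem_bigDisc
    rw [map_left v h1]
    exact ⟨n₁ _ hm, (J.sep _ hm _ h0).trans (n₂ _ h0)⟩
  rcases le_or_gt p 2 with h2 | h2
  · have hv : v ∈ Icc 0 c := ⟨h.level.1, h.mid h1.le h2⟩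
    have ha := J.angle_mem hv ⟨h1.le, h2⟩
    rw [J.map_mid hv ⟨h1.le, h2⟩]
    exact ⟨(n₁ _ (endOK_of_mem (by norm_num) ⟨hv.1, by linarith [hv.2, J.norm₁.le]⟩).mem_bigDisc).trans_le
      ha.1, ha.2.trans_lt (n₂ _ (endOK_of_mem (by norm_num) ⟨(J.lam_mem v hv).1.1, by
        linarith [(J.lam_mem v hv).1.2, J.norm₂.le]⟩).mem_bigDisc)⟩
  · have hm := (h.right h2.le).1.mem_bigDisc
    rw [J.map_right h h2.le]
    exact ⟨(n₁ _ h0).trans (J.sep _ h0 _ hm), n₂ _ hm⟩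

/-- The middle piece starts at the transversal `R = 1` of the first chart, before the strip begins.
Until the angle of `(5/4, 0)` it runs along the chart segment from `R = 1` to `R = 3/2` and so
belongs to `S₁`; the other end is similar. -/
lemma subset (J : IsJunction) {p v : ℝ} (h : BOK p v) :
    Ψ p v ∈ S₁ ∪ S₂ ∪ Icc (k₁ (5 / 4, 0)).1 (k₂ (5 / 4, 0)).1 ×ˢ Ici (0 : ℝ) := by
  rcases le_or_gt p 1 with h1 | h1
  · rw [map_left v h1]
    exact Or.inl (Or.inl (J.chart₁.subset _ (h.left h1).1.mem_bigDisc))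
  rcases le_or_gt 2 p with h2 | h2
  · rw [J.map_right h h2]
    exact Or.inl (Or.inr (J.chart₂.subset _ (h.right h2).1.mem_bigDisc))
  have hv : v ∈ Icc 0 c := ⟨h.level.1, h.mid h1.le h2.le⟩
  have hl := J.lam_mem v hv
  have ha := J.angle_mem hv ⟨h1.le, h2.le⟩
  have hb := J.angle_box hv ⟨h1.le, h2.le⟩
  have hc4 := J.norm₁.le
  have hc4' := J.norm₂.le
  rw [J.map_mid hv ⟨h1.le, h2.le⟩]
  set θ := Θ p v
  have hsub : Icc (1 : ℝ) (3 / 2) ⊆ Icc (1 / 2) (3 / 2) := Icc_subset_Icc_left (by norm_num)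
  rcases lt_or_ge θ (k₁ (5 / 4, 0)).1 with h3 | h3
  · have hc : ContinuousOn (fun R => (k₁ (endPt κ₁ R v)).1) (Icc 1 (3 / 2)) :=
      continuous_fst.comp_continuousOn (J.chart₁.continuousOn_endPt.comp
        (by fun_prop : Continuous fun R : ℝ => (R, v)).continuousOn fun R hR =>
          ⟨hsub hR, hv.1, by simp only; linarith [hv.2]⟩)
    obtain ⟨R, hR, he⟩ := intermediate_value_Icc (by norm_num : (1 : ℝ) ≤ 3 / 2) hc
      (show θ ∈ Icc _ _ from ⟨ha.1, by have := (J.norm₁.cross v hv).2; linarith⟩)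
    have e := J.norm₁.eq v hv R (hsub hR)
    simp only at he
    rw [he] at e
    have : (θ, Y θ (r₁ v)) = k₁ (endPt κ₁ R v) := Prod.ext he.symm e.symm
    rw [this]
    exact Or.inl (Or.inl (J.chart₁.subset _ (endOK_of_mem ⟨by linarith [hR.1], hR.2⟩
      ⟨hv.1, by linarith [hv.2]⟩).mem_bigDisc))
  rcases lt_or_ge (k₂ (5 / 4, 0)).1 θ with h4 | h4
  · have hc : ContinuousOn (fun R => -(k₂ (endPt κ₂ R (lam v))).1) (Icc 1 (3 / 2)) :=
      (continuous_fst.comp_continuousOn (J.chart₂.continuousOn_endPt.comp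
        (by fun_prop : Continuous fun R : ℝ => (R, lam v)).continuousOn fun R hR =>
          ⟨hsub hR, hl.1.1, by simp only; linarith [hl.1.2]⟩)).neg
    obtain ⟨R, hR, he⟩ := intermediate_value_Icc (by norm_num : (1 : ℝ) ≤ 3 / 2) hc
      (show -θ ∈ Icc (-(k₂ (endPt κ₂ 1 (lam v))).1) (-(k₂ (endPt κ₂ (3 / 2) (lam v))).1) from
        ⟨by linarith [ha.2], by have := (J.norm₂.cross _ hl.1).2; linarith⟩)
    have e := J.norm₂.eq _ hl.1 R (hsub hR)
    have he : (k₂ (endPt κ₂ R (lam v))).1 = θ := neg_injective he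
    rw [he, hl.2] at e
    have : (θ, Y θ (r₁ v)) = k₂ (endPt κ₂ R (lam v)) := Prod.ext he.symm e.symm
    rw [this]
    exact Or.inl (Or.inr (J.chart₂.subset _ (endOK_of_mem ⟨by linarith [hR.1], hR.2⟩
      ⟨hl.1.1, by linarith [hl.1.2]⟩).mem_bigDisc))
  · refine Or.inr ⟨⟨h3, h4⟩, ?_⟩
    have hr := J.norm₁.mapsTo hv
    rcases hr.1.eq_or_lt with h0 | h0
    · exact (by rw [← h0, J.box.zero θ hb] : Y θ (r₁ v) = 0).ge
    · exact (J.box.pos θ hb _ ⟨h0, hr.2⟩).le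

/-- There are two ways to approach `ρ = 0`: the label tends to `0`, or the position tends to the
vertex of a sector that is not hyperbolic. This yields continuity of the unions at their vertex. -/
lemma exists_snd_lt (J : IsJunction) {ε : ℝ} (hε : 0 < ε) : ∃ δ > 0, ∀ p v, BOK p v →
    -δ < p → p < 3 + δ → (v < δ ∨ κ₁ ≠ .hyperbolic ∧ p < δ ∨ κ₂ ≠ .hyperbolic ∧ 3 - δ < p) →
    (Ψ p v).2 < ε := by
  obtain ⟨δ₁, hδ₁, h1⟩ := J.chart₁.exists_snd_lt hε
  obtain ⟨δ₂, hδ₂, h2⟩ := J.chart₂.exists_snd_lt hε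
  obtain ⟨δ₃, hδ₃, h3⟩ : ∃ δ > 0, ∀ v ∈ Icc (0 : ℝ) 2, v < δ → lam v < δ₂ :=
    isCompact_Icc.exists_of_eventually_of_eq_zero (g := id) continuousOn_id (fun v hv => hv.1)
      fun v hv h0 => by
        obtain rfl : v = 0 := h0
        exact (J.lam_cont 0 hv).eventually (Iio_mem_nhds (by rw [J.lam_zero]; exact hδ₂))
  have hYr : ContinuousOn (fun q : ℝ × ℝ => Y q.1 (r₁ q.2)) (Icc α β ×ˢ Icc 0 c) :=
    J.box.cont.comp (f := fun q : ℝ × ℝ => (q.1, r₁ q.2)) (continuous_fst.continuousOn.prodMk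
      (J.norm₁.cont.comp continuous_snd.continuousOn fun q hq => hq.2))
      fun q hq => ⟨hq.1, J.norm₁.mapsTo hq.2⟩
  obtain ⟨δ₄, hδ₄, h4⟩ : ∃ δ > 0, ∀ q ∈ Icc α β ×ˢ Icc 0 c, q.2 < δ → Y q.1 (r₁ q.2) < ε :=
    (isCompact_Icc.prod isCompact_Icc).exists_of_eventually_of_eq_zero (g := Prod.snd)
      continuous_snd.continuousOn (fun q hq => hq.2.1) fun q hq h0 =>
        (hYr q hq).eventually (Iio_mem_nhds (by simp only [h0]; rw [J.norm₁.zero, J.box.zero _ hq.1]; exact hε))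
  refine ⟨min (min (min δ₁ δ₂) (min δ₃ δ₄)) (1 / 2), by positivity, fun p v h hp0 hp3 hor => ?_⟩
  set δ := min (min (min δ₁ δ₂) (min δ₃ δ₄)) (1 / 2) with hδ
  have e0 : δ ≤ 1 / 2 := min_le_right _ _
  have e1 : δ ≤ δ₁ := (min_le_left _ _).trans ((min_le_left _ _).trans (min_le_left _ _))
  have e2 : δ ≤ δ₂ := (min_le_left _ _).trans ((min_le_left _ _).trans (min_le_right _ _))
  have e3 : δ ≤ δ₃ := (min_le_left _ _).trans ((min_le_right _ _).trans (min_le_left _ _))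
  have e4 : δ ≤ δ₄ := (min_le_left _ _).trans ((min_le_right _ _).trans (min_le_right _ _))
  rcases le_or_gt p 1 with hp1 | hp1
  · rw [map_left v hp1]
    refine h1 p v (h.left hp1).1 (by linarith) ?_
    rcases hor with h | h | h
    exacts [Or.inl (h.trans_le e1), Or.inr ⟨h.1, h.2.trans_le e1⟩, by linarith [h.2]]
  rcases le_or_gt p 2 with hp2 | hp2
  · have hv : v ∈ Icc 0 c := ⟨h.level.1, h.mid hp1.le hp2⟩
    rw [J.map_mid hv ⟨hp1.le, hp2⟩]
    refine h4 (_, v) ⟨J.angle_box hv ⟨hp1.le, hp2⟩, hv⟩ ?_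
    rcases hor with h | h | h
    exacts [h.trans_le e4, by linarith [h.2], by linarith [h.2]]
  · rw [J.map_right h hp2.le]
    refine h2 _ _ (h.right hp2.le).1 (by linarith) ?_
    rcases hor with h' | h' | h'
    exacts [Or.inl (h3 v h.level (h'.trans_le e3)), by linarith [h'.2],
      Or.inr ⟨h'.1, by linarith [h'.2]⟩]

lemma exists_mid (J : IsJunction) {v θ : ℝ} (hv : v ∈ Icc 0 c)
    (hθ : θ ∈ Icc (k₁ (endPt κ₁ 1 v)).1 (k₂ (endPt κ₂ 1 (lam v))).1) :
    ∃ p ∈ Icc (1 : ℝ) 2, Ψ p v = (θ, Y θ (r₁ v)) := by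
  obtain ⟨p, hp, he⟩ := intermediate_value_Icc (f := fun r => Θ r v) (a := 1) (b := 2)
    (by norm_num) (by unfold bridgeAngle; fun_prop) (by
      simp only [angle_one, angle_two]; exact hθ)
  exact ⟨p, hp, by rw [J.map_mid hv hp]; simp only at he; rw [he]⟩

lemma ok_of_mem (J : IsJunction) {p v : ℝ} (hp : p ∈ Ioo (0 : ℝ) 3) (hv : v ∈ Icc 0 c) :
    BOK p v := by
  have hl := J.lam_mem v hv
  have h4 := J.norm₁.le
  have h4' := J.norm₂.le
  refine ⟨J.level_mem hv, fun h => ⟨endOK_of_mem ⟨hp.1, by linarith⟩ ⟨hv.1, by linarith [hv.2]⟩,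
    Or.inl (by linarith [hv.2])⟩, fun _ _ => hv.2, fun h => ⟨endOK_of_mem ⟨by linarith [hp.2],
      by linarith⟩ ⟨hl.1.1, by linarith [hl.1.2]⟩, Or.inl (by linarith [hl.1.2])⟩⟩

/-- Low points above the strip lie on graphs of small label, and such a graph crosses the strip
within the middle piece, since both transversals lie outside the strip. -/
lemma strip (J : IsJunction) {c' : ℝ} (hc' : c' ∈ Ioc 0 c) : ∃ ε > 0, ∀ q : ℝ × ℝ,
    q.1 ∈ Icc (k₁ (5 / 4, 0)).1 (k₂ (5 / 4, 0)).1 → 0 < q.2 → q.2 < ε →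
      ∃ p ∈ Icc (1 : ℝ) 2, ∃ v ∈ Ioo 0 c', Ψ p v = q := by
  have hs : Icc 0 c' ⊆ Icc 0 c := Icc_subset_Icc_right hc'.2
  have h0c : (0 : ℝ) ∈ Icc 0 c := ⟨le_rfl, J.norm₁.pos.le⟩
  have hr : 0 < r₁ c' := by
    have := J.norm₁.mono h0c ⟨hc'.1.le, hc'.2⟩ hc'.1
    rwa [J.norm₁.zero] at this
  have hnn : ∀ q ∈ Icc α β ×ˢ Icc 0 l₀, 0 ≤ Y q.1 q.2 := fun q hq => by
    rcases hq.2.1.eq_or_lt with h | h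
    · rw [← h, J.box.zero _ hq.1]
    · exact (J.box.pos _ hq.1 _ ⟨h, hq.2.2⟩).le
  obtain ⟨ε, hε, h⟩ := (isCompact_Icc.prod isCompact_Icc).exists_of_eventually_of_eq_zero
    (p := fun q : ℝ × ℝ => q.2 < r₁ c') J.box.cont hnn (fun q hq h0 => by
      have : q.2 = 0 := by
        by_contra hne
        exact (J.box.pos _ hq.1 _ ⟨lt_of_le_of_ne hq.2.1 (Ne.symm hne), hq.2.2⟩).ne' h0
      exact mem_nhdsWithin_of_mem_nhds (continuous_snd.continuousAt.eventually
        (Iio_mem_nhds (by rw [this]; exact hr))))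
  have hm₁ := (J.norm₁.mem 0 h0c (5 / 4) (by norm_num)).1
  have hm₂ := (J.norm₂.mem 0 ⟨le_rfl, J.norm₂.pos.le⟩ (5 / 4) (by norm_num)).2
  rw [endPt_zero_right] at hm₁ hm₂
  refine ⟨min ε ε₀, lt_min hε J.box.ε_pos, fun q hq hq0 hqε => ?_⟩
  have hqb : q.1 ∈ Icc α β := ⟨hm₁.trans hq.1, hq.2.trans hm₂⟩
  obtain ⟨l, hl, hle⟩ := J.box.cover _ hqb _ ⟨hq0.le, (hqε.trans_le (min_le_right _ _)).le⟩
  have hlt : l < r₁ c' := h (q.1, l) ⟨hqb, hl⟩ (by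
    simp only [hle]; exact hqε.trans_le (min_le_left _ _))
  have hl0 : 0 < l := by
    refine lt_of_le_of_ne hl.1 fun h => ?_
    rw [← h, J.box.zero _ hqb] at hle
    exact hq0.ne hle
  obtain ⟨v, hv, rfl⟩ := intermediate_value_Ioo hc'.1.le (J.norm₁.cont.mono hs)
    (show l ∈ Ioo (r₁ 0) (r₁ c') by rw [J.norm₁.zero]; exact ⟨hl0, hlt⟩)
  have hvc := hs (Ioo_subset_Icc_self hv)
  obtain ⟨p, hp, he⟩ := J.exists_mid hvc
    ⟨(J.lt₁ hvc).le.trans hq.1, hq.2.trans (J.lt₂ hvc).le⟩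
  exact ⟨p, hp, v, hv, by rw [he, hle]⟩

/-- A low point of a sector lies in the half disc of its chart, or on a chart segment of small
label, or beyond the mark `(5/4, 0)`. A segment of small label belongs to the bridge, and the points
beyond the mark belong to the strip because, by `far₁` and `far₂`, they do not come near the
opposite end. -/
theorem cover (J : IsJunction) {c' : ℝ} (hc' : c' ∈ Ioc 0 c) : ∃ ε > 0,
    ∀ q ∈ S₁ ∪ S₂ ∪ Icc (k₁ (5 / 4, 0)).1 (k₂ (5 / 4, 0)).1 ×ˢ Ici (0 : ℝ), 0 < q.2 → q.2 < ε →
      (∃ a ∈ halfDisc, k₁ a = q) ∨ (∃ a ∈ halfDisc, k₂ a = q) ∨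
        ∃ p ∈ Icc (1 / 2 : ℝ) (5 / 2), ∃ v ∈ Ioo 0 c', Ψ p v = q := by
  have hc0 : c' ∈ Icc 0 c := ⟨hc'.1.le, hc'.2⟩
  have hlc := J.lam_pos (J.level_mem hc0) hc'.1
  have h4 := J.norm₁.le
  have h4' := J.norm₂.le
  obtain ⟨ε₁, hε₁, h1⟩ := J.strip hc'
  obtain ⟨ε₂, hε₂, h2⟩ := J.chart₁.cover c' hc'.1
  obtain ⟨ε₃, hε₃, h3⟩ := J.chart₂.cover _ hlc
  obtain ⟨ε₅, hε₅, h5⟩ := J.far₁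
  obtain ⟨ε₆, hε₆, h6⟩ := J.far₂
  refine ⟨min (min ε₁ (min ε₂ ε₃)) (min ε₅ ε₆), by positivity, fun q hq hq0 hqε => ?_⟩
  simp only [lt_min_iff] at hqε
  obtain ⟨⟨e1, e2, e3⟩, e5, e6⟩ := hqε
  have hstrip : q.1 ∈ Icc (k₁ (5 / 4, 0)).1 (k₂ (5 / 4, 0)).1 →
      ∃ p ∈ Icc (1 / 2 : ℝ) (5 / 2), ∃ v ∈ Ioo 0 c', Ψ p v = q := fun hm => by
    obtain ⟨p, hp, hv⟩ := h1 q hm hq0 e1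
    exact ⟨p, ⟨by linarith [hp.1], by linarith [hp.2]⟩, hv⟩
  rcases hq with (hq | hq) | hq
  · rcases h2 q hq e2 with h | ⟨a, ⟨ha, ha0⟩, hR, hw, rfl⟩ | h
    · exact Or.inl h
    · right; right
      have hE := endPt_endPos_endLev ha ha0 (κ := κ₁) (Or.inl (by linarith [hc'.2]))
      set R := endPos κ₁ a
      set w := endLev κ₁ a
      have hw0 : 0 < w := by
        refine lt_of_le_of_ne hE.2.1 fun h => ?_
        rw [← h, endPt_zero_right] at hE
        rw [← hE.1, J.chart₁.axis R ⟨by linarith [hR.1], by linarith [hR.2]⟩] at hq0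
        exact lt_irrefl _ hq0
      have hwc : w ∈ Icc 0 c := ⟨hw0.le, hw.le.trans hc'.2⟩
      rcases le_or_gt R 1 with h1' | h1'
      · exact ⟨R, ⟨hR.1.le, by linarith⟩, w, ⟨hw0, hw⟩, by rw [map_left w h1', hE.1]⟩
      · have hRm : R ∈ Icc (1 / 2 : ℝ) (3 / 2) := ⟨hR.1.le, hR.2.le⟩
        have m1 := J.norm₁.strict w hwc (by norm_num : (1 : ℝ) ∈ Icc (1 / 2 : ℝ) (3 / 2)) hRm h1'
        have m2 := J.norm₁.eq w hwc R hRm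
        simp only [one_mul] at m1
        rw [hE.1] at m1 m2
        obtain ⟨p, hp, he⟩ := J.exists_mid hwc (θ := (k₁ a).1) ⟨m1.le, (J.sep _ ha _
          (endOK_of_mem (by norm_num) ⟨(J.lam_mem w hwc).1.1, by
            linarith [(J.lam_mem w hwc).1.2]⟩).mem_bigDisc).le⟩
        exact ⟨p, ⟨by linarith [hp.1], by linarith [hp.2]⟩, w, ⟨hw0, hw⟩, by
          rw [he, ← m2]⟩
    · exact Or.inr (Or.inr (hstrip ⟨by linarith, (h5 q hq e5).le⟩))
  · rcases h3 q hq e3 with h | ⟨a, ⟨ha, ha0⟩, hR, hw, rfl⟩ | h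
    · exact Or.inr (Or.inl h)
    · right; right
      have hl1 := (J.lam_mem c' hc0).1.2
      have hE := endPt_endPos_endLev ha ha0 (κ := κ₂) (Or.inl (by linarith))
      set R := endPos κ₂ a
      set w := endLev κ₂ a
      have hw0 : 0 < w := by
        refine lt_of_le_of_ne hE.2.1 fun h => ?_
        rw [← h, endPt_zero_right] at hE
        rw [← hE.1, J.chart₂.axis R ⟨by linarith [hR.1], by linarith [hR.2]⟩] at hq0
        exact lt_irrefl _ hq0
      obtain ⟨v, hv, hvw⟩ := intermediate_value_Ioo hc'.1.le (J.lam_cont.mono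
        (Icc_subset_Icc_right (J.level_mem hc0).2))
        (show w ∈ Ioo (lam 0) (lam c') by rw [J.lam_zero]; exact ⟨hw0, hw⟩)
      have hvc : v ∈ Icc 0 c := ⟨hv.1.le, hv.2.le.trans hc'.2⟩
      have hl := J.lam_mem v hvc
      rcases le_or_gt R 1 with h1' | h1'
      · exact ⟨3 - R, ⟨by linarith, by linarith [hR.1]⟩, v, hv, by
          rw [J.map_right (J.ok_of_mem ⟨by linarith, by linarith [hR.1]⟩ hvc) (by linarith),
            hvw, sub_sub_cancel, hE.1]⟩
      · have hRm : R ∈ Icc (1 / 2 : ℝ) (3 / 2) := ⟨hR.1.le, hR.2.le⟩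
        have m1 := J.norm₂.strict _ hl.1 (by norm_num : (1 : ℝ) ∈ Icc (1 / 2 : ℝ) (3 / 2)) hRm h1'
        have m2 := J.norm₂.eq _ hl.1 R hRm
        simp only [neg_mul, one_mul, neg_lt_neg_iff] at m1
        rw [hl.2, hvw, hE.1] at m2
        rw [hvw] at m1
        rw [hE.1] at m1
        obtain ⟨p, hp, he⟩ := J.exists_mid hvc (θ := (k₂ a).1) ⟨(J.sep _
          (endOK_of_mem (by norm_num) ⟨hvc.1, by linarith [hvc.2]⟩).mem_bigDisc _ ha).le, by
            rw [hvw]; exact m1.le⟩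
        exact ⟨p, ⟨by linarith [hp.1], by linarith [hp.2]⟩, v, hv, by
          rw [he, ← m2]⟩
    · exact Or.inr (Or.inr (hstrip ⟨(h6 q hq e6).le, by linarith⟩))
  · exact Or.inr (Or.inr (hstrip hq.1))

end Junction

lemma IsLocalChart.lt_axis {F : ℝ × ℝ → ℝ × ℝ} {κ : SectorType} {S : Set (ℝ × ℝ)} {σ θ₀ d : ℝ}
    {k : ℝ × ℝ → ℝ × ℝ} (hk : IsLocalChart F κ S σ θ₀ d k) {x : ℝ} (hx : x ∈ Ioc (0 : ℝ) 2) :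
    σ * θ₀ < σ * (k (x, 0)).1 := by
  have := hk.axis_mono (by norm_num : (0 : ℝ) ∈ Icc (0 : ℝ) 2) ⟨hx.1.le, hx.2⟩ hx.1
  have hv : k (0, 0) = (θ₀, 0) := hk.vertex
  simpa only [hv] using this

lemma Junction.range₁ {F : ℝ × ℝ → ℝ × ℝ} {κ₁ κ₂ : SectorType} {S₁ S₂ : Set (ℝ × ℝ)} {θ₁ θ₂ d : ℝ}
    {k₁ k₂ : ℝ × ℝ → ℝ × ℝ} {α β l₀ ε₀ : ℝ} {Y : ℝ → ℝ → ℝ} {c c₂ : ℝ} {r₁ r₂ lam : ℝ → ℝ}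
    (J : Junction F κ₁ κ₂ S₁ S₂ θ₁ θ₂ d k₁ k₂ α β l₀ ε₀ Y c c₂ r₁ r₂ lam) {a : ℝ × ℝ}
    (ha : a ∈ bigDisc) : (k₁ a).1 ∈ Ioo (θ₁ - 1) (θ₂ + 1) := by
  have h0 : (0 : ℝ × ℝ) ∈ bigDisc := ⟨by norm_num, le_rfl⟩
  have h1 := (abs_lt.1 (J.chart₁.near a ha)).1
  have h2 := (abs_lt.1 (J.chart₂.near 0 h0)).2
  constructor <;> linarith [J.d_le, J.sep a ha 0 h0]

theorem exists_junction {F : ℝ × ℝ → ℝ × ℝ} (hF : ContDiff ℝ 1 F) (hb : ∀ θ, (F (θ, 0)).2 = 0)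
    {θ₁ θ₂ : ℝ} (hlt : θ₁ < θ₂) (hpos : ∀ θ ∈ Ioo θ₁ θ₂, 0 < (F (θ, 0)).1) {κ₁ κ₂ : SectorType}
    {S₁ S₂ : Set (ℝ × ℝ)} {h₁ h₂ : ℝ × ℝ → ℝ × ℝ} (hs₁ : IsSideSector F κ₁ S₁ 1 θ₁ θ₂ h₁)
    (hs₂ : IsSideSector (-F) κ₂ S₂ (-1) θ₂ θ₁ h₂) :
    ∃ (d : ℝ) (k₁ k₂ : ℝ × ℝ → ℝ × ℝ) (α β l₀ ε₀ : ℝ) (Y : ℝ → ℝ → ℝ) (c c₂ : ℝ)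
      (r₁ r₂ lam : ℝ → ℝ),
      Junction F κ₁ κ₂ S₁ S₂ θ₁ θ₂ d k₁ k₂ α β l₀ ε₀ Y c c₂ r₁ r₂ lam := by
  obtain ⟨μ₁, hμ₁, ε₁, hε₁, hf₁⟩ := hs₁.exists_far
  obtain ⟨μ₂, hμ₂, ε₂, hε₂, hf₂⟩ := hs₂.exists_far
  simp only [one_mul] at hμ₁ hf₁
  -- The bound `1` serves the window of angles, `(θ₂ - θ₁) / 4` separates the charts, and the last
  -- two keep each sector, near `ρ = 0`, away from the opposite chart.
  set d := min (min 1 ((θ₂ - θ₁) / 4)) (min (θ₂ - μ₁) (-μ₂ - θ₁)) with hd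
  have hd0 : 0 < d := lt_min (lt_min one_pos (by linarith)) (lt_min (by linarith) (by linarith))
  have d1 : d ≤ 1 := (min_le_left _ _).trans (min_le_left _ _)
  have d2 : d ≤ (θ₂ - θ₁) / 4 := (min_le_left _ _).trans (min_le_right _ _)
  have d3 : d ≤ θ₂ - μ₁ := (min_le_right _ _).trans (min_le_left _ _)
  have d4 : d ≤ -μ₂ - θ₁ := (min_le_right _ _).trans (min_le_right _ _)
  obtain ⟨k₁, hk₁⟩ := hs₁.exists_isLocalChart hd0
  obtain ⟨k₂, hk₂⟩ := hs₂.exists_isLocalChart hd0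
  have n₁ := fun a ha => abs_lt.1 (hk₁.near a ha)
  have n₂ := fun a ha => abs_lt.1 (hk₂.near a ha)
  have hax : ∀ x ∈ Icc (0 : ℝ) 2, ((x, 0) : ℝ × ℝ) ∈ bigDisc := fun x hx =>
    ⟨by simp only; nlinarith [hx.1, hx.2], le_rfl⟩
  have sep : ∀ a ∈ bigDisc, ∀ b ∈ bigDisc, (k₁ a).1 < (k₂ b).1 := fun a ha b hb => by
    linarith [(n₁ a ha).2, (n₂ b hb).1]
  -- The box starts at position `1/4` on each axis, so that the positions from `1/2` to `3/2` lie in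
  -- its interior.
  set α := (k₁ (1 / 4, 0)).1 with hα
  set β := (k₂ (1 / 4, 0)).1 with hβ
  have hα1 : θ₁ < α := by linarith [hk₁.lt_axis (x := 1 / 4) (by norm_num)]
  have hβ2 : β < θ₂ := by linarith [hk₂.lt_axis (x := 1 / 4) (by norm_num)]
  have h4 := hax (1 / 4) (by norm_num)
  have hαβ : α < β := sep _ h4 _ h4
  obtain ⟨l₀, ε₀, Y, hB⟩ := exists_isFlowBox hF hb hαβ fun θ hθ =>
    hpos θ ⟨hα1.trans_le hθ.1, hθ.2.trans_lt hβ2⟩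
  obtain ⟨c₁, r₁, hn₁⟩ := hk₁.exists_isNormal (Or.inl ⟨rfl, rfl⟩) hB fun R hR => by
    have hR2 : R ∈ Icc (0 : ℝ) 2 := ⟨by linarith [hR.1], by linarith [hR.2]⟩
    have := hk₁.axis_mono (by norm_num : (1 / 4 : ℝ) ∈ Icc (0 : ℝ) 2) hR2 (by linarith [hR.1])
    simp only [one_mul] at this
    exact ⟨this, sep _ (hax R hR2) _ h4⟩
  obtain ⟨c₂, r₂, hn₂⟩ := hk₂.exists_isNormal (Or.inr ⟨rfl, rfl⟩) hB fun R hR => by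
    have hR2 : R ∈ Icc (0 : ℝ) 2 := ⟨by linarith [hR.1], by linarith [hR.2]⟩
    have := hk₂.axis_mono (by norm_num : (1 / 4 : ℝ) ∈ Icc (0 : ℝ) 2) hR2 (by linarith [hR.1])
    simp only [neg_mul, one_mul, neg_lt_neg_iff] at this
    exact ⟨sep _ h4 _ (hax R hR2), this⟩
  obtain ⟨c₁', hc₁', ha₁⟩ := hk₁.exists_avoid hB hn₁
  obtain ⟨c₂', hc₂', ha₂⟩ := hk₂.exists_avoid hB hn₂
  replace hn₁ := hn₁.of_le hc₁'.1 hc₁'.2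
  replace hn₂ := hn₂.of_le hc₂'.1 hc₂'.2
  obtain ⟨c, hc, lam, hl1, hl2, hl3, hl4, hl5⟩ := exists_transition hc₁'.1 hn₁.le hc₂'.1 hn₂.le
    hn₁.cont hn₂.cont hn₁.mono hn₂.mono hn₁.zero hn₂.zero
  refine ⟨d, k₁, k₂, α, β, l₀, ε₀, Y, c, c₂', r₁, r₂, lam, hk₁, hk₂, d1, sep, hB,
    hn₁.of_le hc.1 hc.2, hn₂, hl1, hl2, hl3, hl4, hl5, fun v hv θ hθ a ha ha' he => ?_,
    fun v hv θ hθ a ha ha' he => ?_, ⟨ε₁, hε₁, fun q hq hq' => ?_⟩, ⟨ε₂, hε₂, fun q hq hq' => ?_⟩⟩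
  · simpa using ha₁ v ⟨hv.1, hv.2.trans hc.2⟩ θ hθ a ha ha' he
  · simpa using ha₂ v hv θ hθ a ha ha' he
  · have := hf₁ q hq hq'
    linarith [(n₂ _ (hax (5 / 4) (by norm_num))).1]
  · have := hf₂ q hq hq'
    linarith [(n₁ _ (hax (5 / 4) (by norm_num))).2]

/-! ### Union with a hyperbolic sector -/

/-- The position on the bridge, in terms of the position `R` and the label `v` in a sector. -/
noncomputable def shiftPos (c R v : ℝ) : ℝ := R + 3 * (1 - v / c) * (max R 0 / (|R| + v / c))

section shiftPos
variable {c R R' v : ℝ}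

lemma shiftPos_of_nonpos (h : R ≤ 0) : shiftPos c R v = R := by simp [shiftPos, max_eq_right h]

lemma shiftPos_of_pos (h : 0 < R) :
    shiftPos c R v = R + 3 * (1 - v / c) * (R / (R + v / c)) := by
  simp [shiftPos, max_eq_left h.le, abs_of_pos h]

/-- On label `0` the negative half-axis stays fixed, while the positive one goes to `p = R + 3`,
that is, to the negative half-axis of the second sector. On label `c` the shift vanishes, which fits
with the unchanged first chart at larger labels. -/
lemma shiftPos_zero_right (h : 0 < R) : shiftPos c R 0 = R + 3 := by
  rw [shiftPos_of_pos h]; simp [h.ne']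

lemma shiftPos_self (hc : c ≠ 0) : shiftPos c R c = R := by simp [shiftPos, hc]

lemma div_mem_Icc (hc : 0 < c) (hv : v ∈ Icc 0 c) : v / c ∈ Icc (0 : ℝ) 1 :=
  ⟨div_nonneg hv.1 hc.le, div_le_one_of_le₀ hv.2 hc.le⟩

lemma le_shiftPos (hc : 0 < c) (hv : v ∈ Icc 0 c) : R ≤ shiftPos c R v := by
  have h := div_mem_Icc hc hv
  have : 0 ≤ 3 * (1 - v / c) * (max R 0 / (|R| + v / c)) :=
    mul_nonneg (by linarith [h.2]) (div_nonneg (le_max_right _ _) (by have := h.1; positivity))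
  unfold shiftPos; linarith

lemma shiftPos_le (hc : 0 < c) (hv : v ∈ Icc 0 c) : shiftPos c R v ≤ R + 3 := by
  have h := div_mem_Icc hc hv
  have h1 : max R 0 / (|R| + v / c) ≤ 1 := div_le_one_of_le₀
    (max_le (by linarith [le_abs_self R, h.1]) (by have := h.1; positivity))
    (by have := h.1; positivity)
  have h2 : 0 ≤ max R 0 / (|R| + v / c) :=
    div_nonneg (le_max_right _ _) (by have := h.1; positivity)
  have : (1 - v / c) * (max R 0 / (|R| + v / c)) ≤ 1 :=
    mul_le_one₀ (by linarith [h.1]) h2 h1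
  unfold shiftPos; linarith

lemma shiftPos_lt (hc : 0 < c) (hv : v ∈ Icc 0 c) (hR : R < R') :
    shiftPos c R v < shiftPos c R' v := by
  rcases le_or_gt R 0 with h0 | h0
  · rw [shiftPos_of_nonpos h0]
    exact hR.trans_le (le_shiftPos hc hv)
  have h := div_mem_Icc hc hv
  have h0' := h0.trans hR
  rw [shiftPos_of_pos h0, shiftPos_of_pos h0']
  have h1 : R / (R + v / c) ≤ R' / (R' + v / c) := by
    rw [div_le_div_iff₀ (by linarith [h.1]) (by linarith [h.1])]
    nlinarith [h.1]
  have := mul_le_mul_of_nonneg_left h1 (show 0 ≤ 3 * (1 - v / c) by linarith [h.2])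
  linarith

/-- The denominator `|R| + v / c` vanishes only at `R = v = 0`, the vertex. -/
lemma continuousOn_shiftPos (hc : 0 < c) :
    ContinuousOn (fun q : ℝ × ℝ => shiftPos c q.1 q.2) {q | 0 ≤ q.2 ∧ (0 < q.2 ∨ q.1 ≠ 0)} := by
  unfold shiftPos
  refine ContinuousOn.add (by fun_prop) (ContinuousOn.mul (by fun_prop)
    (ContinuousOn.div (by fun_prop) (by fun_prop) fun q hq => ?_))
  have h1 := abs_nonneg q.1
  have h2 := div_nonneg hq.1 hc.le
  rcases hq.2 with h | h
  · have := div_pos h hc; positivity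
  · have := abs_pos.2 h; positivity

lemma exists_shiftPos_eq (hc : 0 < c) (hv : 0 < v) {B p : ℝ} (hB : 0 ≤ B) (hp : 0 < p)
    (hpB : p ≤ shiftPos c B v) : ∃ R ∈ Ioc 0 B, shiftPos c R v = p := by
  have hcont : ContinuousOn (fun R => shiftPos c R v) (Icc 0 B) :=
    (continuousOn_shiftPos hc).comp (f := fun R : ℝ => (R, v)) (by fun_prop)
      fun R _ => ⟨hv.le, Or.inl hv⟩
  obtain ⟨R, hR, he⟩ := intermediate_value_Icc hB hcont
    (show p ∈ Icc _ _ from ⟨by rw [shiftPos_of_nonpos le_rfl]; exact hp.le, hpB⟩)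
  refine ⟨R, ⟨lt_of_le_of_ne hR.1 fun h => ?_, hR.2⟩, he⟩
  simp only [← h, shiftPos_of_nonpos le_rfl] at he
  exact hp.ne he

end shiftPos

namespace Junction

variable {F : ℝ × ℝ → ℝ × ℝ} {κ₁ : SectorType} {S₁ S₂ : Set (ℝ × ℝ)} {θ₁ θ₂ d : ℝ}
  {k₁ k₂ : ℝ × ℝ → ℝ × ℝ} {α β l₀ ε₀ : ℝ} {Y : ℝ → ℝ → ℝ} {c c₂ : ℝ} {r₁ r₂ lam : ℝ → ℝ}

local notation "Ψ" => bridge κ₁ SectorType.hyperbolic k₁ k₂ Y r₁ lam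
local notation "BOK" => BridgeOK κ₁ SectorType.hyperbolic c lam
local notation "IsJunction" =>
  Junction F κ₁ SectorType.hyperbolic S₁ S₂ θ₁ θ₂ d k₁ k₂ α β l₀ ε₀ Y c c₂ r₁ r₂ lam

/-- The union of a sector with a hyperbolic one. -/
noncomputable def hypUnion (κ₁ : SectorType) (k₁ k₂ : ℝ × ℝ → ℝ × ℝ) (Y : ℝ → ℝ → ℝ) (c : ℝ)
    (r₁ lam : ℝ → ℝ) (b : ℝ × ℝ) : ℝ × ℝ :=
  if c ≤ endLev κ₁ b then k₁ b else
    bridge κ₁ .hyperbolic k₁ k₂ Y r₁ lam (shiftPos c (endPos κ₁ b) (endLev κ₁ b)) (endLev κ₁ b)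

local notation "ψ" => hypUnion κ₁ k₁ k₂ Y c r₁ lam

/-- Shifted positions stay between `-1` and `4`. On label `0` no position in `[0, 3]` occurs, so
both vertices and the arc at infinity are skipped. -/
lemma hyp_ok (J : IsJunction) {b : ℝ × ℝ} (hb : b ∈ halfDisc \ {0}) (hl : endLev κ₁ b ≤ c) :
    BOK (shiftPos c (endPos κ₁ b) (endLev κ₁ b)) (endLev κ₁ b) := by
  have hc4 := J.norm₁.le
  have hc := J.norm₁.pos
  have hE := EndOK.of_mem (κ := κ₁) (halfDisc_subset_bigDisc hb.1) hb.2 (Or.inl (by linarith))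
    ((abs_endPos_le_one hb.1).trans (by norm_num))
  have hR := abs_le.1 (abs_endPos_le_one (κ := κ₁) hb.1)
  set R := endPos κ₁ b
  set v := endLev κ₁ b
  have hv : v ∈ Icc 0 c := ⟨hE.nonneg, hl⟩
  have h1 := le_shiftPos (R := R) J.norm₁.pos hv
  have h2 := shiftPos_le (R := R) J.norm₁.pos hv
  have hlv := J.lam_mem v hv
  have hc2 := J.norm₂.le
  refine ⟨J.level_mem hv, fun h => ⟨⟨hv.1, Or.inl (by linarith), ?_, ?_, ?_⟩,
    Or.inl (by linarith)⟩, fun _ _ => hl, fun h => ⟨⟨hlv.1.1, Or.inl (by linarith [hlv.1.2]), ?_,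
    Or.inl rfl, ?_⟩, Or.inl (by linarith [hlv.1.2])⟩⟩
  · rw [abs_le]; constructor <;> linarith [hR.1]
  · exact hE.pos.imp_right fun h => h.trans_le h1
  · refine hE.ne.imp_right fun hne => ?_
    rcases hne.lt_or_gt with h3 | h3
    · rw [shiftPos_of_nonpos h3.le]; exact h3.ne
    · exact (h3.trans_le h1).ne'
  · rw [abs_le]; constructor <;> linarith [hR.2]
  · rcases hv.1.eq_or_lt with h3 | h3
    · right
      rw [← h3] at h ⊢
      rcases hE.ne with h4 | h4
      · linarith
      rcases h4.lt_or_gt with h4 | h4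
      · rw [shiftPos_of_nonpos h4.le] at h; linarith
      · rw [shiftPos_zero_right h4]; linarith
    · exact Or.inl (J.lam_pos (J.level_mem hv) h3)

lemma hyp_apply (J : IsJunction) {b : ℝ × ℝ} (hb : b ∈ halfDisc \ {0}) (hl : endLev κ₁ b ≤ c) :
    ψ b = Ψ (shiftPos c (endPos κ₁ b) (endLev κ₁ b)) (endLev κ₁ b) := by
  rcases hl.eq_or_lt with h | h
  · have hR := abs_le.1 (abs_endPos_le_one (κ := κ₁) hb.1)
    have hE := endPt_endPos_endLev (κ := κ₁) (halfDisc_subset_bigDisc hb.1) hb.2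
      (Or.inl (by linarith [J.norm₁.le]))
    rw [h] at hE
    simp only [hypUnion, h, le_refl, if_true]
    rw [shiftPos_self J.norm₁.pos.ne', map_left _ hR.2, hE.1]
  · simp [hypUnion, not_le.2 h]

lemma hyp_apply_of_ge {b : ℝ × ℝ} (hl : c ≤ endLev κ₁ b) : ψ b = k₁ b := by
  simp [hypUnion, hl]

lemma hyp_continuousOn (J : IsJunction) : ContinuousOn ψ (halfDisc \ {0}) := by
  have hsub : halfDisc \ {0} ⊆ bigDisc \ {0} := sdiff_subset_sdiff_left halfDisc_subset_bigDisc
  have hlev := (continuousOn_endLev κ₁).mono hsub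
  refine ContinuousOn.of_le_of_ge hlev (a := c) ?_ ?_
  · have hq : ContinuousOn (fun b => (endPos κ₁ b, endLev κ₁ b))
        (halfDisc \ {0} ∩ {b | endLev κ₁ b ≤ c}) :=
      (continuous_endPos κ₁).continuousOn.prodMk (hlev.mono inter_subset_left)
    have hsh : ContinuousOn (fun b => shiftPos c (endPos κ₁ b) (endLev κ₁ b))
        (halfDisc \ {0} ∩ {b | endLev κ₁ b ≤ c}) :=
      (continuousOn_shiftPos J.norm₁.pos).comp hq fun b hb => by
        have hE := endPt_endPos_endLev (κ := κ₁) (hsub hb.1).1 hb.1.2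
          (Or.inl (by have : endLev κ₁ b ≤ c := hb.2; linarith [J.norm₁.le]))
        exact ⟨hE.2.1, hE.2.2.2.1⟩
    exact (J.continuousOn_bridge.comp (hsh.prodMk (hlev.mono inter_subset_left))
      fun b hb => J.hyp_ok hb.1 hb.2).congr fun b hb => J.hyp_apply hb.1 hb.2
  · exact (J.chart₁.cont.mono fun b hb => (hsub hb.1).1).congr fun b hb => hyp_apply_of_ge hb.2

lemma hyp_injOn (J : IsJunction) : InjOn ψ (halfDisc \ {0}) := by
  have hc4 := J.norm₁.le
  -- A point of the first chart with label at least `c` cannot lie on the bridge at label below `c`: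
  -- for `p ≤ 1` the labels differ, and for `p > 1` `notMem₁` applies.
  have key : ∀ b ∈ halfDisc \ {0}, ∀ b' ∈ halfDisc \ {0}, c ≤ endLev κ₁ b → endLev κ₁ b' < c →
      ψ b ≠ ψ b' := by
    intro b hb b' hb' hl hl' he
    rw [hyp_apply_of_ge hl, J.hyp_apply hb' hl'.le] at he
    have hok := J.hyp_ok hb' hl'.le
    rcases le_or_gt (shiftPos c (endPos κ₁ b') (endLev κ₁ b')) 1 with h1 | h1
    · have hE := (hok.left h1).1
      rw [map_left _ h1] at he
      have e := J.chart₁.inj (halfDisc_subset_bigDisc hb.1) hE.mem_bigDisc he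
      rw [e, hE.coords.2.2.2.1 (Or.inl (by linarith))] at hl
      linarith
    · exact J.notMem₁ hok h1 (halfDisc_subset_bigDisc hb.1)
        (abs_le.1 (abs_endPos_le_one (κ := κ₁) hb.1)).2 he
  intro b hb b' hb' he
  rcases le_or_gt c (endLev κ₁ b) with hl | hl <;> rcases le_or_gt c (endLev κ₁ b') with hl' | hl'
  · rw [hyp_apply_of_ge hl, hyp_apply_of_ge hl'] at he
    exact J.chart₁.inj (halfDisc_subset_bigDisc hb.1) (halfDisc_subset_bigDisc hb'.1) he
  · exact absurd he (key b hb b' hb' hl hl')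
  · exact absurd he.symm (key b' hb' b hb hl' hl)
  · rw [J.hyp_apply hb hl.le, J.hyp_apply hb' hl'.le] at he
    obtain ⟨h1, h2⟩ := J.map_inj (J.hyp_ok hb hl.le) (J.hyp_ok hb' hl'.le) he
    have hE := endPt_endPos_endLev (κ := κ₁) (halfDisc_subset_bigDisc hb.1) hb.2
      (Or.inl (by linarith))
    have hE' := endPt_endPos_endLev (κ := κ₁) (halfDisc_subset_bigDisc hb'.1) hb'.2
      (Or.inl (by linarith))
    have hv : endLev κ₁ b ∈ Icc 0 c := ⟨hE.2.1, hl.le⟩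
    rw [← h2] at h1 hE'
    rw [← hE.1, ← hE'.1]
    congr 1
    rcases lt_trichotomy (endPos κ₁ b) (endPos κ₁ b') with h3 | h3 | h3
    · exact absurd h1 (shiftPos_lt J.norm₁.pos hv h3).ne
    · exact h3
    · exact absurd h1 (shiftPos_lt J.norm₁.pos hv h3).ne'

lemma hyp_snd_pos (J : IsJunction) {b : ℝ × ℝ} (hb : b ∈ halfDisc \ {0}) : 0 < (ψ b).2 := by
  have hc4 := J.norm₁.le
  rcases le_or_gt c (endLev κ₁ b) with hl | hl
  · rw [hyp_apply_of_ge hl]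
    refine J.chart₁.pos b (halfDisc_subset_bigDisc hb.1) fun h => ?_
    have e : b = endPt κ₁ b.1 0 := by rw [endPt_zero_right]; exact Prod.ext rfl h.1
    have h0 : 0 < b.1 := lt_of_le_of_ne h.2 fun h0 => hb.2 (Prod.ext h0.symm h.1)
    have h1 : b.1 ≤ 1 := by nlinarith [hb.1.1, h.1]
    have hE : EndOK κ₁ b.1 0 := endOK_of_mem ⟨h0, by linarith⟩ (by norm_num)
    rw [e, hE.coords.2.2.2.1 (Or.inl (by norm_num))] at hl
    exact absurd J.norm₁.pos (not_lt.2 hl)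
  · rw [J.hyp_apply hb hl.le]
    have hE := endPt_endPos_endLev (κ := κ₁) (halfDisc_subset_bigDisc hb.1) hb.2
      (Or.inl (by linarith))
    refine J.snd_pos (J.hyp_ok hb hl.le) ?_
    rcases hE.2.1.eq_or_lt with h | h
    · right
      rw [← h]
      rcases (hE.2.2.2.1.resolve_left (by rw [← h]; exact lt_irrefl _)).lt_or_gt with h' | h'
      · left; rwa [shiftPos_of_nonpos h'.le]
      · right; rw [shiftPos_zero_right h']; linarith
    · exact Or.inl h

lemma hyp_vertex (J : IsJunction) :
    Filter.Tendsto (fun b => (ψ b).2) (𝓝[halfDisc \ {0}] 0) (𝓝 0) := by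
  have hc := J.norm₁.pos
  rw [Metric.tendsto_nhds]
  intro ε hε
  obtain ⟨δ, hδ, hsmall⟩ := J.exists_snd_lt hε
  -- If the label is at least `δ`, the shifted position is at most `R (1 + 3 c / δ)`; this choice
  -- makes it less than `δ`.
  have hδ' : 0 < δ / (1 + 3 * c / δ) := by positivity
  have hδδ : δ / (1 + 3 * c / δ) ≤ δ := div_le_self hδ.le (by
    have : 0 < 3 * c / δ := by positivity
    linarith)
  have hp0 : endPos κ₁ 0 = 0 := by cases κ₁ <;> simp [endPos]
  have h0 : (0 : ℝ × ℝ) ∈ bigDisc := ⟨by norm_num, le_rfl⟩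
  have n1 : ∀ᶠ b in 𝓝[halfDisc \ {0}] (0 : ℝ × ℝ), |endPos κ₁ b| < δ / (1 + 3 * c / δ) :=
    mem_nhdsWithin_of_mem_nhds ((continuous_abs.comp (continuous_endPos κ₁)).continuousAt.eventually
      (Iio_mem_nhds (by simp only [Function.comp, hp0, abs_zero]; exact hδ')))
  have n2 : ∀ᶠ b in 𝓝[halfDisc \ {0}] (0 : ℝ × ℝ), b.2 < δ :=
    mem_nhdsWithin_of_mem_nhds (continuous_snd.continuousAt.eventually (Iio_mem_nhds hδ))
  have n3 : ∀ᶠ b in 𝓝[halfDisc \ {0}] (0 : ℝ × ℝ), (k₁ b).2 < ε :=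
    (((continuous_snd.comp_continuousOn J.chart₁.cont) 0 h0).mono
      (sdiff_subset.trans halfDisc_subset_bigDisc)).eventually
      (Iio_mem_nhds (by simp only [Function.comp, J.chart₁.vertex]; exact hε))
  filter_upwards [n1, n2, n3, self_mem_nhdsWithin] with b b1 b2 b3 hb
  rw [Real.dist_eq, sub_zero, abs_of_pos (J.hyp_snd_pos hb)]
  rcases le_or_gt c (endLev κ₁ b) with hl | hl
  · rwa [hyp_apply_of_ge hl]
  have hE := endPt_endPos_endLev (κ := κ₁) (halfDisc_subset_bigDisc hb.1) hb.2
    (Or.inl (by linarith [J.norm₁.le]))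
  have hok := J.hyp_ok hb hl.le
  rw [J.hyp_apply hb hl.le]
  have hb1 := abs_lt.1 b1
  have hv : endLev κ₁ b ∈ Icc 0 c := ⟨hE.2.1, hl.le⟩
  have l1 := le_shiftPos (R := endPos κ₁ b) hc hv
  have l2 := shiftPos_le (R := endPos κ₁ b) hc hv
  refine hsmall _ _ hok (by linarith) (by linarith) ?_
  by_cases hκ : κ₁ = .hyperbolic
  · subst hκ; exact Or.inl b2
  rcases lt_or_ge (endLev κ₁ b) δ with h | h
  · exact Or.inl h
  refine Or.inr (Or.inl ⟨hκ, ?_⟩)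
  have hR : 0 < endPos κ₁ b := hE.2.2.1.resolve_left hκ
  rw [shiftPos_of_pos hR]
  have hw := div_mem_Icc hc hv
  have hwδ : δ / c ≤ endLev κ₁ b / c := by gcongr
  have hdc : 0 < δ / c := by positivity
  have h1 : endPos κ₁ b / (endPos κ₁ b + endLev κ₁ b / c) ≤ endPos κ₁ b / (δ / c) := by
    gcongr; linarith
  have h2 : 3 * (1 - endLev κ₁ b / c) * (endPos κ₁ b / (endPos κ₁ b + endLev κ₁ b / c)) ≤
      3 * 1 * (endPos κ₁ b / (δ / c)) := by
    refine mul_le_mul (by linarith [hw.1]) h1 (div_nonneg hR.le (by linarith [hw.1])) (by norm_num)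
  have h3 : endPos κ₁ b * (1 + 3 * c / δ) < δ := by
    rw [← lt_div_iff₀ (by positivity)]; exact hb1.2
  have h4 : 3 * 1 * (endPos κ₁ b / (δ / c)) = endPos κ₁ b * (3 * c / δ) := by
    field_simp
  linarith

lemma hyp_arcs (J : IsJunction) {a b : ℝ × ℝ} (ha0 : a ≠ 0)
    (h : Reaches (modelField κ₁) halfDisc a b) :
    Reaches F (ψ '' modelBetween κ₁ a b) (ψ a) (ψ b) := by
  have hc4 := J.norm₁.le
  have hup : ∀ x ∈ halfDisc, 0 ≤ x.2 := fun x hx => hx.2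
  have hup' : ∀ x ∈ bigDisc, 0 ≤ x.2 := fun x hx => hx.2
  have hb0 : b ≠ 0 := fun hb => ha0 ((reaches_model_zero_iff h).2 hb)
  have ha : a ∈ halfDisc \ {0} := ⟨h.left_mem, ha0⟩
  have hb : b ∈ halfDisc \ {0} := ⟨h.right_mem, hb0⟩
  have hbig := h.mono halfDisc_subset_bigDisc
  have hlev := (hbig.modelArc hup' ha0).endLev hbig.left_mem
  have hne : ∀ x ∈ modelBetween κ₁ a b, x ∈ halfDisc \ {0} ∧ endLev κ₁ x = endLev κ₁ a := by
    intro x hx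
    have hx' := hx.1.mono halfDisc_subset_bigDisc
    exact ⟨⟨hx.1.right_mem, fun h0 => ha0 ((reaches_model_zero_iff hx.1).2 h0)⟩,
      ((hx'.modelArc hup' ha0).endLev hx'.left_mem).1.symm⟩
  rcases le_or_gt c (endLev κ₁ a) with hl | hl
  · rw [hyp_apply_of_ge hl, hyp_apply_of_ge (hlev.1 ▸ hl)]
    refine (J.chart₁.arcs a b hbig).mono ?_
    rintro _ ⟨x, hx, rfl⟩
    have hx' := h.model_between hup hup' hx.1 hx.2
    exact ⟨x, hx', hyp_apply_of_ge (by rw [(hne x hx').2]; exact hl)⟩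
  · have hl' : endLev κ₁ b < c := hlev.1 ▸ hl
    have hl2 : endLev κ₁ a < 1 / 2 := by linarith
    have hE := endPt_endPos_endLev (κ := κ₁) (halfDisc_subset_bigDisc ha.1) ha0 (Or.inl hl2)
    have hE' := endPt_endPos_endLev (κ := κ₁) (halfDisc_subset_bigDisc hb.1) hb0
      (Or.inl (by linarith))
    have hok := EndOK.of_mem (κ := κ₁) (halfDisc_subset_bigDisc ha.1) ha0 (Or.inl hl2)
      ((abs_endPos_le_one ha.1).trans (by norm_num))
    have hok' := EndOK.of_mem (κ := κ₁) (halfDisc_subset_bigDisc hb.1) hb0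
      (Or.inl (by linarith)) ((abs_endPos_le_one hb.1).trans (by norm_num))
    have hR := hlev.2 (Or.inl hl2)
    rw [J.hyp_apply ha hl.le, J.hyp_apply hb hl'.le, ← hlev.1]
    rw [← hlev.1] at hE' hok'
    set v := endLev κ₁ a with hvdef
    set R := endPos κ₁ a
    set R' := endPos κ₁ b
    have hv : v ∈ Icc 0 c := ⟨hok.nonneg, hl.le⟩
    have harc := h.modelArc hup ha0
    -- An arc of label `0` cannot pass through the vertex, so its positions have one sign.
    have hsign : 0 < v ∨ 0 < R ∨ R' < 0 := by
      by_contra hcon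
      push Not at hcon
      obtain ⟨h1, h2, h3⟩ := hcon
      have hv0 : v = 0 := le_antisymm h1 hv.1
      have hκ : κ₁ = .hyperbolic := hok.pos.resolve_right (not_lt.2 h2)
      subst hκ
      have := (harc.mem 0 ⟨h2, h3⟩).2
      apply this
      have e : modelLev .hyperbolic a = 0 := hv0
      rw [e]; rfl
    have hbt : ∀ r ∈ Icc R R', endPt κ₁ r v ∈ modelBetween κ₁ a b ∧
        endPos κ₁ (endPt κ₁ r v) = r := by
      intro r hr
      have hr' := hok.mono hok' hsign hr
      have harc' := harc
      rw [← hE.1, ← hE'.1] at harc'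
      have := harc'.endPt_between hok hok' hr' hr.1 hr.2
      rw [hE.1, hE'.1] at this
      exact ⟨this, hr'.coords.2.1⟩
    have hcont : ContinuousOn (fun r => shiftPos c r v) (Icc R R') :=
      (continuousOn_shiftPos J.norm₁.pos).comp (f := fun r : ℝ => (r, v)) (by fun_prop)
        fun r hr => ⟨hv.1, by
          rcases hsign with h | h | h
          exacts [Or.inl h, Or.inr (h.trans_le hr.1).ne', Or.inr (hr.2.trans_lt h).ne]⟩
    have hmon : shiftPos c R v ≤ shiftPos c R' v := by
      rcases hR.eq_or_lt with h | h
      · rw [h]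
      · exact (shiftPos_lt J.norm₁.pos hv h).le
    have hpre : ∀ x ∈ Icc (shiftPos c R v) (shiftPos c R' v), ∃ y ∈ modelBetween κ₁ a b,
        y ∈ halfDisc \ {0} ∧ endLev κ₁ y = v ∧ shiftPos c (endPos κ₁ y) (endLev κ₁ y) = x := by
      intro x hx
      obtain ⟨r, hr, rfl⟩ := intermediate_value_Icc hR hcont hx
      have hy := hbt r hr
      have hy' := hne _ hy.1
      exact ⟨_, hy.1, hy'.1, hy'.2, by rw [hy.2, hy'.2]⟩
    refine (J.arcs hmon (fun x hx => ?_) ?_).mono ?_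
    · obtain ⟨y, -, hy, hyv, hyx⟩ := hpre x hx
      have := J.hyp_ok hy (by rw [hyv]; exact hl.le)
      rwa [hyx, hyv] at this
    · rcases hv.1.eq_or_lt with h0 | h0
      · right
        rw [← h0]
        rcases hsign with h1 | h1 | h1
        · linarith
        · right; rw [shiftPos_zero_right h1]; linarith
        · left; rwa [shiftPos_of_nonpos h1.le]
      · exact Or.inl h0
    · rintro _ ⟨x, hx, rfl⟩
      obtain ⟨y, hym, hy, hyv, hyx⟩ := hpre x hx
      refine ⟨y, hym, ?_⟩
      rw [J.hyp_apply hy (by rw [hyv]; exact hl.le), hyx, hyv]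

lemma hyp_apply_endPt (J : IsJunction) {R v : ℝ} (h : EndOK κ₁ R v) (hv : v < c) (hR : |R| ≤ 1)
    (hκ : κ₁ = .hyperbolic → R ^ 2 + v ^ 2 ≤ 1) :
    endPt κ₁ R v ∈ halfDisc \ {0} ∧ ψ (endPt κ₁ R v) = Ψ (shiftPos c R v) v ∧
      BOK (shiftPos c R v) v := by
  have hco := h.coords
  have hl := hco.2.2.2.1 (Or.inl (by linarith [J.norm₁.le]))
  have hm : endPt κ₁ R v ∈ halfDisc \ {0} := by
    refine ⟨⟨?_, hco.1⟩, h.endPt_ne_zero⟩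
    by_cases hk : κ₁ = .hyperbolic
    · subst hk; exact hκ rfl
    · rw [hco.2.2.2.2 hk]; exact (sq_le_one_iff_abs_le_one R).2 hR
  have h1 := J.hyp_apply hm (by rw [hl]; exact hv.le)
  have h2 := J.hyp_ok hm (by rw [hl]; exact hv.le)
  rw [hco.2.1, hl] at h1 h2
  exact ⟨hm, h1, h2⟩

/-- For `v / c ≤ 1/10` the position `9/10` is shifted to at least `0.9 + 3 · 0.9 · 0.9 > 13/4`, and
points with `R ≤ 9/10` and such labels lie in the half disc. The value `13/4` leaves a margin of
`1/4` beyond the second vertex. -/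
lemma hyp_exists_eq (J : IsJunction) {p v : ℝ} (hp : p ∈ Ioc (0 : ℝ) (13 / 4))
    (hv : v ∈ Ioo 0 (c / 10)) : ∃ b ∈ halfDisc \ {0}, ψ b = Ψ p v ∧ BOK p v := by
  have hc := J.norm₁.pos
  have hw : v / c ≤ 1 / 10 := by rw [div_le_iff₀ hc]; linarith [hv.2]
  have hw0 : 0 < v / c := div_pos hv.1 hc
  obtain ⟨R, hR, he⟩ := exists_shiftPos_eq hc hv.1 (B := 9 / 10) (by norm_num) hp.1 (by
    rw [shiftPos_of_pos (by norm_num)]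
    have h1 : (9 / 10 : ℝ) ≤ 9 / 10 / (9 / 10 + v / c) := by
      rw [le_div_iff₀ (by positivity)]; linarith
    have := mul_le_mul (show 3 * (9 / 10) ≤ 3 * (1 - v / c) by linarith) h1 (by norm_num)
      (by linarith)
    linarith [hp.2])
  have hvc : v < c := by linarith [hv.2]
  have hv4 : v ≤ 1 / 40 := by linarith [hv.2, J.norm₁.le]
  have hR1 : |R| ≤ 1 := by rw [abs_of_pos hR.1]; linarith [hR.2]
  obtain ⟨h1, h2, h3⟩ := J.hyp_apply_endPt (R := R) (v := v)
    (endOK_of_mem ⟨hR.1, by linarith [hR.2]⟩ ⟨hv.1.le, by linarith⟩) hvc hR1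
    (fun _ => by nlinarith [hR.1, hR.2, hv.1])
  rw [he] at h2 h3
  exact ⟨_, h1, h2, h3⟩

lemma hyp_cover (J : IsJunction) : ∃ ε > 0,
    ∀ q ∈ S₁ ∪ S₂ ∪ Icc (k₁ (5 / 4, 0)).1 (k₂ (5 / 4, 0)).1 ×ˢ Ici (0 : ℝ), 0 < q.2 → q.2 < ε →
      q ∈ ψ '' (halfDisc \ {0}) := by
  have hc := J.norm₁.pos
  have hc4 := J.norm₁.le
  have hcm : c / 10 ∈ Icc 0 c := ⟨by positivity, by linarith⟩
  have hlc := J.lam_pos (J.level_mem hcm) (by positivity)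
  obtain ⟨ε₁, hε₁, h1⟩ := J.cover (c' := c / 10) ⟨by positivity, by linarith⟩
  -- In the hyperbolic half disc `ρ` vanishes only on the nonnegative half-axis, so low points have
  -- abscissa above `-1/4` and a small ordinate.
  obtain ⟨ε₂, hε₂, h2⟩ := isCompact_halfDisc.exists_of_eventually_of_eq_zero
    (g := fun a => (k₂ a).2) (p := fun a => -(1 / 4) < a.1 ∧ a.2 < lam (c / 10))
    ((continuous_snd.comp_continuousOn J.chart₂.cont).mono halfDisc_subset_bigDisc)
    (fun a ha => J.chart₂.snd_nonneg (halfDisc_subset_bigDisc ha)) (fun a ha h0 => by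
      obtain ⟨e, hx⟩ := J.chart₂.eq_of_snd_eq_zero (halfDisc_subset_bigDisc ha) h0
      refine mem_nhdsWithin_of_mem_nhds (Filter.Eventually.and
        (continuous_fst.continuousAt.eventually (Ioi_mem_nhds ?_))
        (continuous_snd.continuousAt.eventually (Iio_mem_nhds ?_)))
      · linarith [hx.1]
      · rw [e]; exact hlc)
  refine ⟨min ε₁ ε₂, lt_min hε₁ hε₂, fun q hq hq0 hqε => ?_⟩
  rcases h1 q hq hq0 (hqε.trans_le (min_le_left _ _)) with ⟨a, ha, rfl⟩ | ⟨a, ha, rfl⟩ |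
    ⟨p, hp, v, hv, rfl⟩
  · have ha0 : a ≠ 0 := by
      rintro rfl
      rw [J.chart₁.vertex] at hq0
      exact lt_irrefl _ hq0
    rcases le_or_gt c (endLev κ₁ a) with hl | hl
    · exact ⟨a, ⟨ha, ha0⟩, hyp_apply_of_ge hl⟩
    have hl2 : endLev κ₁ a < 1 / 2 := by linarith
    have hR1 := abs_endPos_le_one (κ := κ₁) ha
    have hE := endPt_endPos_endLev (κ := κ₁) (halfDisc_subset_bigDisc ha) ha0 (Or.inl hl2)
    have happ := J.hyp_apply ⟨ha, ha0⟩ hl.le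
    set R := endPos κ₁ a with hRdef
    set v := endLev κ₁ a with hvdef
    rcases le_or_gt R 0 with hR | hR
    · rw [shiftPos_of_nonpos hR, map_left _ (by linarith), hE.1] at happ
      exact ⟨a, ⟨ha, ha0⟩, happ⟩
    have hv0 : 0 < v := by
      refine lt_of_le_of_ne hE.2.1 fun h => ?_
      rw [← h, endPt_zero_right] at hE
      rw [← hE.1, J.chart₁.axis R ⟨hR.le, by linarith [(abs_le.1 hR1).2]⟩] at hq0
      exact lt_irrefl _ hq0
    -- The shift never decreases a position, so the position `R` has a preimage `R₀ ≤ R`, which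
    -- stays in the half disc.
    obtain ⟨R₀, hR₀, he⟩ := exists_shiftPos_eq hc hv0 hR.le hR
      (le_shiftPos hc ⟨hv0.le, hl.le⟩)
    have hRle := (abs_le.1 hR1).2
    obtain ⟨m1, m2, -⟩ := J.hyp_apply_endPt (R := R₀) (v := v)
      (endOK_of_mem ⟨hR₀.1, by linarith [hR₀.2]⟩ ⟨hv0.le, hl2.le⟩) hl
      (by rw [abs_of_pos hR₀.1]; exact hR₀.2.trans hRle) (fun hκ => by
        have h3 : R ^ 2 + v ^ 2 ≤ 1 := by
          have := ha.1
          rw [hRdef, hvdef]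
          subst hκ
          exact this
        nlinarith [hR₀.1, hR₀.2])
    exact ⟨_, m1, by rw [m2, he, map_left _ hRle, hE.1]⟩
  · obtain ⟨b1, b2⟩ := h2 a ha (hqε.trans_le (min_le_right _ _))
    have ha1 : a.1 ≤ 1 := by nlinarith [ha.1, sq_nonneg a.2]
    rcases ha.2.eq_or_lt with h0 | h0
    · have ha10 : a.1 < 0 := by
        by_contra hcon
        have := J.chart₂.axis a.1 ⟨not_lt.1 hcon, by linarith⟩
        rw [show (a.1, (0 : ℝ)) = a from Prod.ext rfl h0] at this
        exact hq0.ne' this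
      -- A point of the second negative half-axis: it comes from the positive half-axis of the
      -- model, where `3 - (R + 3) = -R`.
      obtain ⟨m1, m2, m3⟩ := J.hyp_apply_endPt (R := -a.1) (v := 0)
        (endOK_of_mem ⟨by linarith, by linarith⟩ (by norm_num)) hc
        (by rw [abs_of_pos (by linarith)]; linarith) (fun _ => by nlinarith)
      rw [shiftPos_zero_right (by linarith)] at m2 m3
      refine ⟨_, m1, ?_⟩
      rw [m2, J.map_right m3 (by linarith), J.lam_zero]
      congr 1
      exact Prod.ext (by simp [endPt]) h0
    · obtain ⟨v, hv, hva⟩ := intermediate_value_Ioo hcm.1 (J.lam_cont.mono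
        (Icc_subset_Icc_right (J.level_mem hcm).2))
        (show a.2 ∈ Ioo (lam 0) (lam (c / 10)) by rw [J.lam_zero]; exact ⟨h0, b2⟩)
      obtain ⟨b, hb, he, hok⟩ := J.hyp_exists_eq (p := 3 - a.1) (v := v)
        ⟨by linarith, by linarith⟩ hv
      refine ⟨b, hb, ?_⟩
      rw [he, J.map_right hok (by linarith), hva, sub_sub_cancel]
      rfl
  · obtain ⟨b, hb, he, -⟩ := J.hyp_exists_eq (p := p) ⟨by linarith [hp.1], by linarith [hp.2]⟩ hv
    exact ⟨b, hb, he⟩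

theorem hyp_isUnion (J : IsJunction) : IsUnion F θ₁ θ₂ κ₁
    (S₁ ∪ S₂ ∪ Icc (k₁ (5 / 4, 0)).1 (k₂ (5 / 4, 0)).1 ×ˢ Ici (0 : ℝ)) ψ where
  continuousOn := J.hyp_continuousOn
  vertex := J.hyp_vertex
  injOn := J.hyp_injOn
  pos _ ha := J.hyp_snd_pos ha
  range a ha := by
    rcases le_or_gt c (endLev κ₁ a) with hl | hl
    · rw [hyp_apply_of_ge hl]; exact J.range₁ (halfDisc_subset_bigDisc ha.1)
    · rw [J.hyp_apply ha hl.le]; exact J.range (J.hyp_ok ha hl.le)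
  arcs _ _ ha h := J.hyp_arcs ha h
  subset a ha := by
    rcases le_or_gt c (endLev κ₁ a) with hl | hl
    · rw [hyp_apply_of_ge hl]
      exact Or.inl (Or.inl (J.chart₁.subset _ (halfDisc_subset_bigDisc ha.1)))
    · rw [J.hyp_apply ha hl.le]; exact J.subset (J.hyp_ok ha hl.le)
  cover := J.hyp_cover

end Junction

/-! ### Union of two parabolic sectors -/

/-- The amount by which trajectories near the boundary of an elliptic sector are cut. -/
noncomputable def cutWidth (v : ℝ) : ℝ := max 0 (min 1 (2 - 2 * v))

/-- The position on a trajectory after the cut. -/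
noncomputable def cutPos (ξ v : ℝ) : ℝ := if ξ ≤ 0 then ξ - cutWidth v else ξ + cutWidth v

/-- An increasing bijection of the line onto the interval from `0` to `3`. -/
noncomputable def squeeze (ξ : ℝ) : ℝ := 3 / 2 * (1 + ξ / (1 + |ξ|))

lemma cutWidth_nonneg (v : ℝ) : 0 ≤ cutWidth v := le_max_left _ _

lemma cutWidth_le (v : ℝ) : cutWidth v ≤ 1 := max_le zero_le_one (min_le_left _ _)

lemma cutWidth_of_ge {v : ℝ} (h : 1 ≤ v) : cutWidth v = 0 :=
  max_eq_left ((min_le_right _ _).trans (by linarith))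

lemma cutWidth_of_le {v : ℝ} (h : v ≤ 1 / 2) : cutWidth v = 1 := by
  rw [cutWidth, min_eq_left (by linarith), max_eq_right zero_le_one]

lemma cutPos_lt {ξ ξ' v : ℝ} (h : ξ < ξ') : cutPos ξ v < cutPos ξ' v := by
  have := cutWidth_nonneg v
  unfold cutPos
  split_ifs <;> linarith

lemma abs_le_abs_cutPos (ξ v : ℝ) : |ξ| + cutWidth v = |cutPos ξ v| := by
  have := cutWidth_nonneg v
  unfold cutPos
  split_ifs with h
  · rw [abs_of_nonpos h, abs_of_nonpos (by linarith)]; ring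
  · have h := not_le.1 h
    rw [abs_of_pos h, abs_of_pos (by linarith)]

/-- The jump at `ξ = 0` is invisible outside the unit disc: there `ξ = 0` forces `v ≥ 1`, where the
width of the cut is `0`. -/
lemma continuousOn_cutPos :
    ContinuousOn (fun q : ℝ × ℝ => cutPos q.1 q.2) {q | 0 ≤ q.2 ∧ 1 ≤ q.1 ^ 2 + q.2 ^ 2} := by
  have hw : Continuous fun q : ℝ × ℝ => cutWidth q.2 := by unfold cutWidth; fun_prop
  refine ContinuousOn.of_le_of_ge (g := Prod.fst) (a := 0) continuous_fst.continuousOn ?_ ?_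
  · refine (continuous_fst.sub hw).continuousOn.congr fun q hq => ?_
    show cutPos q.1 q.2 = q.1 - cutWidth q.2
    simp only [cutPos, if_pos (show q.1 ≤ 0 from hq.2)]
  · refine (continuous_fst.add hw).continuousOn.congr fun q hq => ?_
    show cutPos q.1 q.2 = q.1 + cutWidth q.2
    have h0 : 0 ≤ q.1 := hq.2
    rcases h0.eq_or_lt with h | h
    · have h1 : 1 ≤ q.2 := by
        have := hq.1.2
        rw [← h] at this
        nlinarith [hq.1.1]
      simp only [cutPos, ← h, le_refl, if_true, cutWidth_of_ge h1]
      ring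
    · simp only [cutPos, if_neg (not_le.2 h)]

lemma squeeze_of_nonpos {ξ : ℝ} (h : ξ ≤ 0) : squeeze ξ = 3 / 2 / (1 - ξ) := by
  have : 1 - ξ ≠ 0 := by linarith
  rw [squeeze, abs_of_nonpos h, ← sub_eq_add_neg]
  field_simp
  ring

lemma squeeze_of_nonneg {ξ : ℝ} (h : 0 ≤ ξ) : squeeze ξ = 3 - 3 / 2 / (1 + ξ) := by
  have : 1 + ξ ≠ 0 := by linarith
  rw [squeeze, abs_of_nonneg h]
  field_simp
  ring

lemma squeeze_mem (ξ : ℝ) : squeeze ξ ∈ Ioo (0 : ℝ) 3 := by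
  rcases le_total ξ 0 with h | h
  · rw [squeeze_of_nonpos h]
    have h1 : 0 < 1 - ξ := by linarith
    exact ⟨by positivity, by rw [div_lt_iff₀ h1]; linarith⟩
  · rw [squeeze_of_nonneg h]
    have h1 : 0 < 1 + ξ := by linarith
    have h2 : 3 / 2 / (1 + ξ) < 3 := by rw [div_lt_iff₀ h1]; linarith
    have h3 : 0 < 3 / 2 / (1 + ξ) := by positivity
    constructor <;> linarith

lemma continuous_squeeze : Continuous squeeze := by
  unfold squeeze
  exact continuous_const.mul (continuous_const.add (continuous_id.div (by fun_prop)
    fun ξ => by positivity))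

lemma exists_squeeze_eq {p : ℝ} (hp : p ∈ Ioo (0 : ℝ) 3) : ∃ ξ, squeeze ξ = p ∧
    (p ≤ 1 / 2 → ξ ≤ -2) ∧ (5 / 2 ≤ p → 2 ≤ ξ) := by
  rcases le_total p (3 / 2) with h | h
  · have e : 1 - (1 - 3 / 2 / p) = 3 / 2 / p := by ring
    have h0 : 1 ≤ 3 / 2 / p := by rw [le_div_iff₀ hp.1]; linarith
    refine ⟨1 - 3 / 2 / p, ?_, fun h' => ?_, fun h' => by linarith⟩
    · rw [squeeze_of_nonpos (by linarith), e, div_div_cancel₀ (by norm_num)]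
    · have : 3 ≤ 3 / 2 / p := by rw [le_div_iff₀ hp.1]; linarith
      linarith
  · have hp3 : 0 < 3 - p := by linarith [hp.2]
    have e : 1 + (3 / 2 / (3 - p) - 1) = 3 / 2 / (3 - p) := by ring
    have h0 : 1 ≤ 3 / 2 / (3 - p) := by rw [le_div_iff₀ hp3]; linarith
    refine ⟨3 / 2 / (3 - p) - 1, ?_, fun h' => by linarith, fun h' => ?_⟩
    · rw [squeeze_of_nonneg (by linarith), e, div_div_cancel₀ (by norm_num)]; ring
    · have : 3 ≤ 3 / 2 / (3 - p) := by rw [le_div_iff₀ hp3]; linarith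
      linarith

lemma squeeze_lt {ξ ξ' : ℝ} (h : ξ < ξ') : squeeze ξ < squeeze ξ' := by
  rcases le_total ξ' 0 with h1 | h1
  · rw [squeeze_of_nonpos h1, squeeze_of_nonpos (h.le.trans h1)]
    exact div_lt_div_of_pos_left (by norm_num) (by linarith) (by linarith)
  rcases le_total 0 ξ with h2 | h2
  · rw [squeeze_of_nonneg h1, squeeze_of_nonneg h2]
    have : 3 / 2 / (1 + ξ') < 3 / 2 / (1 + ξ) :=
      div_lt_div_of_pos_left (by norm_num) (by linarith) (by linarith)
    linarith
  · rw [squeeze_of_nonneg h1, squeeze_of_nonpos h2]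
    have e1 : 3 / 2 / (1 + ξ') ≤ 3 / 2 := div_le_self (by norm_num) (by linarith)
    have e2 : 3 / 2 / (1 - ξ) ≤ 3 / 2 := div_le_self (by norm_num) (by linarith)
    rcases h2.eq_or_lt with h3 | h3
    · have : 3 / 2 / (1 + ξ') < 3 / 2 := div_lt_self (by norm_num) (by linarith)
      linarith
    · have : 3 / 2 / (1 - ξ) < 3 / 2 := div_lt_self (by norm_num) (by linarith)
      linarith

lemma squeeze_near {δ ξ : ℝ} (hδ : 0 < δ) (h : 2 / δ ≤ |ξ|) : squeeze ξ < δ ∨ 3 - δ < squeeze ξ := by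
  have h1 : 3 / 2 / (1 + |ξ|) < δ := by
    rw [div_lt_iff₀ (by positivity)]
    rw [div_le_iff₀ hδ] at h
    linarith
  rcases le_total ξ 0 with h2 | h2
  · left; rw [squeeze_of_nonpos h2]; rwa [abs_of_nonpos h2] at h1
  · right; rw [squeeze_of_nonneg h2]; rw [abs_of_nonneg h2] at h1; linarith

/-- Near the line `ρ = 0` a parabolic sector consists of points close to the vertex and of points
on trajectories close to the line. -/
lemma IsLocalChart.exists_parabolic_small {F : ℝ × ℝ → ℝ × ℝ} {S : Set (ℝ × ℝ)} {σ θ₀ d : ℝ}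
    {k : ℝ × ℝ → ℝ × ℝ} (hk : IsLocalChart F .parabolic S σ θ₀ d k) {η : ℝ} (hη : 0 < η) :
    ∃ ε > 0, ∀ a ∈ halfDisc, (k a).2 < ε →
      endPos .parabolic a < 1 / 2 ∨ endLev .parabolic a < η := by
  refine isCompact_halfDisc.exists_of_eventually_of_eq_zero
    ((continuous_snd.comp_continuousOn hk.cont).mono halfDisc_subset_bigDisc)
    (fun a ha => hk.snd_nonneg (halfDisc_subset_bigDisc ha)) fun a ha h0 => ?_
  obtain ⟨e, hx⟩ := hk.eq_of_snd_eq_zero (halfDisc_subset_bigDisc ha) h0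
  rcases hx.1.eq_or_lt with hx0 | hx0
  · have h1 : endPos .parabolic a < 1 / 2 := by
      rw [e, ← hx0]; simp [endPos]
    filter_upwards [mem_nhdsWithin_of_mem_nhds ((continuous_endPos .parabolic).continuousAt.eventually
      (Iio_mem_nhds h1))] with b hb using Or.inl hb
  · have hx1 : a.1 ≤ 1 := by nlinarith [ha.1, sq_nonneg a.2]
    have hok : EndOK .parabolic a.1 0 := endOK_of_mem ⟨hx0, by linarith⟩ (by norm_num)
    have hl := hok.coords.2.2.2.1 (Or.inr rfl)
    have hne := hok.endPt_ne_zero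
    rw [endPt_zero_right, ← e] at hl hne
    have h2 : ∀ᶠ b in 𝓝[bigDisc \ {0}] a, endLev .parabolic b < η :=
      (continuousOn_endLev .parabolic _ ⟨halfDisc_subset_bigDisc ha, hne⟩).eventually
        (Iio_mem_nhds (by rw [hl]; exact hη))
    have h3 : 𝓝[halfDisc] a ≤ 𝓝[bigDisc \ {0}] a := by
      refine nhdsWithin_le_iff.2 ?_
      filter_upwards [self_mem_nhdsWithin, mem_nhdsWithin_of_mem_nhds
        (isOpen_compl_singleton.mem_nhds hne)] with b b1 b2 using ⟨halfDisc_subset_bigDisc b1, b2⟩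
    filter_upwards [h3 h2] with b hb using Or.inr hb

/-- Under `-1/z` the punctured half disc becomes the closed upper half plane outside the open unit
disc. Lines of height below `1` are split into two pieces, which will lie in different parabolic
sectors if they are low enough. -/
lemma model_elliptic_mem {a : ℝ × ℝ} (ha : a ∈ halfDisc \ {0}) :
    0 ≤ modelLev .elliptic a ∧
      modelPos .elliptic a ^ 2 + modelLev .elliptic a ^ 2 = (a.1 ^ 2 + a.2 ^ 2)⁻¹ ∧
      1 ≤ modelPos .elliptic a ^ 2 + modelLev .elliptic a ^ 2 := by
  have hn := normSq_pos ha.2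
  have e : modelPos .elliptic a ^ 2 + modelLev .elliptic a ^ 2 = (a.1 ^ 2 + a.2 ^ 2)⁻¹ := by
    simp only [modelPos, modelLev]; field_simp
  refine ⟨div_nonneg ha.1.2 hn.le, e, ?_⟩
  rw [e]; exact (one_le_inv₀ hn).2 ha.1.1

lemma modelPt_elliptic_mem {ξ v : ℝ} (hv : 0 ≤ v) (h : 1 ≤ ξ ^ 2 + v ^ 2) :
    modelPt .elliptic ξ v ∈ halfDisc \ {0} := by
  have h0 : 0 < ξ ^ 2 + v ^ 2 := by linarith
  have e : (-ξ / (ξ ^ 2 + v ^ 2)) ^ 2 + (v / (ξ ^ 2 + v ^ 2)) ^ 2 = (ξ ^ 2 + v ^ 2)⁻¹ := by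
    field_simp
  refine ⟨⟨?_, div_nonneg hv h0.le⟩, fun h1 => ?_⟩
  · simp only [modelPt, e]; exact inv_le_one_of_one_le₀ h
  · have h1 : modelPt .elliptic ξ v = 0 := h1
    simp only [modelPt, Prod.mk_eq_zero] at h1
    rw [h1.1, h1.2] at e
    have := inv_pos.2 h0
    rw [← e] at this
    norm_num at this

lemma one_le_of_modelPt_mem {ξ v : ℝ} (h : modelPt .elliptic ξ v ∈ halfDisc)
    (h0 : modelPt .elliptic ξ v ≠ 0) : 1 ≤ ξ ^ 2 + v ^ 2 := by
  have hn := normSq_pos h0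
  have hp : ξ ^ 2 + v ^ 2 ≠ 0 := fun hp => h0 (by simp [modelPt, hp])
  have e : (-ξ / (ξ ^ 2 + v ^ 2)) ^ 2 + (v / (ξ ^ 2 + v ^ 2)) ^ 2 = (ξ ^ 2 + v ^ 2)⁻¹ := by
    field_simp
  have h1 := h.1
  simp only [modelPt, e] at h1 hn
  exact (inv_le_one₀ (inv_pos.1 hn)).1 h1

/-- The label on the bridge, in terms of the label in the elliptic model. -/
noncomputable def parLev (c v : ℝ) : ℝ := 2 / (1 + 4 / c * v)

lemma parLev_mem {c v : ℝ} (hc : 0 < c) (hv : 0 ≤ v) : parLev c v ∈ Ioc (0 : ℝ) 2 := by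
  have : 0 ≤ 4 / c * v := by positivity
  exact ⟨by unfold parLev; positivity, div_le_self two_pos.le (by linarith)⟩

lemma parLev_le {c v : ℝ} (hc : 0 < c) (hv : 1 / 2 ≤ v) : parLev c v ≤ c := by
  have h : 4 / c * (1 / 2) ≤ 4 / c * v := by gcongr
  have h0 : 0 < 1 + 4 / c * v := by positivity
  rw [parLev, div_le_iff₀ h0]
  have : c * (4 / c * (1 / 2)) = 2 := by field_simp; norm_num
  nlinarith

lemma parLev_injOn {c : ℝ} (hc : 0 < c) : InjOn (parLev c) (Ici 0) := by
  intro v hv v' hv' h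
  have hv : 0 ≤ v := hv
  have hv' : 0 ≤ v' := hv'
  have h0 : 0 < 1 + 4 / c * v := by positivity
  have h0' : 0 < 1 + 4 / c * v' := by positivity
  rw [parLev, parLev, div_eq_div_iff h0.ne' h0'.ne'] at h
  have : 4 / c * (v' - v) = 0 := by linarith
  rcases mul_eq_zero.1 this with h1 | h1
  · exact absurd h1 (by positivity)
  · linarith

/-- The threshold is `parLev c 1`. As `parLev` is decreasing, labels below it come from heights `v ≥
1`, that is, from lines that the unit disc does not split. -/
lemma exists_parLev_eq {c y : ℝ} (hc : 0 < c) (hy : y ∈ Ioc (0 : ℝ) 2) :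
    ∃ v, 0 ≤ v ∧ parLev c v = y ∧ (y ≤ 2 / (1 + 4 / c) → 1 ≤ v) := by
  have h1 : 1 ≤ 2 / y := by rw [le_div_iff₀ hy.1]; linarith [hy.2]
  refine ⟨(2 / y - 1) / (4 / c), div_nonneg (by linarith) (by positivity), ?_, fun h => ?_⟩
  · rw [parLev, mul_div_cancel₀ _ (by positivity), add_sub_cancel, div_div_cancel₀ two_ne_zero]
  · rw [le_div_iff₀ (by positivity), one_mul, le_sub_iff_add_le, le_div_iff₀ hy.1]
    rw [le_div_iff₀ (by positivity)] at h
    linarith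

namespace Junction

variable {F : ℝ × ℝ → ℝ × ℝ} {S₁ S₂ : Set (ℝ × ℝ)} {θ₁ θ₂ d : ℝ}
  {k₁ k₂ : ℝ × ℝ → ℝ × ℝ} {α β l₀ ε₀ : ℝ} {Y : ℝ → ℝ → ℝ} {c c₂ : ℝ} {r₁ r₂ lam : ℝ → ℝ}

local notation "Ψ" => bridge SectorType.parabolic SectorType.parabolic k₁ k₂ Y r₁ lam
local notation "BOK" => BridgeOK SectorType.parabolic SectorType.parabolic c lam
local notation "IsJunction" => Junction F SectorType.parabolic SectorType.parabolic
  S₁ S₂ θ₁ θ₂ d k₁ k₂ α β l₀ ε₀ Y c c₂ r₁ r₂ lam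

/-- The union of two parabolic sectors. -/
noncomputable def parUnion (k₁ k₂ : ℝ × ℝ → ℝ × ℝ) (Y : ℝ → ℝ → ℝ) (c : ℝ)
    (r₁ lam : ℝ → ℝ) (a : ℝ × ℝ) : ℝ × ℝ :=
  bridge .parabolic .parabolic k₁ k₂ Y r₁ lam
    (squeeze (cutPos (modelPos .elliptic a) (modelLev .elliptic a))) (parLev c (modelLev .elliptic a))

local notation "ψ" => parUnion k₁ k₂ Y c r₁ lam

lemma par_ok_of (J : IsJunction) {p y : ℝ} (hp : p ∈ Ioo (0 : ℝ) 3) (hy : y ∈ Ioc (0 : ℝ) 2)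
    (h : 1 ≤ p → p ≤ 2 → y ≤ c) : BOK p y := by
  have hy' : y ∈ Icc (0 : ℝ) 2 := ⟨hy.1.le, hy.2⟩
  have hl : lam y ≤ 2 := by
    have := J.lam_mono.monotoneOn hy' ⟨two_pos.le, le_rfl⟩ hy.2
    rwa [J.lam_two] at this
  refine ⟨hy', fun h1 => ⟨⟨hy.1.le, Or.inr ⟨rfl, hy.2⟩, ?_, Or.inr hp.1, Or.inl hy.1⟩, Or.inr rfl⟩,
    h, fun h2 => ⟨⟨J.lam_nonneg hy', Or.inr ⟨rfl, hl⟩, ?_, Or.inr (by linarith [hp.2]),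
      Or.inl (J.lam_pos hy' hy.1)⟩, Or.inr rfl⟩⟩
  · rw [abs_of_pos hp.1]; linarith
  · rw [abs_of_pos (by linarith [hp.2])]; linarith

/-- If `v ≥ 1/2`, the label is at most `c` and the whole bridge is available. If `v < 1/2`, the cut
has width `1`, so the squeezed position is at most `3/4` or at least `9/4` and stays out of the
middle piece. -/
lemma par_ok (J : IsJunction) (ξ : ℝ) {v : ℝ} (hv : 0 ≤ v) :
    BOK (squeeze (cutPos ξ v)) (parLev c v) := by
  refine J.par_ok_of (squeeze_mem _) (parLev_mem J.norm₁.pos hv) fun h1 h2 => ?_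
  refine parLev_le J.norm₁.pos ?_
  by_contra hcon
  have hcon := not_le.1 hcon
  have h3 := abs_le_abs_cutPos ξ v
  rw [cutWidth_of_le hcon.le] at h3
  have h4 : 1 ≤ |cutPos ξ v| := by linarith [abs_nonneg ξ]
  rcases le_total (cutPos ξ v) 0 with h5 | h5
  · rw [squeeze_of_nonpos h5, le_div_iff₀ (by linarith)] at h1
    rw [abs_of_nonpos h5] at h4
    linarith
  · have : 3 / 2 / (1 + cutPos ξ v) < 1 := by
      rw [abs_of_nonneg h5] at h4
      rw [div_lt_iff₀ (by linarith)]; linarith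
    rw [squeeze_of_nonneg h5] at h2
    linarith

lemma par_ok' (J : IsJunction) {a : ℝ × ℝ} (ha : a ∈ halfDisc \ {0}) :
    BOK (squeeze (cutPos (modelPos .elliptic a) (modelLev .elliptic a)))
      (parLev c (modelLev .elliptic a)) :=
  J.par_ok _ (model_elliptic_mem ha).1

lemma par_apply_modelPt {ξ v : ℝ} (hv : 0 ≤ v) (h : 1 ≤ ξ ^ 2 + v ^ 2) :
    ψ (modelPt .elliptic ξ v) = Ψ (squeeze (cutPos ξ v)) (parLev c v) := by
  have h1 := modelPos_lev_modelPt (κ := .elliptic) (p := ξ) (v := v) ⟨hv, by simp⟩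
    (modelPt_elliptic_mem hv h).2
  rw [parUnion, h1.1, h1.2]

lemma par_continuousOn (J : IsJunction) : ContinuousOn ψ (halfDisc \ {0}) := by
  have hsub : halfDisc \ {0} ⊆ ({0}ᶜ : Set (ℝ × ℝ)) := fun a ha => ha.2
  have hp := (continuousOn_modelPos .elliptic).mono hsub
  have hl := (continuousOn_modelLev .elliptic).mono hsub
  have hcut := continuousOn_cutPos.comp (hp.prodMk hl) fun a ha =>
    ⟨(model_elliptic_mem ha).1, (model_elliptic_mem ha).2.2⟩
  have hlev : ContinuousOn (fun a => parLev c (modelLev .elliptic a)) (halfDisc \ {0}) := by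
    unfold parLev
    refine continuousOn_const.div (continuousOn_const.add (continuousOn_const.mul hl)) fun a ha => ?_
    have := J.norm₁.pos
    have := (model_elliptic_mem ha).1
    positivity
  exact J.continuousOn_bridge.comp ((continuous_squeeze.comp_continuousOn hcut).prodMk hlev)
    fun a ha => J.par_ok' ha

lemma par_snd_pos (J : IsJunction) {a : ℝ × ℝ} (ha : a ∈ halfDisc \ {0}) : 0 < (ψ a).2 :=
  J.snd_pos (J.par_ok' ha) (Or.inl (parLev_mem J.norm₁.pos (model_elliptic_mem ha).1).1)

lemma par_vertex (J : IsJunction) :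
    Filter.Tendsto (fun a => (ψ a).2) (𝓝[halfDisc \ {0}] 0) (𝓝 0) := by
  have hc := J.norm₁.pos
  rw [Metric.tendsto_nhds]
  intro ε hε
  obtain ⟨δ, hδ, hsmall⟩ := J.exists_snd_lt hε
  -- Heights above `V` have label below `δ`; if the height is at most `V`, then near the vertex `|ξ|
  -- ≥ 2/δ`, and the position is within `δ` of `0` or `3`.
  set V := 2 / (4 / c * δ) with hV
  have hM : 0 < V ^ 2 + (2 / δ) ^ 2 := by positivity
  have n1 : ∀ᶠ a in 𝓝[halfDisc \ {0}] (0 : ℝ × ℝ), a.1 ^ 2 + a.2 ^ 2 < (V ^ 2 + (2 / δ) ^ 2)⁻¹ :=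
    mem_nhdsWithin_of_mem_nhds ((isOpen_lt (by fun_prop) (by fun_prop)).mem_nhds (by
      simp only [mem_ofPred_eq, Prod.fst_zero, Prod.snd_zero]
      have := inv_pos.2 hM
      norm_num
      linarith))
  filter_upwards [n1, self_mem_nhdsWithin] with a ha1 ha
  rw [Real.dist_eq, sub_zero, abs_of_pos (J.par_snd_pos ha)]
  have hm := model_elliptic_mem ha
  have hn := normSq_pos ha.2
  set ξ := modelPos .elliptic a with hξ
  set v := modelLev .elliptic a with hv
  have hbig : V ^ 2 + (2 / δ) ^ 2 < ξ ^ 2 + v ^ 2 := by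
    rw [hm.2.1]; exact (lt_inv_comm₀ hn hM).1 ha1
  have hsq := squeeze_mem (cutPos ξ v)
  refine hsmall _ _ (J.par_ok' ha) (by linarith [hsq.1]) (by linarith [hsq.2]) ?_
  rcases lt_or_ge V v with h1 | h1
  · left
    have h0 : 0 < 1 + 4 / c * v := by have := hm.1; positivity
    rw [parLev, div_lt_iff₀ h0]
    rw [hV, div_lt_iff₀ (by positivity)] at h1
    linarith
  · right
    have h2 : 2 / δ ≤ |ξ| := by
      have : v ^ 2 ≤ V ^ 2 := pow_le_pow_left₀ hm.1 h1 2
      have h3 : (2 / δ) ^ 2 ≤ ξ ^ 2 := by linarith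
      have := sq_le_sq.1 h3
      rwa [abs_of_pos (by positivity)] at this
    have h3 := squeeze_near hδ (h2.trans (by
      rw [← abs_le_abs_cutPos ξ v]; linarith [cutWidth_nonneg v] : |ξ| ≤ |cutPos ξ v|))
    exact h3.imp (fun h => ⟨by simp, h⟩) fun h => ⟨by simp, h⟩

lemma par_injOn (J : IsJunction) : InjOn ψ (halfDisc \ {0}) := by
  intro a ha b hb he
  have hma := model_elliptic_mem ha
  have hmb := model_elliptic_mem hb
  obtain ⟨h1, h2⟩ := J.map_inj (J.par_ok' ha) (J.par_ok' hb) he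
  have hv := parLev_injOn J.norm₁.pos hma.1 hmb.1 h2
  refine modelArc_injective ha.2 hb.2 ha.1.2 hb.1.2 hv ?_
  rw [hv] at h1
  rcases lt_trichotomy (modelPos .elliptic a) (modelPos .elliptic b) with h | h | h
  · exact absurd h1 (squeeze_lt (cutPos_lt h)).ne
  · exact h
  · exact absurd h1 (squeeze_lt (cutPos_lt h)).ne'

lemma par_arcs (J : IsJunction) {a b : ℝ × ℝ} (ha0 : a ≠ 0)
    (h : Reaches (modelField .elliptic) halfDisc a b) :
    Reaches F (ψ '' modelBetween .elliptic a b) (ψ a) (ψ b) := by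
  have hup : ∀ x ∈ halfDisc, 0 ≤ x.2 := fun x hx => hx.2
  have harc := h.modelArc hup ha0
  have hma := model_elliptic_mem (a := a) ⟨h.left_mem, ha0⟩
  rw [parUnion, parUnion, ← harc.lev]
  have hmem : ∀ t ∈ Icc (modelPos .elliptic a) (modelPos .elliptic b),
      1 ≤ t ^ 2 + modelLev .elliptic a ^ 2 ∧
        modelPt .elliptic t (modelLev .elliptic a) ∈ modelBetween .elliptic a b := by
    intro t ht
    obtain ⟨h1, h2⟩ := harc.mem t ht
    have hl : IsLev .elliptic (modelLev .elliptic a) := ⟨hma.1, by simp⟩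
    have e := modelPos_lev_modelPt hl h2
    refine ⟨one_le_of_modelPt_mem h1 h2, ModelArc.reaches ⟨ha0, h2, e.2.symm, ?_, ?_⟩
      h.left_mem.2 h1.2, ModelArc.reaches ⟨h2, harc.right, ?_, ?_, ?_⟩ h1.2 h.right_mem.2⟩
    · rw [e.1]; exact ht.1
    · rw [e.1]; exact fun p hp => harc.mem p ⟨hp.1, hp.2.trans ht.2⟩
    · rw [e.2]; exact harc.lev
    · rw [e.1]; exact ht.2
    · rw [e.1, e.2]; exact fun p hp => harc.mem p ⟨ht.1.trans hp.1, hp.2⟩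
  set v := modelLev .elliptic a
  set ξ := modelPos .elliptic a
  set ξ' := modelPos .elliptic b
  have hcont : ContinuousOn (fun t => squeeze (cutPos t v)) (Icc ξ ξ') :=
    continuous_squeeze.comp_continuousOn (continuousOn_cutPos.comp (f := fun t : ℝ => (t, v))
      (by fun_prop) fun t ht => ⟨hma.1, (hmem t ht).1⟩)
  have hle : squeeze (cutPos ξ v) ≤ squeeze (cutPos ξ' v) := by
    rcases harc.pos.eq_or_lt with h | h
    · have h : ξ = ξ' := h
      rw [h]
    · exact (squeeze_lt (cutPos_lt h)).le
  refine (J.arcs hle (fun x hx => ?_) (Or.inl (parLev_mem J.norm₁.pos hma.1).1)).mono ?_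
  · obtain ⟨t, ht, rfl⟩ := intermediate_value_Icc harc.pos hcont hx
    exact J.par_ok t hma.1
  · rintro _ ⟨x, hx, rfl⟩
    obtain ⟨t, ht, rfl⟩ := intermediate_value_Icc harc.pos hcont hx
    exact ⟨_, (hmem t ht).2, par_apply_modelPt hma.1 (hmem t ht).1⟩

lemma par_exists_eq (J : IsJunction) {p y : ℝ} (hp : p ∈ Ioo (0 : ℝ) 3) (hy : y ∈ Ioc (0 : ℝ) 2)
    (h : y ≤ 2 / (1 + 4 / c) ∨ p ≤ 1 / 2 ∨ 5 / 2 ≤ p) :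
    ∃ a ∈ halfDisc \ {0}, ψ a = Ψ p y ∧ BOK p y := by
  obtain ⟨v, hv0, hv, hv1⟩ := exists_parLev_eq J.norm₁.pos hy
  obtain ⟨ξ', hξ', h1, h2⟩ := exists_squeeze_eq hp
  have hw0 := cutWidth_nonneg v
  have hw1 := cutWidth_le v
  -- For `v ≥ 1` there is no cut to undo. Otherwise `|ξ'| ≥ 2`, and undoing a cut of width at most
  -- `1` leaves `|ξ| ≥ 1`, so the point still comes from the half disc.
  obtain ⟨ξ, hξ, hn⟩ : ∃ ξ, cutPos ξ v = ξ' ∧ 1 ≤ ξ ^ 2 + v ^ 2 := by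
    rcases h with h | h | h
    · have := hv1 h
      refine ⟨ξ', by simp [cutPos, cutWidth_of_ge this], by nlinarith [sq_nonneg ξ']⟩
    · have := h1 h
      refine ⟨ξ' + cutWidth v, by rw [cutPos, if_pos (by linarith)]; ring, by nlinarith⟩
    · have := h2 h
      refine ⟨ξ' - cutWidth v, by rw [cutPos, if_neg (by linarith)]; ring, by nlinarith⟩
  have hok := J.par_ok ξ hv0
  have e := par_apply_modelPt (k₁ := k₁) (k₂ := k₂) (Y := Y) (c := c) (r₁ := r₁) (lam := lam) hv0 hn
  rw [hξ, hξ', hv] at hok e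
  exact ⟨_, modelPt_elliptic_mem hv0 hn, e, hok⟩

lemma par_cover (J : IsJunction) : ∃ ε > 0,
    ∀ q ∈ S₁ ∪ S₂ ∪ Icc (k₁ (5 / 4, 0)).1 (k₂ (5 / 4, 0)).1 ×ˢ Ici (0 : ℝ), 0 < q.2 → q.2 < ε →
      q ∈ ψ '' (halfDisc \ {0}) := by
  have hc := J.norm₁.pos
  set c' := 2 / (1 + 4 / c) with hc'
  have hc'0 : 0 < c' := by positivity
  have hc'c : c' ≤ c := by simpa [parLev] using parLev_le (v := 1) hc (by norm_num)
  have hcm : c' ∈ Icc 0 c := ⟨hc'0.le, hc'c⟩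
  have hlc := J.lam_pos (J.level_mem hcm) hc'0
  obtain ⟨ε₁, hε₁, h1⟩ := J.cover (c' := c') ⟨hc'0, hc'c⟩
  obtain ⟨ε₂, hε₂, h2⟩ := J.chart₁.exists_parabolic_small hc'0
  obtain ⟨ε₃, hε₃, h3⟩ := J.chart₂.exists_parabolic_small hlc
  refine ⟨min ε₁ (min ε₂ ε₃), lt_min hε₁ (lt_min hε₂ hε₃), fun q hq hq0 hqε => ?_⟩
  simp only [lt_min_iff] at hqε
  obtain ⟨e1, e2, e3⟩ := hqε
  rcases h1 q hq hq0 e1 with ⟨a, ha, rfl⟩ | ⟨a, ha, rfl⟩ | ⟨p, hp, v, hv, rfl⟩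
  · have ha0 : a ≠ 0 := by
      rintro rfl
      rw [J.chart₁.vertex] at hq0
      exact lt_irrefl _ hq0
    have hs := h2 a ha e2
    have hE := endPt_endPos_endLev (κ := .parabolic) (halfDisc_subset_bigDisc ha) ha0 (Or.inr rfl)
    have hR1 := (abs_le.1 (abs_endPos_le_one (κ := .parabolic) ha)).2
    have hR0 : 0 < endPos .parabolic a := hE.2.2.1.resolve_left (by simp)
    have hy0 : 0 < endLev .parabolic a := by
      refine lt_of_le_of_ne hE.2.1 fun h => ?_
      rw [← h, endPt_zero_right] at hE
      rw [← hE.1, J.chart₁.axis _ ⟨hR0.le, by linarith⟩] at hq0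
      exact lt_irrefl _ hq0
    obtain ⟨b, hb, he, -⟩ := J.par_exists_eq (p := endPos .parabolic a) (y := endLev .parabolic a)
      ⟨hR0, by linarith⟩ ⟨hy0, hE.2.2.2.2.2 rfl⟩ (by
        rcases hs with h | h
        exacts [Or.inr (Or.inl h.le), Or.inl h.le])
    exact ⟨b, hb, by rw [he, map_left _ hR1, hE.1]⟩
  · have ha0 : a ≠ 0 := by
      rintro rfl
      rw [J.chart₂.vertex] at hq0
      exact lt_irrefl _ hq0
    have hs := h3 a ha e3
    have hE := endPt_endPos_endLev (κ := .parabolic) (halfDisc_subset_bigDisc ha) ha0 (Or.inr rfl)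
    have hR1 := (abs_le.1 (abs_endPos_le_one (κ := .parabolic) ha)).2
    have hR0 : 0 < endPos .parabolic a := hE.2.2.1.resolve_left (by simp)
    have hy0 : 0 < endLev .parabolic a := by
      refine lt_of_le_of_ne hE.2.1 fun h => ?_
      rw [← h, endPt_zero_right] at hE
      rw [← hE.1, J.chart₂.axis _ ⟨hR0.le, by linarith⟩] at hq0
      exact lt_irrefl _ hq0
    obtain ⟨y, hy, hye⟩ := intermediate_value_Icc two_pos.le J.lam_cont
      (show endLev .parabolic a ∈ Icc (lam 0) (lam 2) by
        rw [J.lam_zero, J.lam_two]; exact ⟨hy0.le, hE.2.2.2.2.2 rfl⟩)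
    have hypos : 0 < y := by
      refine lt_of_le_of_ne hy.1 fun h => ?_
      rw [← h, J.lam_zero] at hye
      exact hy0.ne hye
    obtain ⟨b, hb, he, hok⟩ := J.par_exists_eq (p := 3 - endPos .parabolic a) (y := y)
      ⟨by linarith, by linarith⟩ ⟨hypos, hy.2⟩ (by
        rcases hs with h | h
        · exact Or.inr (Or.inr (by linarith))
        · rw [← hye, J.lam_mono.lt_iff_lt hy (J.level_mem hcm)] at h
          exact Or.inl h.le)
    exact ⟨b, hb, by rw [he, J.map_right hok (by linarith), hye, sub_sub_cancel, hE.1]⟩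
  · obtain ⟨b, hb, he, -⟩ := J.par_exists_eq (p := p) (y := v)
      ⟨by linarith [hp.1], by linarith [hp.2]⟩
      ⟨hv.1, (hv.2.le.trans hc'c).trans (by linarith [J.norm₁.le])⟩ (Or.inl hv.2.le)
    exact ⟨b, hb, he⟩

theorem par_isUnion (J : IsJunction) : IsUnion F θ₁ θ₂ .elliptic
    (S₁ ∪ S₂ ∪ Icc (k₁ (5 / 4, 0)).1 (k₂ (5 / 4, 0)).1 ×ˢ Ici (0 : ℝ)) ψ where
  continuousOn := J.par_continuousOn
  vertex := J.par_vertex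
  injOn := J.par_injOn
  pos _ ha := J.par_snd_pos ha
  range _ ha := J.range (J.par_ok' ha)
  arcs _ _ ha h := J.par_arcs ha h
  subset _ ha := J.subset (J.par_ok' ha)
  cover := J.par_cover

end Junction

/-! ### Symmetries -/

/-- The image of a field under a linear involution. -/
def conjField (L : ℝ × ℝ →L[ℝ] ℝ × ℝ) (F : ℝ × ℝ → ℝ × ℝ) (q : ℝ × ℝ) : ℝ × ℝ := L (F (L q))

section conjField

variable {L : ℝ × ℝ →L[ℝ] ℝ × ℝ} {F : ℝ × ℝ → ℝ × ℝ}

lemma conjField_conjField (hL : ∀ q, L (L q) = q) : conjField L (conjField L F) = F := by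
  funext q; simp only [conjField, hL]

lemma conjField_neg : conjField L (-F) = -conjField L F := by
  funext q; simp [conjField]

lemma image_image_of_involutive (hL : ∀ q, L (L q) = q) (S : Set (ℝ × ℝ)) : L '' (L '' S) = S := by
  rw [image_image]; simp only [hL, image_id']

lemma Reaches.conj (hL : ∀ q, L (L q) = q) {S : Set (ℝ × ℝ)} {a b : ℝ × ℝ} (h : Reaches F S a b) :
    Reaches (conjField L F) (L '' S) (L a) (L b) :=
  h.map (f := L) (f' := fun _ => L) (g := fun _ => 1) (fun _ _ => L.hasFDerivAt) continuousOn_const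
    (fun _ _ => one_pos) fun q _ => by simp only [conjField, hL, one_smul]

lemma reaches_conj_iff (hL : ∀ q, L (L q) = q) {S : Set (ℝ × ℝ)} {a b : ℝ × ℝ} :
    Reaches (conjField L F) (L '' S) (L a) (L b) ↔ Reaches F S a b := by
  refine ⟨fun h => ?_, fun h => h.conj hL⟩
  have := h.conj hL
  rwa [conjField_conjField hL, image_image_of_involutive hL, hL, hL] at this

lemma IsSectorChart.conj (hL : ∀ q, L (L q) = q) {p : ℝ × ℝ} {κ : SectorType} {S : Set (ℝ × ℝ)}
    {h : ℝ × ℝ → ℝ × ℝ} (hh : IsSectorChart F p κ S h) :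
    IsSectorChart (conjField L F) (L p) κ (L '' S) (fun a => L (h a)) := by
  refine ⟨L.continuous.comp_continuousOn hh.continuousOn, fun a ha b hb he => ?_, ?_,
    congrArg L hh.vertex, ?_⟩
  · refine hh.injOn ha hb ?_
    have := congrArg L he
    rwa [hL, hL] at this
  · rw [← hh.image, image_image]
  · rcases hh.trajectories with ht | ht
    · exact Or.inl fun a ha b hb => (reaches_conj_iff hL).trans (ht a ha b hb)
    · exact Or.inr fun a ha b hb => (reaches_conj_iff hL).trans (ht a ha b hb)

end conjField

/-- The reflection in the second axis. -/
def reflFst : ℝ × ℝ →L[ℝ] ℝ × ℝ :=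
  (-ContinuousLinearMap.fst ℝ ℝ ℝ).prod (ContinuousLinearMap.snd ℝ ℝ ℝ)

/-- The reflection in the first axis. -/
def reflSnd : ℝ × ℝ →L[ℝ] ℝ × ℝ :=
  (ContinuousLinearMap.fst ℝ ℝ ℝ).prod (-ContinuousLinearMap.snd ℝ ℝ ℝ)

@[simp] lemma reflFst_apply (q : ℝ × ℝ) : reflFst q = (-q.1, q.2) := rfl

@[simp] lemma reflSnd_apply (q : ℝ × ℝ) : reflSnd q = (q.1, -q.2) := rfl

lemma reflFst_reflFst (q : ℝ × ℝ) : reflFst (reflFst q) = q := by simp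

lemma reflSnd_reflSnd (q : ℝ × ℝ) : reflSnd (reflSnd q) = q := by simp

lemma collapse_reflFst (q : ℝ × ℝ) : collapse (reflFst q) = reflSnd (collapse q) := by
  simp [collapse]

lemma fderiv_collapse_reflFst (q w : ℝ × ℝ) :
    fderiv ℝ collapse q (reflFst w) = reflSnd (fderiv ℝ collapse (reflFst q) w) := by
  rw [fderiv_collapse, fderiv_collapse]
  simp only [reflFst_apply, reflSnd_apply, Real.cos_neg, Real.sin_neg]
  ext <;> simp only <;> ring

lemma IsSideSector.refl {F : ℝ × ℝ → ℝ × ℝ} {κ : SectorType} {S : Set (ℝ × ℝ)} {σ θ₀ θ' : ℝ}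
    {h : ℝ × ℝ → ℝ × ℝ} (hs : IsSideSector F κ S σ θ₀ θ' h) :
    IsSideSector (conjField reflFst F) κ (reflFst '' S) (-σ) (-θ₀) (-θ')
      (fun a => reflFst (h a)) := by
  refine ⟨?_, hs.chart.conj reflFst_reflFst, fun x hx => ?_, hs.pos, fun x hx => ?_⟩
  · rcases hs.sign with h | h <;> simp [h]
  · simpa using hs.axis x hx
  · have := hs.dir x hx
    simpa [conjField] using this

/-- Reflecting the angle reverses the movement along the arc, and the sign of the field restores its
positive direction. In the plane of `O*` the reflection is `(u, v) ↦ (u, -v)`. -/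
lemma CollapseSetup.refl {F G : ℝ × ℝ → ℝ × ℝ} {θ₁ θ₂ : ℝ} (hs : CollapseSetup F G θ₁ θ₂) :
    CollapseSetup (conjField reflFst (-F)) (conjField reflSnd (-G)) (-θ₂) (-θ₁) := by
  obtain ⟨g, hgc, hg0, hg⟩ := hs.conj
  refine ⟨reflFst.contDiff.comp (hs.smooth.neg.comp reflFst.contDiff),
    (reflSnd.lipschitz.locallyLipschitz).comp ((hs.lipschitz.neg_field).comp
      reflSnd.lipschitz.locallyLipschitz), ?_, by linarith [hs.lt], by linarith [hs.le], fun θ => ?_,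
    fun θ hθ => ?_, fun q => g (reflFst q), hgc.comp reflFst.continuous.continuousOn fun q hq => hq,
    fun q hq => hg0 _ hq, fun q hq => ?_⟩
  · rw [conjField, map_zero, Pi.neg_apply, hs.zero, neg_zero, map_zero]
  · simp [conjField, hs.boundary]
  · have := hs.pos (-θ) ⟨by linarith [hθ.2], by linarith [hθ.1]⟩
    simpa [conjField] using this
  · rw [conjField, fderiv_collapse_reflFst, Pi.neg_apply, map_neg, hg (reflFst q) hq, collapse_reflFst]
    simp only [conjField, Pi.neg_apply, map_neg, map_smul, smul_neg]

lemma FieldCollapse.neg {G : ℝ × ℝ → ℝ × ℝ} {θ₁ θ₂ : ℝ} {S₁ S₂ : Set (ℝ × ℝ)} {κ : SectorType}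
    (h : FieldCollapse G θ₁ θ₂ S₁ S₂ κ) : FieldCollapse (-G) θ₁ θ₂ S₁ S₂ κ := by
  obtain ⟨T, ⟨h0, c, hc⟩, hT⟩ := h
  exact ⟨T, ⟨by simp [h0], c, hc.neg⟩, hT⟩

lemma FieldCollapse.refl {G : ℝ × ℝ → ℝ × ℝ} {θ₁ θ₂ : ℝ} {S₁ S₂ : Set (ℝ × ℝ)} {κ : SectorType}
    (h : FieldCollapse G θ₁ θ₂ S₁ S₂ κ) :
    FieldCollapse (conjField reflSnd G) (-θ₂) (-θ₁) (reflFst '' S₂) (reflFst '' S₁) κ := by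
  obtain ⟨T, ⟨h0, c, hc⟩, m₁, m₂, h1, h12, h2, hm₁, hm₂, N, hN, he⟩ := h
  refine ⟨reflSnd '' T, ⟨by rw [conjField, map_zero, h0, map_zero], _, by
    have := hc.conj reflSnd_reflSnd; rwa [map_zero] at this⟩, -m₂, -m₁, by linarith, by linarith,
    by linarith, ⟨(m₂, 0), hm₂, rfl⟩, ⟨(m₁, 0), hm₁, rfl⟩, reflSnd ⁻¹' N,
    reflSnd.continuous.continuousAt.preimage_mem_nhds (by rwa [map_zero]), ?_⟩
  have hinj : Function.Injective reflSnd := fun a b h => by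
    rw [← reflSnd_reflSnd a, h, reflSnd_reflSnd]
  have hpre : reflSnd ⁻¹' N = reflSnd '' N := by
    ext w
    exact ⟨fun h => ⟨_, h, reflSnd_reflSnd w⟩, by
      rintro ⟨x, hx, rfl⟩; simpa only [mem_preimage, reflSnd_reflSnd] using hx⟩
  have hset : reflFst '' (Icc m₁ m₂ ×ˢ Ici (0 : ℝ)) = Icc (-m₂) (-m₁) ×ˢ Ici (0 : ℝ) := by
    ext q
    constructor
    · rintro ⟨x, ⟨hx, hx'⟩, rfl⟩
      exact ⟨⟨neg_le_neg hx.2, neg_le_neg hx.1⟩, hx'⟩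
    · rintro ⟨hq, hq'⟩
      exact ⟨reflFst q, ⟨⟨by simp only [reflFst_apply]; linarith [hq.2],
        by simp only [reflFst_apply]; linarith [hq.1]⟩, hq'⟩, reflFst_reflFst q⟩
  rw [hpre, ← image_inter hinj, he, image_inter hinj, image_image]
  congr 1
  rw [← hset, union_comm (reflFst '' S₂), ← image_union, ← image_union, image_image]
  simp only [collapse_reflFst]

/-! ### Union of two sectors -/

lemma IsLocalChart.axis_fst_mem {F : ℝ × ℝ → ℝ × ℝ} {κ : SectorType} {S : Set (ℝ × ℝ)} {σ θ₀ d : ℝ}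
    {k : ℝ × ℝ → ℝ × ℝ} (hk : IsLocalChart F κ S σ θ₀ d k) {x : ℝ} (hx : x ∈ Icc (0 : ℝ) 2) :
    ((k (x, 0)).1, (0 : ℝ)) ∈ S := by
  have h := hk.subset (x, 0) ⟨by simp only; nlinarith [hx.1, hx.2], le_rfl⟩
  rwa [← Prod.mk.eta (p := k (x, 0)), hk.axis x hx] at h

/-- A hyperbolic sector at the second end only prolongs the trajectories of the first one, so the
type `κ` is kept, whatever it is. -/
theorem FieldCollapse.of_hyperbolic {F G : ℝ × ℝ → ℝ × ℝ} {θ₁ θ₂ : ℝ}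
    (hs : CollapseSetup F G θ₁ θ₂) {κ : SectorType} {S₁ S₂ : Set (ℝ × ℝ)} {h₁ h₂ : ℝ × ℝ → ℝ × ℝ}
    (hs₁ : IsSideSector F κ S₁ 1 θ₁ θ₂ h₁) (hs₂ : IsSideSector (-F) .hyperbolic S₂ (-1) θ₂ θ₁ h₂) :
    FieldCollapse G θ₁ θ₂ S₁ S₂ κ := by
  obtain ⟨d, k₁, k₂, α, β, l₀, ε₀, Y, c, c₂, r₁, r₂, lam, J⟩ :=
    exists_junction hs.smooth hs.boundary hs.lt hs.pos hs₁ hs₂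
  refine FieldCollapse.of_isUnion hs (fun q hq => ?_) (fun q hq => ?_) ?_ J.axis_lt.le ?_ ?_ ?_
    J.hyp_isUnion
  · rw [← hs₁.chart.image] at hq
    obtain ⟨a, ha, rfl⟩ := hq
    exact hs₁.snd_nonneg ha
  · rw [← hs₂.chart.image] at hq
    obtain ⟨a, ha, rfl⟩ := hq
    exact hs₂.snd_nonneg ha
  · linarith [J.chart₁.lt_axis (x := 5 / 4) (by norm_num)]
  · linarith [J.chart₂.lt_axis (x := 5 / 4) (by norm_num)]
  · exact J.chart₁.axis_fst_mem (by norm_num)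
  · exact J.chart₂.axis_fst_mem (by norm_num)

/-- Reflection of the angle exchanges the two ends; time is reversed to keep the direction along the
arc, and both changes are undone in the conclusion. -/
theorem FieldCollapse.of_hyperbolic' {F G : ℝ × ℝ → ℝ × ℝ} {θ₁ θ₂ : ℝ}
    (hs : CollapseSetup F G θ₁ θ₂) {κ : SectorType} {S₁ S₂ : Set (ℝ × ℝ)} {h₁ h₂ : ℝ × ℝ → ℝ × ℝ}
    (hs₁ : IsSideSector F .hyperbolic S₁ 1 θ₁ θ₂ h₁) (hs₂ : IsSideSector (-F) κ S₂ (-1) θ₂ θ₁ h₂) :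
    FieldCollapse G θ₁ θ₂ S₁ S₂ κ := by
  have h2 := hs₂.refl
  have h1 := hs₁.refl
  rw [neg_neg] at h2
  have := (FieldCollapse.of_hyperbolic hs.refl h2 (by
    rwa [conjField_neg, neg_neg])).refl.neg
  rw [conjField_conjField reflSnd_reflSnd, image_image_of_involutive reflFst_reflFst,
    image_image_of_involutive reflFst_reflFst, neg_neg, neg_neg, neg_neg] at this
  exact this

theorem FieldCollapse.of_parabolic {F G : ℝ × ℝ → ℝ × ℝ} {θ₁ θ₂ : ℝ}
    (hs : CollapseSetup F G θ₁ θ₂) {S₁ S₂ : Set (ℝ × ℝ)} {h₁ h₂ : ℝ × ℝ → ℝ × ℝ}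
    (hs₁ : IsSideSector F .parabolic S₁ 1 θ₁ θ₂ h₁)
    (hs₂ : IsSideSector (-F) .parabolic S₂ (-1) θ₂ θ₁ h₂) :
    FieldCollapse G θ₁ θ₂ S₁ S₂ .elliptic := by
  obtain ⟨d, k₁, k₂, α, β, l₀, ε₀, Y, c, c₂, r₁, r₂, lam, J⟩ :=
    exists_junction hs.smooth hs.boundary hs.lt hs.pos hs₁ hs₂
  refine FieldCollapse.of_isUnion hs (fun q hq => ?_) (fun q hq => ?_) ?_ J.axis_lt.le ?_ ?_ ?_
    J.par_isUnion
  · rw [← hs₁.chart.image] at hq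
    obtain ⟨a, ha, rfl⟩ := hq
    exact hs₁.snd_nonneg ha
  · rw [← hs₂.chart.image] at hq
    obtain ⟨a, ha, rfl⟩ := hq
    exact hs₂.snd_nonneg ha
  · linarith [J.chart₁.lt_axis (x := 5 / 4) (by norm_num)]
  · linarith [J.chart₂.lt_axis (x := 5 / 4) (by norm_num)]
  · exact J.chart₁.axis_fst_mem (by norm_num)
  · exact J.chart₂.axis_fst_mem (by norm_num)

/-! ### The polynomial system -/

lemma MvPolynomial.contDiff_eval {σ : Type*} {E : Type*} [NormedAddCommGroup E] [NormedSpace ℝ E]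
    {k : WithTop ℕ∞} {f : E → σ → ℝ} (hf : ∀ i, ContDiff ℝ k fun e => f e i)
    (P : MvPolynomial σ ℝ) : ContDiff ℝ k fun e => eval (f e) P := by
  induction P using MvPolynomial.induction_on with
  | C a => simpa only [eval_C] using contDiff_const
  | add p q hp hq => simpa only [map_add] using hp.add hq
  | mul_X p i hp => simpa only [map_mul, eval_X] using hp.mul (hf i)

lemma MvPolynomial.IsHomogeneous.eval_smul {σ R : Type*} [CommSemiring R] {n : ℕ}
    {P : MvPolynomial σ R} (hP : P.IsHomogeneous n) (r : R) (x : σ → R) :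
    eval (r • x) P = r ^ n * eval x P := by
  rw [eval_eq, eval_eq, Finset.mul_sum]
  refine Finset.sum_congr rfl fun d hd => ?_
  have hdeg : ∑ i ∈ d.support, d i = n := by
    have := hP (mem_support_iff.1 hd)
    rwa [Finsupp.weight_apply, Finsupp.sum, Finset.sum_congr rfl
      fun i _ => by rw [Pi.one_apply, smul_eq_mul, mul_one]] at this
  simp only [Pi.smul_apply, smul_eq_mul, mul_pow, Finset.prod_mul_distrib]
  rw [Finset.prod_pow_eq_pow_sum, hdeg]
  ring

lemma MvPolynomial.sum_homogeneousComponent_of_le {σ R : Type*} [CommSemiring R] {n : ℕ}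
    {P : MvPolynomial σ R} (hP : P.totalDegree ≤ n) :
    ∑ k ∈ Finset.range (n + 1), homogeneousComponent k P = P := by
  conv_rhs => rw [← sum_homogeneousComponent P]
  refine (Finset.sum_subset (Finset.range_subset_range.2 (by omega)) fun k _ hk => ?_).symm
  exact homogeneousComponent_eq_zero _ _ (by simpa using hk)

lemma contDiff_vec2 {E : Type*} [NormedAddCommGroup E] [NormedSpace ℝ E] {k : WithTop ℕ∞}
    {f g : E → ℝ} (hf : ContDiff ℝ k f) (hg : ContDiff ℝ k g) (i : Fin 2) :
    ContDiff ℝ k fun e => ![f e, g e] i := by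
  fin_cases i
  exacts [hf, hg]

lemma locallyLipschitz_polyField (U V : MvPolynomial (Fin 2) ℝ) :
    LocallyLipschitz (polyField U V) := by
  have h := contDiff_vec2 (k := 1) (contDiff_fst (𝕜 := ℝ) (E := ℝ) (F := ℝ)) contDiff_snd
  exact ((MvPolynomial.contDiff_eval h U).prodMk (MvPolynomial.contDiff_eval h V)).locallyLipschitz

lemma contDiff_circleField (n : ℕ) (X Y : MvPolynomial (Fin 2) ℝ) :
    ContDiff ℝ 1 (circleField n X Y) := by
  have h := contDiff_vec2 (k := 1) (Real.contDiff_cos.comp (contDiff_fst (𝕜 := ℝ) (E := ℝ) (F := ℝ)))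
    (Real.contDiff_sin.comp contDiff_fst)
  have hs : ∀ P : ℕ → MvPolynomial (Fin 2) ℝ, ContDiff ℝ 1 fun q : ℝ × ℝ =>
      ∑ k ∈ Finset.range (n + 1), q.2 ^ (n - k) *
        MvPolynomial.eval ![Real.cos q.1, Real.sin q.1] (P k) := fun P =>
    ContDiff.sum fun k _ => (contDiff_snd.pow _).mul (MvPolynomial.contDiff_eval h (P k))
  exact (hs _).prodMk (contDiff_snd.mul (hs _)).neg

lemma circleField_zero_snd (n : ℕ) (X Y : MvPolynomial (Fin 2) ℝ) (θ : ℝ) :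
    (circleField n X Y (θ, 0)).2 = 0 := by
  simp [circleField]

lemma circleField_zero_fst (n : ℕ) (X Y : MvPolynomial (Fin 2) ℝ) (θ : ℝ) :
    (circleField n X Y (θ, 0)).1 =
      MvPolynomial.eval ![Real.cos θ, Real.sin θ] (angularPart n X Y) := by
  simp only [circleField]
  rw [Finset.sum_eq_single n, Nat.sub_self, pow_zero, one_mul]
  · intro k hk hkn
    have : k < n + 1 := Finset.mem_range.1 hk
    rw [zero_pow (by omega), zero_mul]
  · intro h
    exact absurd (Finset.mem_range.2 (Nat.lt_succ_self n)) h

lemma isHomogeneous_angularPart (k : ℕ) (X Y : MvPolynomial (Fin 2) ℝ) :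
    (angularPart k X Y).IsHomogeneous (1 + k) :=
  ((MvPolynomial.isHomogeneous_X ℝ 0).mul (MvPolynomial.homogeneousComponent_isHomogeneous k Y)).sub
    ((MvPolynomial.isHomogeneous_X ℝ 1).mul (MvPolynomial.homogeneousComponent_isHomogeneous k X))

/-- The angular part on the boundary is homogeneous in the direction, so its zeros come in opposite
pairs. Hence adjacent equilibria are at most `π` apart. -/
lemma circleField_add_pi (n : ℕ) (X Y : MvPolynomial (Fin 2) ℝ) {θ : ℝ}
    (h : circleField n X Y (θ, 0) = 0) : circleField n X Y (θ + Real.pi, 0) = 0 := by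
  refine Prod.ext ?_ (circleField_zero_snd ..)
  have h1 : (circleField n X Y (θ, 0)).1 = 0 := by rw [h]; rfl
  rw [circleField_zero_fst] at h1
  rw [circleField_zero_fst, Real.cos_add_pi, Real.sin_add_pi]
  have : ![-Real.cos θ, -Real.sin θ] = (-1 : ℝ) • ![Real.cos θ, Real.sin θ] := by
    simp
  rw [this, (isHomogeneous_angularPart n X Y).eval_smul, h1, mul_zero]
  rfl

lemma eval_div_eq {n : ℕ} {P : MvPolynomial (Fin 2) ℝ} (hP : P.totalDegree ≤ n) {ρ : ℝ}
    (hρ : 0 < ρ) (c s : ℝ) : ρ ^ n * MvPolynomial.eval ![c / ρ, s / ρ] P =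
      ∑ k ∈ Finset.range (n + 1), ρ ^ (n - k) * MvPolynomial.eval ![c, s] (homPart k P) := by
  conv_lhs => rw [← MvPolynomial.sum_homogeneousComponent_of_le hP]
  rw [map_sum, Finset.mul_sum]
  refine Finset.sum_congr rfl fun k hk => ?_
  have hk' : k ≤ n := Nat.lt_succ_iff.1 (Finset.mem_range.1 hk)
  have : ![c / ρ, s / ρ] = ρ⁻¹ • ![c, s] := by
    ext i; fin_cases i <;> simp [div_eq_inv_mul]
  rw [this, (MvPolynomial.homogeneousComponent_isHomogeneous k P).eval_smul, ← mul_assoc,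
    ← Nat.sub_add_cancel hk', pow_add, Nat.add_sub_cancel, mul_assoc (ρ ^ (n - k)), ← mul_pow,
    mul_inv_cancel₀ hρ.ne', one_pow, mul_one]

lemma circleField_eq {n : ℕ} {X Y : MvPolynomial (Fin 2) ℝ} (hX : X.totalDegree ≤ n)
    (hY : Y.totalDegree ≤ n) {q : ℝ × ℝ} (hq : 0 < q.2) :
    circleField n X Y q =
      (q.2 ^ n * (Real.cos q.1 *
          MvPolynomial.eval ![Real.cos q.1 / q.2, Real.sin q.1 / q.2] Y -
        Real.sin q.1 * MvPolynomial.eval ![Real.cos q.1 / q.2, Real.sin q.1 / q.2] X),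
      -(q.2 * (q.2 ^ n * (Real.cos q.1 *
          MvPolynomial.eval ![Real.cos q.1 / q.2, Real.sin q.1 / q.2] X +
        Real.sin q.1 * MvPolynomial.eval ![Real.cos q.1 / q.2, Real.sin q.1 / q.2] Y)))) := by
  have ex := eval_div_eq hX hq (Real.cos q.1) (Real.sin q.1)
  have ey := eval_div_eq hY hq (Real.cos q.1) (Real.sin q.1)
  rw [mul_sub, mul_add, mul_left_comm, ey, mul_left_comm, ex, mul_left_comm, ex, mul_left_comm, ey]
  simp only [circleField, Finset.mul_sum, ← Finset.sum_sub_distrib, ← Finset.sum_add_distrib,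
    angularPart, radialPart, map_sub, map_add, map_mul, MvPolynomial.eval_X, Matrix.cons_val_zero,
    Matrix.cons_val_one]
  refine Prod.ext ?_ ?_ <;> simp only [neg_inj]
  all_goals exact Finset.sum_congr rfl fun k _ => by ring

/-- The factor is `dτ/ds`, from `dt = ρ^(n-1) ds` and `dt = (u² + v²)^m dτ` with `u² + v² = 16 ρ²`.
Writing `ρ^n / ρ` avoids truncated subtraction at `n = 0`. -/
lemma StereoConjugate.exists_factor {n : ℕ} {X Y U V : MvPolynomial (Fin 2) ℝ}
    (hX : X.totalDegree ≤ n) (hY : Y.totalDegree ≤ n) (h : StereoConjugate X Y U V) :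
    ∃ g : ℝ × ℝ → ℝ, ContinuousOn g {q | 0 < q.2} ∧ (∀ q, 0 < q.2 → 0 < g q) ∧
      ∀ q, 0 < q.2 →
        fderiv ℝ collapse q (circleField n X Y q) = g q • polyField U V (collapse q) := by
  obtain ⟨-, m, hm⟩ := h
  refine ⟨fun q => q.2 ^ n / (q.2 * (16 * q.2 ^ 2) ^ m), ?_, fun q hq => by positivity,
    fun q hq => ?_⟩
  · refine ContinuousOn.div (by fun_prop) (by fun_prop) fun q hq => ?_
    have : (0 : ℝ) < q.2 := hq
    positivity
  · obtain ⟨θ, ρ⟩ := q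
    simp only at hq
    have hr := collapse_normSq (θ, ρ)
    have hne : collapse (θ, ρ) ≠ 0 := fun h0 => by
      rw [h0] at hr
      simp only [Prod.fst_zero, Prod.snd_zero] at hr
      nlinarith
    obtain ⟨hu, hv⟩ := hm (collapse (θ, ρ)).1 (collapse (θ, ρ)).2 hne
    have hsq : (collapse (θ, ρ)).1 ^ 2 + (collapse (θ, ρ)).2 ^ 2 = 16 * ρ ^ 2 := by
      rw [hr]; ring
    have e1 : 4 * (collapse (θ, ρ)).1 / (16 * ρ ^ 2) = Real.cos θ / ρ := by
      simp only [collapse]; field_simp; ring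
    have e2 : 4 * (collapse (θ, ρ)).2 / (16 * ρ ^ 2) = Real.sin θ / ρ := by
      simp only [collapse]; field_simp; ring
    rw [hsq, e1, e2] at hu hv
    rw [fderiv_collapse, circleField_eq hX hY hq]
    simp only [polyField, hu, hv]
    simp only [collapse, Prod.smul_mk, smul_eq_mul]
    have hp : (0 : ℝ) < (16 * ρ ^ 2) ^ m := by positivity
    ext <;> simp only <;> field_simp <;> ring

lemma AdjacentAtInfinity.le {n : ℕ} {X Y : MvPolynomial (Fin 2) ℝ} {θ₁ θ₂ : ℝ}
    (h : AdjacentAtInfinity n X Y θ₁ θ₂) : θ₂ ≤ θ₁ + Real.pi := by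
  by_contra hc
  exact h.between (θ₁ + Real.pi) ⟨by linarith [Real.pi_pos], not_le.1 hc⟩
    (circleField_add_pi n X Y h.left)

lemma AdjacentAtInfinity.pos_or_neg {n : ℕ} {X Y : MvPolynomial (Fin 2) ℝ} {θ₁ θ₂ : ℝ}
    (h : AdjacentAtInfinity n X Y θ₁ θ₂) :
    (∀ θ ∈ Ioo θ₁ θ₂, 0 < (circleField n X Y (θ, 0)).1) ∨
      ∀ θ ∈ Ioo θ₁ θ₂, (circleField n X Y (θ, 0)).1 < 0 := by
  have hne : ∀ θ ∈ Ioo θ₁ θ₂, (circleField n X Y (θ, 0)).1 ≠ 0 := fun θ hθ h0 =>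
    h.between θ hθ (Prod.ext h0 (circleField_zero_snd ..))
  have hcont : ContinuousOn (fun θ : ℝ => (circleField n X Y (θ, 0)).1) (Ioo θ₁ θ₂) :=
    ((continuous_fst.comp (contDiff_circleField n X Y).continuous).comp
      (by fun_prop : Continuous fun θ : ℝ => (θ, (0 : ℝ)))).continuousOn
  by_contra! hc
  obtain ⟨⟨a, ha, ha'⟩, b, hb, hb'⟩ := hc
  obtain ⟨c, hc, hc'⟩ := isPreconnected_Ioo.intermediate_value ha hb hcont ⟨ha', hb'⟩
  exact hne c hc hc'

lemma IsExteriorSector.exists_chart {n : ℕ} {X Y : MvPolynomial (Fin 2) ℝ} {θ : ℝ} {A : Set ℝ}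
    {κ : SectorType} {S : Set (ℝ × ℝ)} {F : ℝ × ℝ → ℝ × ℝ}
    (hF : F = circleField n X Y ∨ F = -circleField n X Y)
    (h : IsExteriorSector n X Y θ A κ S) : ∃ k, IsSectorChart F (θ, 0) κ S k ∧
      (∀ x ∈ Ioc (0 : ℝ) 1, (k (x, 0)).1 ∈ A ∧ (k (x, 0)).2 = 0) ∧
      ∀ a ∈ halfDisc, ¬ (a.2 = 0 ∧ 0 ≤ a.1) → 0 < (k a).2 := by
  obtain ⟨-, k, hk, h'⟩ := h
  refine ⟨k, ?_, h'⟩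
  rcases hF with rfl | rfl
  exacts [hk, hk.neg]

lemma IsExteriorSector.exists_isSideSector_left {n : ℕ} {X Y : MvPolynomial (Fin 2) ℝ} {θ₁ θ₂ : ℝ}
    {κ : SectorType} {S : Set (ℝ × ℝ)} {F : ℝ × ℝ → ℝ × ℝ}
    (hF : F = circleField n X Y ∨ F = -circleField n X Y)
    (hpos : ∀ θ ∈ Ioo θ₁ θ₂, 0 < (F (θ, 0)).1)
    (h : IsExteriorSector n X Y θ₁ (Ioo θ₁ θ₂) κ S) : ∃ k, IsSideSector F κ S 1 θ₁ θ₂ k := by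
  obtain ⟨k, hk, hax, hp⟩ := h.exists_chart hF
  refine ⟨k, Or.inl rfl, hk, fun x hx => ?_, hp, fun x hx => ?_⟩
  · have := hax x hx
    simp only [one_mul]
    exact ⟨this.1.1, this.1.2, this.2⟩
  · have := hax x hx
    rw [one_mul, ← Prod.mk.eta (p := k (x, 0)), this.2]
    exact hpos _ this.1

lemma IsExteriorSector.exists_isSideSector_right {n : ℕ} {X Y : MvPolynomial (Fin 2) ℝ} {θ₁ θ₂ : ℝ}
    {κ : SectorType} {S : Set (ℝ × ℝ)} {F : ℝ × ℝ → ℝ × ℝ}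
    (hF : F = circleField n X Y ∨ F = -circleField n X Y)
    (hpos : ∀ θ ∈ Ioo θ₁ θ₂, 0 < (F (θ, 0)).1)
    (h : IsExteriorSector n X Y θ₂ (Ioo θ₁ θ₂) κ S) : ∃ k, IsSideSector (-F) κ S (-1) θ₂ θ₁ k := by
  obtain ⟨k, hk, hax, hp⟩ := h.exists_chart hF
  refine ⟨k, Or.inr rfl, hk.neg, fun x hx => ?_, hp, fun x hx => ?_⟩
  · have := hax x hx
    exact ⟨by linarith [this.1.2], by linarith [this.1.1], this.2⟩
  · have := hax x hx
    rw [Pi.neg_apply, Prod.fst_neg, neg_mul_neg, one_mul, ← Prod.mk.eta (p := k (x, 0)), this.2]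
    exact hpos _ this.1

/-- Without zeros on the open arc the boundary movement has a constant sign. If it is negative, both
fields are replaced by their opposites, and the same factor conjugates them. -/
lemma AdjacentAtInfinity.exists_collapseSetup {n : ℕ} {X Y U V : MvPolynomial (Fin 2) ℝ}
    (hX : X.totalDegree ≤ n) (hY : Y.totalDegree ≤ n) (hUV : StereoConjugate X Y U V)
    (hM : polyField U V 0 = 0) {θ₁ θ₂ : ℝ} (h : AdjacentAtInfinity n X Y θ₁ θ₂) :
    ∃ F G, (F = circleField n X Y ∨ F = -circleField n X Y) ∧
      (G = polyField U V ∨ G = -polyField U V) ∧ CollapseSetup F G θ₁ θ₂ := by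
  obtain ⟨g, hgc, hg0, hg⟩ := hUV.exists_factor hX hY
  rcases h.pos_or_neg with hp | hp
  · exact ⟨_, _, Or.inl rfl, Or.inl rfl, contDiff_circleField n X Y, locallyLipschitz_polyField U V,
      hM, h.lt, h.le, circleField_zero_snd n X Y, hp, g, hgc, hg0, hg⟩
  · refine ⟨_, _, Or.inr rfl, Or.inr rfl, (contDiff_circleField n X Y).neg,
      (locallyLipschitz_polyField U V).neg_field, by rw [Pi.neg_apply, hM, neg_zero], h.lt, h.le,
      fun θ => by rw [Pi.neg_apply, Prod.snd_neg, circleField_zero_snd, neg_zero],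
      fun θ hθ => by rw [Pi.neg_apply, Prod.fst_neg]; exact neg_pos.2 (hp θ hθ), g, hgc, hg0,
      fun q hq => by rw [Pi.neg_apply, map_neg, hg q hq, Pi.neg_apply, smul_neg]⟩

theorem mainTheorem5 (n : ℕ) (X Y : MvPolynomial (Fin 2) ℝ) (hD : IsPolySystem n X Y)
    (hns : ProjectivelyNonsingular n X Y)
    (U V : MvPolynomial (Fin 2) ℝ) (hUV : StereoConjugate X Y U V)
    (hM : polyField U V 0 = 0)
    (θ₁ θ₂ : ℝ) (hadj : AdjacentAtInfinity n X Y θ₁ θ₂)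
    (κ₁ κ₂ : SectorType) (S₁ S₂ : Set (ℝ × ℝ))
    (hS₁ : IsExteriorSector n X Y θ₁ (Set.Ioo θ₁ θ₂) κ₁ S₁)
    (hS₂ : IsExteriorSector n X Y θ₂ (Set.Ioo θ₁ θ₂) κ₂ S₂) :
    (κ₁ = .parabolic ∧ κ₂ = .parabolic →
      CollapseToSector U V θ₁ θ₂ S₁ S₂ .elliptic) ∧
    (κ₁ = .hyperbolic ∧ κ₂ = .hyperbolic →
      CollapseToSector U V θ₁ θ₂ S₁ S₂ .hyperbolic) ∧
    (κ₁ = .parabolic ∧ κ₂ = .hyperbolic ∨ κ₁ = .hyperbolic ∧ κ₂ = .parabolic →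
      CollapseToSector U V θ₁ θ₂ S₁ S₂ .parabolic) ∧
    (κ₁ = .hyperbolic ∧ κ₂ = .elliptic ∨ κ₁ = .elliptic ∧ κ₂ = .hyperbolic →
      CollapseToSector U V θ₁ θ₂ S₁ S₂ .elliptic) := by
  obtain ⟨F, G, hF, hG, hs⟩ := hadj.exists_collapseSetup hD.degX hD.degY hUV hM
  obtain ⟨h₁, hs₁⟩ := hS₁.exists_isSideSector_left hF hs.pos
  obtain ⟨h₂, hs₂⟩ := hS₂.exists_isSideSector_right hF hs.pos
  have key : ∀ κ, FieldCollapse G θ₁ θ₂ S₁ S₂ κ → CollapseToSector U V θ₁ θ₂ S₁ S₂ κ := by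
    intro κ h
    rcases hG with rfl | rfl
    · exact h
    · have := h.neg
      rw [neg_neg] at this
      exact this
  refine ⟨?_, ?_, ?_, ?_⟩
  · rintro ⟨rfl, rfl⟩
    exact key _ (.of_parabolic hs hs₁ hs₂)
  · rintro ⟨rfl, rfl⟩
    exact key _ (.of_hyperbolic hs hs₁ hs₂)
  · rintro (⟨rfl, rfl⟩ | ⟨rfl, rfl⟩)
    · exact key _ (.of_hyperbolic hs hs₁ hs₂)
    · exact key _ (.of_hyperbolic' hs hs₁ hs₂)
  · rintro (⟨rfl, rfl⟩ | ⟨rfl, rfl⟩)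
    · exact key _ (.of_hyperbolic' hs hs₁ hs₂)
    · exact key _ (.of_hyperbolic hs hs₁ hs₂)
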